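/- **Setting.** Let $K$ be a number field, $\mathfrak o_K$ its ring of integers. For a maximal ideal $\mathfrak p$ of $\mathfrak o_K$ normalize $|\cdot|_{\mathfrak p}$ by $|\varpi|_{\mathfrak p}=N(\mathfrak p)^{-1}$ for a uniformizer $\varpi$. *Analytic type.* For a real number $a\ge 0$ let $G_{\mathrm{an},a}$ be the set of $n$-tuples $f=(f_1,\dots,f_n)$, $f_i=\sum_I f_{i,I}X^I\in K[[X_1,\dots,X_n]]$, with $f(0)=0$ and $Df(0)\in \mathrm{GL}_n(K)$, such that each $f_i$ has a positive radius of convergence at each place of $K$ (finite places and embeddings $K\hookrightarrow\mathbf C$), and such that there are a finite set $S$ of maximal ideals of $\mathfrak o_K$ and real numbers $C_{\mathfrak p}\ge 1$ $(\mathfrak p\notin S)$ with $\prod_{\mathfrak p\notin S}C_{\mathfrak p}<\infty$ and $$|f_{i,I}|_{\mathfrak p}\le \frac{C_{\mathfrak p}^{|I|}}{|I!|_{\mathfrak p}^{a}}\qquad\text{for all } \mathfrak p\notin S,\ \text{all } i \text{ and all multi-indices } I ,$$ where $|I|=\sum_j i_j$ and $I!=\prod_j i_j!$. Let $X$ be a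 projective variety over $K$, $P$ a smooth $K$-rational point of $X$, and $\widehat V$ a smooth formal subscheme of dimension $d$ of the formal completion $\widehat X_P$. An étale map $x=(x_1,\dots,x_n)$ from an open neighbourhood of $P$ to $\mathbf A^n_K$ with $x(P)=0$ identifies $\widehat X_P$ with $\widehat{\mathbf A}^n_{K,0}$; let $\alpha(X,\widehat V,P)\in[0,\infty]$ be the infimum of the $a\ge 0$ for which some $f\in G_{\mathrm{an},a}$ satisfies $f^*(x_*\widehat V)=\widehat{\mathbf A}^d_{K,0}\times\{0\}^{n-d}$. This number does not depend on the choice of $x$. For $\alpha\geq 0$ one says that $\widehat V$ is *$\alpha$-analytic* if $\alpha(X,\widehat V,P)\le\alpha$; explicitly, this means that étale maps $x$ as above exist and that for each of them the infimum is at most $\alpha$. *Foliations.* An algebraic foliation $F$ of dimension $d$ on a smooth open subset $U$ of $X$ is an involutive subbundle of rank $d$ of the tangent bundle $TU$. The germ of formal leaf of $F$ through $P\in U(K)$ is the smooth formal subscheme $\widehat V$ of dimension $d$ of $\widehat X_P$ which is tangent to $F$, that is, whose ideal in $\widehat{\mathcal O}_{X,P}$ is stable under the derivations in $F$. *$\mathfrak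 p$-curvature.* For some positive integer $N$ there are a smooth model $\mathscr U$ of $U$, of finite type over $\mathfrak o_K[1/N]$, and an involutive subbundle $\mathscr F$ of $T\mathscr U=T_{\mathscr U/\mathfrak o_K[1/N]}$ with generic fibre $F$. For a maximal ideal $\mathfrak p$ of $\mathfrak o_K[1/N]$ with residue field $\mathbf F_{\mathfrak p}$ of characteristic $p$, the $\mathfrak p$-curvature is said to vanish if the subbundle $\mathscr F\otimes\mathbf F_{\mathfrak p}$ of $T(\mathscr U\otimes\mathbf F_{\mathfrak p})$ is stable under $D\mapsto D^p$. Up to finitely many $\mathfrak p$ this does not depend on the choice of $N,\mathscr U,\mathscr F$; almost every $\mathfrak p$-curvature of $F$ is said to vanish if, for some choice of $(N,\mathscr U,\mathscr F)$, the $\mathfrak p$-curvature vanishes for all but finitely many $\mathfrak p$. **Lemma.** Let $X$ be a projective variety over the number field $K$, let $P$ be a smooth $K$-rational point of $X$, let $F$ be an algebraic foliation on a smooth open subset $U$ of $X$ containing $P$, and let $\widehat V$ be the germ of formal leaf of $F$ through $P$. If almost every $\mathfrak p$-curvature of $F$ vanishes (all but finitely many), then $\widehat V$ is $0$-analytic.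 -/

import Mathlib

universe u

open AlgebraicGeometry CategoryTheory
open scoped NumberField NNReal ENNReal

noncomputable section

namespace FormalLeaf

/-! ### Derivations and the tangent sheaf -/

/-- The module of `R`-linear derivations of an `R`-algebra `A` with structure map `r : R → A`:
additive derivations `A → A` killing the image of `R`. -/
def relDer {R A : Type*} [CommRing R] [CommRing A] (r : R →+* A) :
    Submodule A (Derivation ℤ A A) where
  carrier := {D | ∀ c, D (r c) = 0}
  add_mem' {D E} hD hE c := by simp [hD c, hE c]
  zero_mem' c := by simp
  smul_mem' a D hD c := by simp [hD c]

/-- Let `φ : A → B` be a ring homomorphism, `M` a module of derivations of `A`, and `r : R → B`.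
This is the `B`-module generated by the `R`-linear derivations of `B` that are compatible
through `φ` with a member of `M`. It is used for the restriction to a smaller open set, for the
generic fibre, for the reduction modulo a prime and for the completion at a point. -/
def pullbackDer {R A B : Type*} [CommRing R] [CommRing A] [CommRing B]
    (r : R →+* B) (φ : A →+* B) (M : Submodule A (Derivation ℤ A A)) :
    Submodule B (Derivation ℤ B B) :=
  Submodule.span B {D' | D' ∈ relDer r ∧ ∃ D ∈ M, ∀ a, D' (φ a) = φ (D a)}

/-- The structure map `R → Γ(Y, W)` of an open subset of a scheme over `Spec R`. -/
def baseHom {R : CommRingCat.{u}} {Y : Scheme.{u}} (π : Y ⟶ Spec R) (W : Y.Opens) :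
    R →+* Γ(Y, W) :=
  ((Scheme.ΓSpecIso R).inv ≫ π.appLE ⊤ W le_top).hom

/-- An algebraic foliation of dimension `d` on a smooth scheme `Y` over `Spec R`: an involutive
subbundle of rank `d` of the relative tangent bundle. It is given by its sections over the affine
open subsets, as submodules of the modules of `R`-derivations. -/
structure Foliation {R : CommRingCat.{u}} {Y : Scheme.{u}} (π : Y ⟶ Spec R) (d : ℕ) where
  /-- the sections over an affine open subset -/
  sections (W : Y.affineOpens) : Submodule Γ(Y, W.1) (Derivation ℤ Γ(Y, W.1) Γ(Y, W.1))
  sections_le (W : Y.affineOpens) : sections W ≤ relDer (baseHom π W.1)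
  /-- quasi-coherence -/
  sections_restrict (W W' : Y.affineOpens) (h : W'.1 ≤ W.1) :
    sections W' =
      pullbackDer (baseHom π W'.1) (Y.presheaf.map (homOfLE h).op).hom (sections W)
  /-- locally the tangent bundle has a frame whose first `d` members form a frame of the
  foliation -/
  exists_frame (y : Y) : ∃ W : Y.affineOpens, y ∈ W.1 ∧
    ∃ (m : ℕ) (b : Module.Basis (Fin d ⊕ Fin m) Γ(Y, W.1) (relDer (baseHom π W.1))),
      sections W = Submodule.span Γ(Y, W.1)
        (Set.range fun i : Fin d => (b (Sum.inl i) : Derivation ℤ Γ(Y, W.1) Γ(Y, W.1)))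
  involutive (W : Y.affineOpens) : ∀ D ∈ sections W, ∀ E ∈ sections W, ⁅D, E⁆ ∈ sections W

/-! ### Models and `𝔭`-curvatures -/

/-- The ring `𝓞 K [1/N]`, as a subring of `K`. -/
abbrev ringAway (K : Type u) [Field K] (N : ℕ) : Subalgebra (𝓞 K) K :=
  Algebra.adjoin (𝓞 K) {((N : K))⁻¹}

/-- The morphism `Spec K → Spec 𝓞 K [1/N]`. -/
def genericPt (K : Type u) [Field K] (N : ℕ) :
    Spec (CommRingCat.of K) ⟶ Spec (CommRingCat.of (ringAway K N)) :=
  Spec.map (CommRingCat.ofHom (algebraMap (ringAway K N) K))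

/-- A model of the foliated scheme `(U, F)` over `𝓞 K [1/N]`: a smooth scheme of finite type
with generic fibre `U`, and a foliation on it with generic fibre `F`. -/
structure Model {K : Type u} [Field K] {U : Scheme.{u}} {π : U ⟶ Spec (CommRingCat.of K)}
    {d : ℕ} (F : Foliation π d) (N : ℕ) where
  /-- the scheme over `𝓞 K [1/N]` -/
  scheme : Scheme.{u}
  /-- its structure morphism -/
  str : scheme ⟶ Spec (CommRingCat.of (ringAway K N))
  smooth : Smooth str
  quasiCompact : QuasiCompact str
  /-- the inclusion of the generic fibre -/
  incl : U ⟶ scheme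
  isPullback : IsPullback incl π str (genericPt K N)
  /-- the foliation on the model -/
  fol : Foliation str d
  fol_generic (W : scheme.affineOpens) (W' : U.affineOpens) (h : W'.1 ≤ incl ⁻¹ᵁ W.1) :
    F.sections W' =
      pullbackDer (baseHom π W'.1) (incl.appLE W.1 W'.1 h).hom (fol.sections W)

/-- The foliation of the model, reduced modulo `𝔭`, is stable under `p`-th powers, where `p` is
the characteristic of the residue field at `𝔭`. Over an affine open subset `W` with ring `B`, the
special fibre has ring `B ⧸ 𝔭 B`, and the reduced foliation is generated by the derivations
induced on `B ⧸ 𝔭 B` by those in the foliation. -/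
def Model.PCurvatureVanishes {K : Type u} [Field K] {U : Scheme.{u}}
    {π : U ⟶ Spec (CommRingCat.of K)} {d : ℕ} {F : Foliation π d} {N : ℕ} (M : Model F N)
    (𝔭 : MaximalSpectrum (ringAway K N)) : Prop :=
  ∀ W : M.scheme.affineOpens,
    let β : ringAway K N →+* Γ(M.scheme, W.1) := baseHom M.str W.1
    let red := Ideal.Quotient.mk (𝔭.asIdeal.map β)
    let Fbar := pullbackDer (red.comp β) red (M.fol.sections W)
    ∀ D ∈ Fbar, ∃ E ∈ Fbar, ∀ b, E b = D^[ringChar (ringAway K N ⧸ 𝔭.asIdeal)] b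

/-- All but finitely many `𝔭`-curvatures of the foliation vanish. -/
def Foliation.AlmostAllPCurvaturesVanish {K : Type u} [Field K] {U : Scheme.{u}}
    {π : U ⟶ Spec (CommRingCat.of K)} {d : ℕ} (F : Foliation π d) : Prop :=
  ∃ N : ℕ, 0 < N ∧ ∃ M : Model F N,
    {𝔭 : MaximalSpectrum (ringAway K N) | ¬ M.PCurvatureVanishes 𝔭}.Finite

/-! ### Formal subschemes and formal leaves -/

attribute [local instance] MvPolynomial.gradedAlgebra

/-- A closed immersion into some projective space `ℙ^m` over `K` exists. -/
def IsProjectiveOver {K : Type u} [Field K] {X : Scheme.{u}}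
    (π : X ⟶ Spec (CommRingCat.of K)) : Prop :=
  ∃ (m : ℕ) (i : X ⟶ Proj (MvPolynomial.homogeneousSubmodule (Fin (m + 1)) K)),
    IsClosedImmersion i ∧
      i ≫ Proj.toSpecZero (MvPolynomial.homogeneousSubmodule (Fin (m + 1)) K) ≫
        Spec.map (CommRingCat.ofHom
          (algebraMap K (MvPolynomial.homogeneousSubmodule (Fin (m + 1)) K 0))) = π

/-- The underlying point of a morphism `Spec K → X`. -/
def ratPoint {K : Type u} [Field K] {X : Scheme.{u}} (P : Spec (CommRingCat.of K) ⟶ X) : X :=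
  P (IsLocalRing.closedPoint K)

/-- The completed local ring of `X` at `x`: the ring of functions of the formal completion. -/
abbrev CompletedStalk (X : Scheme.{u}) (x : X) : Type u :=
  AdicCompletion (IsLocalRing.maximalIdeal (X.presheaf.stalk x)) (X.presheaf.stalk x)

/-- The structure map from `K` to the local ring. -/
def constStalk {K : Type u} [Field K] {X : Scheme.{u}} (π : X ⟶ Spec (CommRingCat.of K))
    (x : X) : K →+* X.presheaf.stalk x :=
  (X.presheaf.germ ⊤ x trivial).hom.comp (baseHom π ⊤)

/-- The structure map from `K` to the completed local ring. -/
def constHat {K : Type u} [Field K] {X : Scheme.{u}} (π : X ⟶ Spec (CommRingCat.of K))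
    (x : X) : K →+* CompletedStalk X x :=
  (algebraMap (X.presheaf.stalk x) (CompletedStalk X x)).comp (constStalk π x)

/-- The germ at `x ∈ U`, in the local ring of `X`, of a function on an open subset of `U`. -/
def germAt {X : Scheme.{u}} (U : X.Opens) (x : X) (hx : x ∈ U) (W : U.toScheme.Opens)
    (hW : (⟨x, hx⟩ : U) ∈ W) : Γ(U.toScheme, W) →+* X.presheaf.stalk x :=
  (U.toScheme.presheaf.germ W ⟨x, hx⟩ hW ≫ (U.stalkIso ⟨x, hx⟩).hom).hom

/-- A smooth formal subscheme of dimension `d` of the formal completion of `X` at the rational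
point `P`: an ideal of the completed local ring whose quotient is `K[[t₁, …, t_d]]`. -/
structure SmoothFormalSubscheme {K : Type u} [Field K] {X : Scheme.{u}}
    (π : X ⟶ Spec (CommRingCat.of K)) (P : Spec (CommRingCat.of K) ⟶ X) (d : ℕ) where
  /-- the defining ideal -/
  ideal : Ideal (CompletedStalk X (ratPoint P))
  smooth : ∃ e : MvPowerSeries (Fin d) K ≃+* CompletedStalk X (ratPoint P) ⧸ ideal,
    ∀ c : K, e (MvPowerSeries.C c) = Ideal.Quotient.mk ideal (constHat π (ratPoint P) c)

/-- `V` is the germ of formal leaf through `P` of the foliation `F` on the open subset `U`: the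
smooth formal subscheme whose dimension is the rank of `F` and which is tangent to `F`, that is,
whose ideal is stable under the derivations of the completed local ring given by `F`. -/
def SmoothFormalSubscheme.IsFormalLeaf {K : Type u} [Field K] {X : Scheme.{u}}
    {π : X ⟶ Spec (CommRingCat.of K)} {P : Spec (CommRingCat.of K) ⟶ X} {d : ℕ}
    (V : SmoothFormalSubscheme π P d) {U : X.Opens} (hPU : ratPoint P ∈ U)
    (F : Foliation (U.ι ≫ π) d) : Prop :=
  ∀ (W : U.toScheme.affineOpens) (hW : (⟨ratPoint P, hPU⟩ : U) ∈ W.1),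
    ∀ D ∈ pullbackDer (constHat π (ratPoint P))
        ((algebraMap (X.presheaf.stalk (ratPoint P)) (CompletedStalk X (ratPoint P))).comp
          (germAt U (ratPoint P) hPU W.1 hW)) (F.sections W),
      ∀ g ∈ V.ideal, D g ∈ V.ideal

/-! ### Formal automorphisms of affine space with growth conditions -/

/-- A power series has a positive radius of convergence for an absolute value. -/
def PosRadius {K : Type u} [Field K] {n : ℕ} (abv : K → ℝ) (g : MvPowerSeries (Fin n) K) :
    Prop :=
  ∃ r : ℝ, 0 < r ∧ ∃ C : ℝ, ∀ I : Fin n →₀ ℕ, abv (g.coeff I) * r ^ I.degree ≤ C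

/-- The factorial of a multi-index. -/
def multiFactorial {n : ℕ} (I : Fin n →₀ ℕ) : ℕ := ∏ j, (I j).factorial

/-- The group of formal automorphisms of affine `n`-space at the origin whose components have a
positive radius of convergence at each place. -/
structure IsAnalyticAut {K : Type u} [Field K] [NumberField K] {n : ℕ}
    (f : Fin n → MvPowerSeries (Fin n) K) : Prop where
  constantCoeff_eq (i : Fin n) : (f i).constantCoeff = 0
  jacobian : IsUnit (Matrix.of fun i j => (f i).coeff (Finsupp.single j 1)).det
  posRadius_arch (σ : K →+* ℂ) (i : Fin n) : PosRadius (fun c => ‖σ c‖) (f i)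
  posRadius_finite (v : IsDedekindDomain.HeightOneSpectrum (𝓞 K)) (i : Fin n) :
    PosRadius (NumberField.HeightOneSpectrum.adicAbv K v) (f i)

/-- The formal automorphisms of growth type `a`. The absolute value at `v` is normalized so that
a uniformizer has absolute value `1 / N(v)`. -/
def HasGrowthType {K : Type u} [Field K] [NumberField K] {n : ℕ} (a : ℝ≥0)
    (f : Fin n → MvPowerSeries (Fin n) K) : Prop :=
  IsAnalyticAut f ∧
  ∃ (S : Finset (IsDedekindDomain.HeightOneSpectrum (𝓞 K)))
    (C : {v : IsDedekindDomain.HeightOneSpectrum (𝓞 K) // v ∉ S} → ℝ),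
    (∀ v, 1 ≤ C v) ∧ Multipliable C ∧
    ∀ v i, ∀ I : Fin n →₀ ℕ,
      NumberField.HeightOneSpectrum.adicAbv K v.1 ((f i).coeff I) ≤
        C v ^ I.degree /
          NumberField.HeightOneSpectrum.adicAbv K v.1 (multiFactorial I : K) ^ (a : ℝ)

/-- The invariant of the formal subscheme of affine `n`-space at the origin with ideal `J`: the
infimum in `[0, ∞]` of those `a` for which some formal automorphism `f` of type `a` pulls the
subscheme back to the linear one with equations `X_i = 0` for `i ≥ d` (indices start at `0`). -/
def alphaAffine {K : Type u} [Field K] [NumberField K] {n : ℕ} (d : ℕ)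
    (J : Ideal (MvPowerSeries (Fin n) K)) : ℝ≥0∞ :=
  sInf {t : ℝ≥0∞ | ∃ a : ℝ≥0, t = a ∧ ∃ f : Fin n → MvPowerSeries (Fin n) K,
    HasGrowthType a f ∧
    Ideal.span ((fun g => MvPowerSeries.subst f g) '' (J : Set (MvPowerSeries (Fin n) K))) =
      Ideal.span {g | ∃ i : Fin n, d ≤ (i : ℕ) ∧ g = MvPowerSeries.X i}}

/-! ### Étale charts -/

/-- An étale chart at `P`: regular functions `x₁, …, x_n` on an open neighbourhood of `P`, such
that the map `(x₁, …, x_n)` to affine space over `K` is étale and sends `P` to the origin. -/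
structure EtaleChart {K : Type u} [Field K] {X : Scheme.{u}}
    (π : X ⟶ Spec (CommRingCat.of K)) (P : Spec (CommRingCat.of K) ⟶ X) (n : ℕ) where
  /-- the neighbourhood -/
  nbhd : X.Opens
  mem : ratPoint P ∈ nbhd
  /-- the functions -/
  coord : Fin n → Γ(nbhd.toScheme, ⊤)
  etale : Etale (AffineSpace.homOfVector (n := ULift.{u} (Fin n)) (nbhd.ι ≫ π)
    fun i => coord i.down)
  vanish (i : Fin n) : germAt nbhd (ratPoint P) mem ⊤ trivial (coord i) ∈
    IsLocalRing.maximalIdeal (X.presheaf.stalk (ratPoint P))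

/-- For elements `x_i` of an ideal `𝔪` of a `K`-algebra `A`, evaluation of polynomials at `x`
sends the `k`-th power of the ideal of the variables into the `k`-th power of `𝔪`. -/
lemma idealOfVars_pow_le {K A : Type*} [CommRing K] [CommRing A] (c : K →+* A)
    (𝔪 : Ideal A) {n : ℕ} (x : Fin n → A) (hx : ∀ i, x i ∈ 𝔪) (k : ℕ) :
    MvPolynomial.idealOfVars (Fin n) K ^ k ≤
      (𝔪 ^ k).comap (MvPolynomial.eval₂Hom c x) := by
  rw [← Ideal.map_le_iff_le_comap, Ideal.map_pow]
  refine Ideal.pow_right_mono ?_ k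
  rw [Ideal.map_le_iff_le_comap, Ideal.span_le]
  rintro _ ⟨i, rfl⟩
  simpa using hx i

/-- The substitution homomorphism `K[[X₁, …, X_n]] → Â`, `X_i ↦ x_i`, into the completion of `A`
at an ideal containing the `x_i`. -/
def evalHat {K A : Type*} [CommRing K] [CommRing A] (c : K →+* A) (𝔪 : Ideal A)
    {n : ℕ} (x : Fin n → A) (hx : ∀ i, x i ∈ 𝔪) :
    MvPowerSeries (Fin n) K →+* AdicCompletion 𝔪 A :=
  AdicCompletion.liftRingHom 𝔪
    (fun k => (Ideal.quotientMap (𝔪 ^ k) (MvPolynomial.eval₂Hom c x)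
      (idealOfVars_pow_le c 𝔪 x hx k)).comp
        (MvPowerSeries.truncTotalAlgHom (Fin n) K k).toRingHom)
    (by
      intro k l hle
      ext p
      have h := MvPowerSeries.truncTotal_sub_truncTotal_mem_pow_idealOfVars hle (le_refl _) p
      have h' := idealOfVars_pow_le c 𝔪 x hx k h
      rw [Ideal.mem_comap, map_sub] at h'
      simpa [Ideal.Quotient.mk_eq_mk_iff_sub_mem, -MvPolynomial.coe_eval₂Hom] using h')

/-- The ideal of `K[[X₁, …, X_n]]` defining the image of the formal subscheme `V` in the formal
completion of affine `n`-space at the origin under an étale chart. -/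
def EtaleChart.pushforward {K : Type u} [Field K] {X : Scheme.{u}}
    {π : X ⟶ Spec (CommRingCat.of K)} {P : Spec (CommRingCat.of K) ⟶ X} {n d : ℕ}
    (c : EtaleChart π P n) (V : SmoothFormalSubscheme π P d) :
    Ideal (MvPowerSeries (Fin n) K) :=
  V.ideal.comap (evalHat (constStalk π (ratPoint P))
    (IsLocalRing.maximalIdeal (X.presheaf.stalk (ratPoint P)))
    (fun i => germAt c.nbhd (ratPoint P) c.mem ⊤ trivial (c.coord i)) c.vanish)

/-- `V` is `α`-analytic: its invariant, computed in the formal affine space through an étale chart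
at `P`, is at most `α`. Charts exist when `P` is a smooth point, and the invariant does not depend
on the chart; the definition asks for the existence of a chart and the bound in every chart. -/
def SmoothFormalSubscheme.IsAnalyticOfType {K : Type u} [Field K] [NumberField K]
    {X : Scheme.{u}} {π : X ⟶ Spec (CommRingCat.of K)} {P : Spec (CommRingCat.of K) ⟶ X} {d : ℕ}
    (V : SmoothFormalSubscheme π P d) (α : ℝ≥0) : Prop :=
  (∃ n, Nonempty (EtaleChart π P n)) ∧
    ∀ (n : ℕ) (c : EtaleChart π P n), alphaAffine d (c.pushforward V) ≤ α

end FormalLeaf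

end

open FormalLeaf

/-!
The growth condition is read off from the Taylor expansions of the coordinates along commuting
derivations that span the foliation.

Let `x₁, …, x_n` be the coordinates of an étale chart at `P`. The local ring `O` of `X` at `P` is
also the local ring of a model of `U` over `𝓞 K [1/N]`, and near the image of `P` the model has an
affine open subset with ring `B`, finitely generated over `ℤ`, on which the `x_i` are defined and
the foliation has a frame `D₁, …, D_d` dual to some of them, `D_l x_{J k} = δ_{l k}`
(`Foliation.exists_dual_frame`). By involutivity the brackets `[D_l, D_m]` are combinations of the
`D_k` whose coefficients are their values on the `x_{J k}`, so they vanish (`frame_comm`). The same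
argument shows that `D_l ^ p` is zero modulo `𝔭` as soon as the `𝔭`-curvature vanishes
(`iterate_mem_map_of_stable`).

The `D_l` extend to the completion `Ô` of `O`, and `g ↦ ∑_I (D ^ I g)(P) / I! t ^ I` is a ring
homomorphism `T : Ô → K[[t₁, …, t_d]]`. It is surjective because `T x_{J k} = t_k`, and it kills
the ideal of the leaf because that ideal is stable under the `D_l` and consists of functions
vanishing at `P`. The quotient by the ideal is isomorphic to the Noetherian ring `K[[t]]`, and a
surjective endomorphism of a Noetherian ring is injective, so the ideal is the kernel of `T`. Hence
the leaf is parametrized by the series `φ_i = T x_i`, and adding the remaining variables to the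
`φ_i` with `i ∉ J` gives a formal automorphism which straightens the leaf.

It remains to bound the coefficients `(D ^ I x_i)(P) / I!` of the `φ_i`. At an archimedean place
and at each of the finite places, bounds of geometric growth follow from the finite generation of
`B` (`MonomialBound` and a common denominator of the generators at `P`). At almost all places `v`,
of residue characteristic `p`, every `p` applications of some `D_l` gain a factor `p`, that is
`|(D ^ I x_i)(P)|_v ≤ |p|_v ^ ∑ ⌊I_l / p⌋`, while `|I!|_v` differs from the right-hand side only
by the contributions of `⌊I_l / p⌋!`. So the coefficients are bounded by `C_v ^ |I|`, where
`log C_v` is of the order of `log p / p ^ 2`, and the product of the `C_v` converges.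
-/


section

open MvPowerSeries

/-! ### Ring homomorphisms out of power series rings -/

namespace MvPowerSeries

variable {σ τ K : Type*} [Field K]

/-- A power series all of whose monomials involve a variable from the finite set `s` is a
combination of these variables; the coefficients can be chosen among the coefficients of the given
series. -/
theorem exists_eq_sum_X_mul {R : Type*} [CommRing R] [DecidableEq σ] (s : Finset σ)
    (p : MvPowerSeries σ R) (hp : ∀ I, (∀ i ∈ s, I i = 0) → coeff I p = 0) :
    ∃ q : σ → MvPowerSeries σ R, p = ∑ i ∈ s, X i * q i ∧
      ∀ i L, coeff L (q i) = 0 ∨ coeff L (q i) = coeff (L + Finsupp.single i 1) p := by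
  induction s using Finset.induction_on generalizing p with
  | empty =>
    refine ⟨0, ?_, fun i L => Or.inl (by simp)⟩
    ext I
    simpa using hp I (by simp)
  | insert a s ha ih =>
    let p' : MvPowerSeries σ R := fun I => if I a = 0 then coeff I p else 0
    have hp' (I) : coeff I p' = if I a = 0 then coeff I p else 0 := rfl
    obtain ⟨q, hq, hq'⟩ := ih p' (by
      intro I hI
      rw [hp']
      split_ifs with h
      · exact hp I (by simpa using ⟨h, hI⟩)
      · rfl)
    let qa : MvPowerSeries σ R := fun L => coeff (L + Finsupp.single a 1) p
    have hqa : p = p' + X a * qa := by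
      ext I
      rw [map_add, hp']
      by_cases h : I a = 0
      · have : coeff I (X a * qa) = 0 := X_dvd_iff.1 (dvd_mul_right _ _) I h
        simp [h, this]
      · obtain ⟨L, rfl⟩ : ∃ L, I = Finsupp.single a 1 + L :=
          ⟨I - Finsupp.single a 1, by
            rw [add_tsub_cancel_of_le]
            simpa using Nat.one_le_iff_ne_zero.2 h⟩
        rw [X, coeff_add_monomial_mul]
        simp only [h, if_false, zero_add, one_mul]
        exact congrArg (fun I => coeff I p) (add_comm _ _)
    refine ⟨Function.update q a qa, ?_, ?_⟩
    · rw [Finset.sum_insert ha, Function.update_self, add_comm]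
      conv_lhs => rw [hqa, hq]
      congr 1
      refine Finset.sum_congr rfl fun i hi => ?_
      rw [Function.update_of_ne (ne_of_mem_of_not_mem hi ha)]
    · intro i L
      by_cases hi : i = a
      · subst hi
        rw [Function.update_self]
        exact Or.inr rfl
      · rw [Function.update_of_ne hi]
        rcases hq' i L with h | h
        · exact Or.inl h
        · rw [hp'] at h
          split_ifs at h
          · exact Or.inr h
          · exact Or.inl h

/-- A ring homomorphism that maps constants to constants and variables to power series without
constant term does not lower the order of vanishing at the origin. -/
theorem coeff_map_eq_zero [Finite σ] (F : MvPowerSeries σ K →+* MvPowerSeries τ K)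
    (hF : ∀ i, constantCoeff (F (X i)) = 0) (k : ℕ) :
    ∀ p : MvPowerSeries σ K, (∀ I, I.degree < k → coeff I p = 0) →
      ∀ L, L.degree < k → coeff L (F p) = 0 := by
  classical
  have := Fintype.ofFinite σ
  induction k with
  | zero => intro p _ L hL; simp at hL
  | succ k ih =>
    intro p hp L hL
    obtain ⟨q, hq, hq'⟩ := exists_eq_sum_X_mul Finset.univ p (by
      intro I hI
      have : I = 0 := by ext i; simpa using hI i (Finset.mem_univ i)
      exact hp I (by simp [this]))
    rw [hq, map_sum, map_sum]
    refine Finset.sum_eq_zero fun i _ => ?_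
    have hqi : ∀ I, I.degree < k → coeff I (q i) = 0 := by
      intro I hI
      rcases hq' i I with h | h
      · exact h
      · rw [h]
        exact hp _ (by simpa using hI)
    rw [map_mul, coeff_mul]
    refine Finset.sum_eq_zero fun ab hab => ?_
    rw [Finset.HasAntidiagonal.mem_antidiagonal] at hab
    by_cases ha : ab.1 = 0
    · rw [ha, coeff_zero_eq_constantCoeff_apply, hF, zero_mul]
    · rw [ih (q i) hqi ab.2 ?_, mul_zero]
      have h1 : ab.1.degree ≠ 0 := by simpa [Finsupp.degree_eq_zero_iff] using ha
      have h2 : ab.1.degree + ab.2.degree = L.degree := by rw [← hab, map_add]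
      omega

/-- Two ring homomorphisms between power series rings over `K` agree if they agree on the
constants and on the variables and map the variables to series without constant term. -/
theorem ringHom_ext_of_X [Finite σ] {F G : MvPowerSeries σ K →+* MvPowerSeries τ K}
    (hC : ∀ c, F (C c) = G (C c)) (hX : ∀ i, F (X i) = G (X i))
    (h0 : ∀ i, constantCoeff (F (X i)) = 0) : F = G := by
  have hpoly (p : MvPolynomial σ K) : F p = G p := by
    have : F.comp MvPolynomial.coeToMvPowerSeries.ringHom =
        G.comp MvPolynomial.coeToMvPowerSeries.ringHom := by
      refine MvPolynomial.ringHom_ext (fun c => ?_) fun i => ?_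
      · simpa using hC c
      · simpa using hX i
    simpa using congrArg (fun f => f p) this
  have hG0 (i) : constantCoeff (G (X i)) = 0 := by rw [← hX, h0]
  refine RingHom.ext fun p => ?_
  ext L
  classical
  let k := L.degree + 1
  have hp : ∀ I, I.degree < k → coeff I (p - ((truncTotal k p : MvPolynomial σ K) : MvPowerSeries σ K)) = 0 := by
    intro I hI
    rw [map_sub, MvPolynomial.coeff_coe, coeff_truncTotal _ hI, sub_self]
  have h1 := coeff_map_eq_zero F h0 k _ hp L (Nat.lt_succ_self _)
  have h2 := coeff_map_eq_zero G hG0 k _ hp L (Nat.lt_succ_self _)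
  rw [map_sub, map_sub, sub_eq_zero] at h1 h2
  rw [h1, h2, hpoly]

/-- The kernel of the homomorphism that sets to zero the variables outside the range of an
embedding is generated by these variables. -/
theorem ker_killCompl [Finite τ] (e : σ ↪ τ) :
    RingHom.ker (killCompl (R := K) e) = Ideal.span {g | ∃ i, i ∉ Set.range e ∧ g = X i} := by
  classical
  have := Fintype.ofFinite τ
  apply le_antisymm
  · intro p hp
    rw [RingHom.mem_ker] at hp
    obtain ⟨q, hq, -⟩ := exists_eq_sum_X_mul (Finset.univ.filter fun i => i ∉ Set.range e) p (by
      intro I hI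
      obtain ⟨L, rfl⟩ : ∃ L : σ →₀ ℕ, I = L.embDomain e := by
        have : I ∈ Set.range (Finsupp.embDomain e) := by
          rw [Finsupp.mem_range_embDomain_iff]
          intro i hi
          by_contra h
          exact (Finsupp.mem_support_iff.1 hi) (hI i (by simpa using h))
        exact this.imp fun L h => h.symm
      rw [← coeff_killCompl, hp, map_zero])
    rw [hq]
    refine Ideal.sum_mem _ fun i hi => Ideal.mul_mem_right _ _ (Ideal.subset_span ⟨i, ?_, rfl⟩)
    simpa using hi
  · rw [Ideal.span_le]
    rintro _ ⟨i, hi, rfl⟩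
    exact killCompl_X_eq_zero hi


end MvPowerSeries

/-- A surjective endomorphism of a Noetherian ring is injective. -/
theorem RingHom.injective_of_surjective_of_isNoetherianRing {R : Type*} [CommRing R]
    [IsNoetherianRing R] (f : R →+* R) (hf : Function.Surjective f) : Function.Injective f := by
  let k : ℕ →o Ideal R := ⟨fun n => RingHom.ker (f ^ n), monotone_nat_of_le_succ fun n x hx => by
    rw [RingHom.mem_ker] at hx ⊢
    rw [pow_succ', RingHom.mul_def, RingHom.comp_apply, hx, map_zero]⟩
  obtain ⟨n, hn⟩ := monotone_stabilizes_iff_noetherian.2 ‹IsNoetherianRing R› k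
  have hsurj : ∀ m : ℕ, Function.Surjective (f ^ m : R →+* R) := by
    intro m
    induction m with
    | zero => exact fun x => ⟨x, rfl⟩
    | succ m ih => rw [pow_succ]; exact ih.comp hf
  rw [injective_iff_map_eq_zero]
  intro x hx
  obtain ⟨y, rfl⟩ := hsurj n x
  have : y ∈ k (n + 1) := by
    change (f ^ (n + 1)) y = 0
    rw [pow_succ', RingHom.mul_def, RingHom.comp_apply, hx]
  rw [← hn (n + 1) n.le_succ] at this
  exact this

namespace FormalLeaf

/-- The components of the formal automorphism that straightens a formal subscheme parametrized by
`φ`. In coordinates for which `φ (J k) = X k`, the automorphism is `φ` plus the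
sum of the coordinates not in the range of `J`, up to the numbering `ρ` of the coordinates. -/
noncomputable def straighten {K : Type*} [Field K] {d n : ℕ} (hd : d ≤ n)
    (φ : Fin n → MvPowerSeries (Fin d) K) (J : Fin d → Fin n) (ρ : Fin n ≃ Fin n) (i : Fin n) :
    MvPowerSeries (Fin n) K :=
  open Classical in
  rename (Fin.castLEEmb hd) (φ i) + if i ∈ Set.range J then 0 else X (ρ i)

section Straighten

variable {K : Type*} [Field K] {d n : ℕ} {hd : d ≤ n} {φ : Fin n → MvPowerSeries (Fin d) K}
  {J : Fin d → Fin n} {ρ : Fin n ≃ Fin n}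

theorem straighten_of_mem (hφ : ∀ k, φ (J k) = X k) (hρ : ∀ k, ρ (J k) = Fin.castLE hd k)
    (k : Fin d) : straighten hd φ J ρ (J k) = X (ρ (J k)) := by
  simp [straighten, hφ, hρ]

theorem straighten_of_notMem {i : Fin n} (hi : i ∉ Set.range J) :
    straighten hd φ J ρ i = rename (Fin.castLEEmb hd) (φ i) + X (ρ i) := by
  simp only [straighten, if_neg hi]

theorem constantCoeff_straighten (h0 : ∀ i, constantCoeff (φ i) = 0) (i : Fin n) :
    constantCoeff (straighten hd φ J ρ i) = 0 := by
  unfold straighten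
  split_ifs <;> simp [h0]

/-- In the numbering `ρ`, the linear part of the straightening automorphism is unipotent and lower
triangular. -/
theorem isUnit_det_straighten (hφ : ∀ k, φ (J k) = X k)
    (hρ : ∀ k, ρ (J k) = Fin.castLE hd k) :
    IsUnit (Matrix.of fun i j =>
      (straighten hd φ J ρ i).coeff (Finsupp.single j 1)).det := by
  classical
  set M : Matrix (Fin n) (Fin n) K :=
    Matrix.of fun i j => (straighten hd φ J ρ i).coeff (Finsupp.single j 1)
  have hX (a b : Fin n) : (X a : MvPowerSeries (Fin n) K).coeff (Finsupp.single b 1) =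
      if b = a then 1 else 0 := by
    rw [coeff_X]
    simp [Finsupp.single_left_inj]
  have hJ (a : Fin n) (ha : (a : ℕ) < d) : ρ.symm a = J ⟨a, ha⟩ := by
    rw [Equiv.symm_apply_eq, hρ]
    rfl
  have hJ' (a : Fin n) (ha : ¬ (a : ℕ) < d) : ρ.symm a ∉ Set.range J := by
    rintro ⟨k, hk⟩
    rw [Equiv.eq_symm_apply, hρ] at hk
    exact ha (by rw [← hk]; exact k.2)
  have hren (a b : Fin n) (hb : ¬ (b : ℕ) < d) :
      (rename (Fin.castLEEmb hd) (φ a)).coeff (Finsupp.single b 1) = 0 := by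
    refine coeff_rename_eq_zero _ _ ?_
    intro hmem
    obtain ⟨x, hx⟩ := hmem
    have : b ∈ (Finsupp.mapDomain (Fin.castLEEmb hd) x).support := by rw [hx]; simp
    obtain ⟨c, -, hc⟩ := Finset.mem_image.1 (Finsupp.mapDomain_support this)
    exact hb (by rw [← hc]; exact c.2)
  have hM (a b : Fin n) (hab : a ≤ b) : M (ρ.symm a) b = if b = a then 1 else 0 := by
    by_cases ha : (a : ℕ) < d
    · simp only [M, Matrix.of_apply]
      rw [hJ a ha, straighten_of_mem hφ hρ, ← hJ a ha, Equiv.apply_symm_apply, hX]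
    · simp only [M, Matrix.of_apply]
      rw [straighten_of_notMem (hJ' a ha), map_add, hren _ _ (fun h => ha (lt_of_le_of_lt hab h)),
        zero_add, Equiv.apply_symm_apply, hX]
  have hdet : (M.submatrix ρ.symm id).det = 1 := by
    rw [Matrix.det_of_isLowerTriangular]
    · exact Finset.prod_eq_one fun i _ => by
        rw [Matrix.submatrix_apply, id, hM i i le_rfl, if_pos rfl]
    · intro a b hab
      rw [Matrix.submatrix_apply, id, hM a b (le_of_lt hab), if_neg (ne_of_gt (OrderDual.toDual_lt_toDual.1 hab))]
  rw [Matrix.det_permute] at hdet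
  exact IsUnit.of_mul_eq_one_right _ hdet

/-- Let `T` be a `K`-homomorphism from `A` to a power series ring, vanishing on an ideal `V` with
smooth quotient of the same dimension `d`. If the coordinates `X (J k)` are mapped to the variables,
then the straightening automorphism maps the ideal of the subscheme `V` to the ideal of
the linear subspace. -/
theorem span_subst_straighten {A : Type*} [CommRing A] (c : K →+* A) (V : Ideal A)
    (e : MvPowerSeries (Fin d) K ≃+* A ⧸ V)
    (Ev : MvPowerSeries (Fin n) K →+* A) (hEv : ∀ a, Ev (C a) = c a)
    (T : A →+* MvPowerSeries (Fin d) K) (hTc : ∀ a, T (c a) = C a)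
    (hTV : ∀ g ∈ V, T g = 0) (hφ : ∀ i, T (Ev (X i)) = φ i)
    (hφJ : ∀ k, φ (J k) = X k) (h0 : ∀ i, constantCoeff (φ i) = 0)
    (hρ : ∀ k, ρ (J k) = Fin.castLE hd k) :
    Ideal.span ((fun g => subst (straighten hd φ J ρ) g) ''
      (V.comap Ev : Set (MvPowerSeries (Fin n) K))) =
      Ideal.span {g | ∃ i : Fin n, d ≤ (i : ℕ) ∧ g = X i} := by
  classical
  have hsub : HasSubst (straighten hd φ J ρ) :=
    hasSubst_of_constantCoeff_zero (constantCoeff_straighten h0)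
  have hJinj : Function.Injective J := by
    intro a b hab
    have h := hρ a
    rw [hab, hρ b] at h
    exact (Fin.castLE_injective hd h).symm
  let Je : Fin d ↪ Fin n := ⟨J, hJinj⟩
  let Tf := (substAlgHom (R := K) hsub : MvPowerSeries (Fin n) K →ₐ[K] _).toRingHom
  have hTf (g) : Tf g = subst (straighten hd φ J ρ) g := by
    rw [← coe_substAlgHom hsub]; rfl
  have hTfC (a : K) : Tf (C a) = C a := by
    have := (substAlgHom (R := K) hsub : MvPowerSeries (Fin n) K →ₐ[K] _).commutes a
    exact this
  have hTfX (i) : Tf (X i) = straighten hd φ J ρ i := by rw [hTf, subst_X hsub]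
  let κ := (killCompl (R := K) (Fin.castLEEmb hd)).toRingHom
  have hκ (g) : κ g = killCompl (Fin.castLEEmb hd) g := rfl
  have hκX (i : Fin n) (hi : i ∉ Set.range J) : κ (X (ρ i)) = 0 := by
    refine killCompl_X_eq_zero ?_
    rintro ⟨k, hk⟩
    exact hi ⟨k, ρ.injective ((hρ k).trans hk)⟩
  -- restricting the straightening automorphism to the linear subspace gives the
  -- parametrization
  have hκT : κ.comp Tf = T.comp Ev := by
    refine ringHom_ext_of_X (fun a => ?_) (fun i => ?_) fun i => ?_
    · rw [RingHom.comp_apply, RingHom.comp_apply, hTfC, hEv, hTc]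
      exact killCompl_C a
    · rw [RingHom.comp_apply, RingHom.comp_apply, hTfX, hφ]
      by_cases hi : i ∈ Set.range J
      · obtain ⟨k, rfl⟩ := hi
        rw [straighten_of_mem hφJ hρ, hφJ, hρ]
        exact killCompl_X (R := K) (e := Fin.castLEEmb hd) k
      · rw [straighten_of_notMem hi, map_add, hκX i hi, add_zero, hκ, killCompl_rename_app]
    · rw [RingHom.comp_apply, hTfX]
      have := constantCoeff_straighten (hd := hd) (J := J) (ρ := ρ) h0 i
      rw [hκ, ← coeff_zero_eq_constantCoeff_apply, coeff_killCompl,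
        Finsupp.embDomain_zero, coeff_zero_eq_constantCoeff_apply, this]
  have hTJ : (T.comp Ev).comp (rename (R := K) Je).toRingHom = RingHom.id _ := by
    refine ringHom_ext_of_X (fun a => ?_) (fun i => ?_) fun i => ?_
    · simp [hEv, hTc]
    · simp [Je, hφ, hφJ]
    · simp [Je, hφ, hφJ]
  have hTsurj : Function.Surjective T := fun g =>
    ⟨Ev (rename Je g), congrArg (fun F => F g) hTJ⟩
  have hker : ∀ g, T g = 0 → g ∈ V := by
    intro g hg
    let Tq := (Ideal.Quotient.lift V T hTV).comp (e : MvPowerSeries (Fin d) K →+* A ⧸ V)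
    have hinj : Function.Injective Tq := by
      refine RingHom.injective_of_surjective_of_isNoetherianRing Tq ?_
      refine (Ideal.Quotient.lift_surjective_of_surjective V hTV hTsurj).comp e.surjective
    obtain ⟨y, hy⟩ := e.surjective (Ideal.Quotient.mk V g)
    have : Tq y = 0 := by
      change Ideal.Quotient.lift V T hTV (e y) = 0
      rw [hy, Ideal.Quotient.lift_mk, hg]
    rw [(injective_iff_map_eq_zero Tq).1 hinj y this, map_zero, eq_comm,
      Ideal.Quotient.eq_zero_iff_mem] at hy
    exact hy
  have hTfJ : Tf.comp (rename (R := K) Je).toRingHom =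
      (rename (R := K) (Fin.castLEEmb hd)).toRingHom := by
    refine ringHom_ext_of_X (fun a => ?_) (fun i => ?_) fun i => ?_
    · simp [hTfC]
    · simp [Je, hTfX, straighten_of_mem hφJ hρ, hρ]
    · simp [Je, hTfX, straighten_of_mem hφJ hρ]
  apply le_antisymm
  · rw [Ideal.span_le]
    rintro _ ⟨g, hg, rfl⟩
    have h1 : κ (Tf g) = 0 := by
      rw [← RingHom.comp_apply, hκT]
      exact hTV _ hg
    have h2 : Tf g ∈ RingHom.ker (killCompl (R := K) (Fin.castLEEmb hd)) := h1
    rw [ker_killCompl, hTf] at h2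
    refine Ideal.span_mono ?_ h2
    rintro _ ⟨i, hi, rfl⟩
    refine ⟨i, ?_, rfl⟩
    by_contra h
    exact hi ⟨⟨i, not_le.1 h⟩, rfl⟩
  · rw [Ideal.span_le]
    rintro _ ⟨a, ha, rfl⟩
    obtain ⟨i, rfl⟩ := ρ.surjective a
    have hi : i ∉ Set.range J := by
      rintro ⟨k, rfl⟩
      rw [hρ] at ha
      exact absurd k.2 (not_lt.2 ha)
    -- the equation `X i = φ i (X (J k))` of the graph is pulled back to `X (ρ i)`
    refine Ideal.subset_span ⟨X i - rename Je (φ i), ?_, ?_⟩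
    · refine hker _ ?_
      rw [map_sub, map_sub, hφ, sub_eq_zero]
      exact (congrArg (fun F => F (φ i)) hTJ).symm
    · change subst (straighten hd φ J ρ) (X i - rename Je (φ i)) = X (ρ i)
      have := congrArg (fun F => F (φ i)) hTfJ
      change Tf (rename Je (φ i)) = rename (Fin.castLEEmb hd) (φ i) at this
      rw [← hTf, map_sub, this, hTfX, straighten_of_notMem hi, add_sub_cancel_left]

end Straighten

end FormalLeaf

end

section

open MvPowerSeries

namespace FormalLeaf

/-! ### Iterates of commuting derivations and the Taylor homomorphism -/

/-- The products `x ^ I = ∏ x i ^ I i` of powers of commuting elements of a monoid. -/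
theorem exists_multiPow {M ι : Type*} [Monoid M] (x : ι → M)
    (hx : ∀ i j, x i * x j = x j * x i) :
    ∃ E : (ι →₀ ℕ) → M, E 0 = 1 ∧ (∀ I L, E (I + L) = E I * E L) ∧
      ∀ i, E (Finsupp.single i 1) = x i := by
  let S := Submonoid.closure (Set.range x)
  have hS : IsMulCommutative S := Submonoid.isMulCommutative_closure M (by
    rintro _ ⟨i, rfl⟩ _ ⟨j, rfl⟩
    exact hx i j)
  let _ : CommMonoid S := { (inferInstance : Monoid S) with mul_comm := hS.is_comm.comm }
  let F : (ι →₀ ℕ) →+ Additive S := Finsupp.liftAddHom fun i =>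
    multiplesHom (Additive S) (Additive.ofMul ⟨x i, Submonoid.subset_closure ⟨i, rfl⟩⟩)
  refine ⟨fun I => ((F I).toMul : S), by simp, fun I L => by simp, fun i => ?_⟩
  simp [F]

section Iter

variable {ι R : Type*} [CommRing R]

/-- The iterate `D ^ I` of a family of commuting derivations. -/
noncomputable def iterDer (D : ι → Derivation ℤ R R)
    (hD : ∀ i j a, D i (D j a) = D j (D i a)) (I : ι →₀ ℕ) : Module.End ℤ R :=
  (exists_multiPow (fun i => ((D i : R →ₗ[ℤ] R) : Module.End ℤ R))
    fun i j => LinearMap.ext (hD i j)).choose I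

variable {D : ι → Derivation ℤ R R} {hD : ∀ i j a, D i (D j a) = D j (D i a)}

@[simp] theorem iterDer_zero (a : R) : iterDer D hD 0 a = a := by
  have := (exists_multiPow (fun i => ((D i : R →ₗ[ℤ] R) : Module.End ℤ R))
    fun i j => LinearMap.ext (hD i j)).choose_spec.1
  exact congrArg (fun f : Module.End ℤ R => f a) this

theorem iterDer_add (I L : ι →₀ ℕ) (a : R) :
    iterDer D hD (I + L) a = iterDer D hD I (iterDer D hD L a) := by
  have := (exists_multiPow (fun i => ((D i : R →ₗ[ℤ] R) : Module.End ℤ R))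
    fun i j => LinearMap.ext (hD i j)).choose_spec.2.1 I L
  exact congrArg (fun f : Module.End ℤ R => f a) this

theorem iterDer_single_one (i : ι) (a : R) : iterDer D hD (Finsupp.single i 1) a = D i a := by
  have := (exists_multiPow (fun i => ((D i : R →ₗ[ℤ] R) : Module.End ℤ R))
    fun i j => LinearMap.ext (hD i j)).choose_spec.2.2 i
  exact congrArg (fun f : Module.End ℤ R => f a) this

theorem iterDer_single (i : ι) (k : ℕ) (a : R) :
    iterDer D hD (Finsupp.single i k) a = (D i)^[k] a := by
  induction k with
  | zero => simp
  | succ k ih =>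
    rw [add_comm, Finsupp.single_add, iterDer_add, ih, iterDer_single_one, add_comm,
      Function.iterate_succ_apply']

/-- Iterates commute with a map intertwining the derivations. -/
theorem map_iterDer {S : Type*} [CommRing S] {D' : ι → Derivation ℤ S S}
    {hD' : ∀ i j a, D' i (D' j a) = D' j (D' i a)} (h : R → S)
    (hh : ∀ i a, h (D i a) = D' i (h a)) (I : ι →₀ ℕ) (a : R) :
    h (iterDer D hD I a) = iterDer D' hD' I (h a) := by
  induction I using Finsupp.induction_linear generalizing a with
  | zero => simp
  | add I L hI hL => rw [iterDer_add, iterDer_add, hI, hL]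
  | single i k =>
    rw [iterDer_single, iterDer_single]
    exact (Function.Semiconj.iterate_right (f := h) (ga := D i) (gb := D' i) (hh i) k) a

end Iter

theorem multiFactorial_add_single {d : ℕ} (I : Fin d →₀ ℕ) (i : Fin d) :
    multiFactorial (I + Finsupp.single i 1) = (I i + 1) * multiFactorial I := by
  classical
  unfold multiFactorial
  rw [← Finset.mul_prod_erase _ _ (Finset.mem_univ i),
    ← Finset.mul_prod_erase _ (fun j => (I j).factorial) (Finset.mem_univ i), ← mul_assoc]
  congr 1
  · simp [Nat.factorial_succ]
  · refine Finset.prod_congr rfl fun j hj => ?_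
    simp [(Finset.ne_of_mem_erase hj).symm]

theorem multiFactorial_ne_zero {d : ℕ} (I : Fin d →₀ ℕ) : multiFactorial I ≠ 0 :=
  Finset.prod_ne_zero_iff.2 fun _ _ => Nat.factorial_ne_zero _

section Taylor

variable {K R : Type*} [Field K] [CommRing R] {d : ℕ}

/-- The power series `∑ ε (D ^ I a) t ^ I / I!`: the Taylor expansion of the function `a` along the
flow of commuting derivations, at the point with evaluation homomorphism `ε`. -/
noncomputable def taylorFun (ε : R →+* K) (D : Fin d → Derivation ℤ R R)
    (hD : ∀ i j a, D i (D j a) = D j (D i a)) (a : R) : MvPowerSeries (Fin d) K :=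
  fun I => ε (iterDer D hD I a) / multiFactorial I

variable {ε : R →+* K} {D : Fin d → Derivation ℤ R R}
  {hD : ∀ i j a, D i (D j a) = D j (D i a)}

theorem coeff_taylorFun (a : R) (I : Fin d →₀ ℕ) :
    coeff I (taylorFun ε D hD a) = ε (iterDer D hD I a) / multiFactorial I := rfl

theorem constantCoeff_taylorFun (a : R) : constantCoeff (taylorFun ε D hD a) = ε a := by
  rw [← coeff_zero_eq_constantCoeff_apply, coeff_taylorFun]
  simp [multiFactorial]

theorem taylorFun_add (a b : R) :
    taylorFun ε D hD (a + b) = taylorFun ε D hD a + taylorFun ε D hD b := by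
  ext I
  simp [coeff_taylorFun, add_div]

variable [CharZero K]

theorem pderiv_taylorFun (i : Fin d) (a : R) :
    pderiv K i (taylorFun ε D hD a) = taylorFun ε D hD (D i a) := by
  ext I
  rw [coeff_pderiv, coeff_taylorFun, coeff_taylorFun, multiFactorial_add_single, iterDer_add,
    iterDer_single_one]
  have h1 : (multiFactorial I : K) ≠ 0 := Nat.cast_ne_zero.2 (multiFactorial_ne_zero I)
  have h2 : ((I i : K) + 1) ≠ 0 := Nat.cast_add_one_ne_zero _
  push_cast
  field_simp

theorem coeff_mul_eq_of_pderiv_eq {f g : MvPowerSeries (Fin d) K} {I : Fin d →₀ ℕ} {i : Fin d}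
    (hi : I i ≠ 0)
    (h : coeff (I - Finsupp.single i 1) (pderiv K i f) =
      coeff (I - Finsupp.single i 1) (pderiv K i g)) : coeff I f = coeff I g := by
  rw [coeff_pderiv, coeff_pderiv, tsub_add_cancel_of_le
    (by simpa using Nat.one_le_iff_ne_zero.2 hi)] at h
  exact mul_right_cancel₀ (Nat.cast_add_one_ne_zero _) h

/-- Both sides have the same constant term, and by the Leibniz rule their derivatives are sums of
products of the same form: hence all coefficients agree by induction on the degree. -/
theorem taylorFun_mul (a b : R) :
    taylorFun ε D hD (a * b) = taylorFun ε D hD a * taylorFun ε D hD b := by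
  suffices ∀ (k : ℕ) (I : Fin d →₀ ℕ), I.degree = k → ∀ a b,
      coeff I (taylorFun ε D hD (a * b)) = coeff I (taylorFun ε D hD a * taylorFun ε D hD b) by
    ext I
    exact this _ I rfl a b
  intro k
  induction k with
  | zero =>
    intro I hI a b
    rw [Finsupp.degree_eq_zero_iff] at hI
    subst hI
    simp only [coeff_zero_eq_constantCoeff_apply, map_mul, constantCoeff_taylorFun]
  | succ k ih =>
    intro I hI a b
    obtain ⟨i, hi⟩ : ∃ i, I i ≠ 0 := by
      by_contra! h
      have : I = 0 := Finsupp.ext h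
      simp [this] at hI
    refine coeff_mul_eq_of_pderiv_eq hi ?_
    have hle : Finsupp.single i 1 ≤ I := by simpa using Nat.one_le_iff_ne_zero.2 hi
    have hdeg : (I - Finsupp.single i 1).degree = k := by
      have := congrArg Finsupp.degree (tsub_add_cancel_of_le hle)
      rw [map_add, Finsupp.degree_single, hI] at this
      exact Nat.succ_injective this
    rw [pderiv_taylorFun, Derivation.leibniz, Derivation.leibniz, pderiv_taylorFun,
      pderiv_taylorFun, smul_eq_mul, smul_eq_mul, smul_eq_mul, smul_eq_mul, taylorFun_add,
      map_add, map_add, ih _ hdeg, ih _ hdeg]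

theorem taylorFun_of_const {a : R} (ha : ∀ i, D i a = 0) :
    taylorFun ε D hD a = C (ε a) := by
  refine pderiv.ext (fun i => ?_) ?_
  · rw [pderiv_taylorFun, ha, pderiv_C]
    ext I
    simp [coeff_taylorFun]
  · rw [constantCoeff_taylorFun, constantCoeff_C]

/-- The Taylor expansion of a function with `D i a = δ i k` vanishing at the point is the
variable `X k`. -/
theorem taylorFun_of_coord {a : R} {k : Fin d} (ha : ∀ i, D i a = if i = k then 1 else 0)
    (h0 : ε a = 0) : taylorFun ε D hD a = X k := by
  refine pderiv.ext (fun i => ?_) ?_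
  · rw [pderiv_taylorFun, ha, pderiv_X, taylorFun_of_const]
    · split_ifs with h
      · subst h; simp
      · simp [Ne.symm h]
    · intro j; split_ifs <;> simp
  · rw [constantCoeff_taylorFun, h0, constantCoeff_X]

variable (ε D hD) in
/-- The Taylor expansion as a ring homomorphism. -/
noncomputable def taylor : R →+* MvPowerSeries (Fin d) K where
  toFun := taylorFun ε D hD
  map_one' := by rw [taylorFun_of_const (by simp)]; simp
  map_mul' := taylorFun_mul
  map_zero' := by ext I; simp [coeff_taylorFun]
  map_add' := taylorFun_add

theorem taylor_apply (a : R) : taylor ε D hD a = taylorFun ε D hD a := rfl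

theorem taylor_eq_zero {V : Ideal R} (hV : ∀ i, ∀ g ∈ V, D i g ∈ V) (hε : ∀ g ∈ V, ε g = 0)
    {g : R} (hg : g ∈ V) : taylor ε D hD g = 0 := by
  have key (I : Fin d →₀ ℕ) : ∀ g ∈ V, iterDer D hD I g ∈ V := by
    induction I using Finsupp.induction_linear with
    | zero => simp
    | add I L hI hL => exact fun g hg => by rw [iterDer_add]; exact hI _ (hL _ hg)
    | single i k =>
      intro g hg
      rw [iterDer_single]
      exact Function.Iterate.rec (fun x => x ∈ V) hg (fun x hx => hV i x hx) k
  ext I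
  rw [taylor_apply, coeff_taylorFun, hε _ (key I g hg), zero_div, map_zero]

end Taylor

/-! ### Extension of derivations -/

/-- A derivation with values in a `T`-module extends along a formally étale algebra `S → T`. -/
theorem exists_derivation_extend {S T N : Type*} [CommRing S] [CommRing T] [Algebra S T]
    [Algebra.FormallyEtale S T] [AddCommGroup N] [Module T N] [Module S N] [IsScalarTower S T N]
    (D : Derivation ℤ S N) : ∃ D' : Derivation ℤ T N, ∀ a, D' (algebraMap S T a) = D a := by
  let e := KaehlerDifferential.tensorKaehlerEquivOfFormallyEtale ℤ S T
  let f := (LinearMap.liftBaseChange T D.liftKaehlerDifferential).comp e.symm.toLinearMap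
  refine ⟨f.compDer (KaehlerDifferential.D ℤ T), fun a => ?_⟩
  change (LinearMap.liftBaseChange T D.liftKaehlerDifferential)
    (e.symm (KaehlerDifferential.D ℤ T (algebraMap S T a))) = D a
  rw [KaehlerDifferential.tensorKaehlerEquivOfFormallyEtale_symm_D_algebraMap]
  simp

/-- Derivations of a formally unramified `S`-algebra that agree on `S` are equal. -/
theorem derivation_eq_of_formallyUnramified {S T N : Type*} [CommRing S] [CommRing T]
    [Algebra S T] [Algebra.FormallyUnramified S T] [AddCommGroup N] [Module T N]
    {D E : Derivation ℤ T N} (h : ∀ a, D (algebraMap S T a) = E (algebraMap S T a)) : D = E := by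
  let _ : Module S N := Module.compHom N (algebraMap S T)
  have : IsScalarTower S T N := IsScalarTower.of_algebraMap_smul fun _ _ => rfl
  let Δ : Derivation S T N := Derivation.mk'
    { toFun := fun x => D x - E x
      map_add' := fun x y => by simp; abel
      map_smul' := fun s x => by
        rw [Algebra.smul_def, Derivation.leibniz, Derivation.leibniz, h]
        simp [smul_sub] }
    (fun a b => by simp [smul_sub]; abel)
  have h0 : Δ = 0 :=
    (KaehlerDifferential.linearMapEquivDerivation S T).symm.injective (Subsingleton.elim _ _)
  ext x
  exact sub_eq_zero.1 (congrArg (fun F : Derivation S T N => F x) h0)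


theorem derivation_mem_pow {R : Type*} [CommRing R] (I : Ideal R) (D : Derivation ℤ R R) (n : ℕ) :
    ∀ a ∈ I ^ (n + 1), D a ∈ I ^ n := by
  induction n with
  | zero => simp
  | succ n ih =>
    intro a ha
    rw [pow_succ] at ha
    refine Submodule.mul_induction_on ha (fun x hx y hy => ?_) fun x y hx hy => ?_
    · rw [Derivation.leibniz, smul_eq_mul, smul_eq_mul]
      refine add_mem (Ideal.mul_mem_right _ _ hx) ?_
      rw [pow_succ']
      exact Ideal.mul_mem_mul hy (ih x hx)
    · rw [map_add]
      exact add_mem hx hy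

/-- The additive derivations of a ring into itself. The `ℤ`-algebra structure is the one that every
ring has; on completions and quotients instance search would find another expression for it. -/
abbrev IntDer (A : Type*) [CommRing A] := Derivation ℤ A A

/-- An additive map satisfying the Leibniz rule, as a derivation. -/
noncomputable def IntDer.mk {A : Type*} [CommRing A] (f : A → A)
    (hadd : ∀ x y, f (x + y) = f x + f y) (hmul : ∀ x y, f (x * y) = x * f y + y * f x) :
    IntDer A :=
  Derivation.mk' (AddMonoidHom.toIntLinearMap (AddMonoidHom.mk' f hadd)) hmul

section Completion

variable {R : Type*} [CommRing R] (I : Ideal R) (D : Derivation ℤ R R)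

theorem exists_completion_map : ∃ D' : AdicCompletion I R → AdicCompletion I R,
    ∀ n x a, AdicCompletion.evalₐ I (n + 1) x = Ideal.Quotient.mk _ a →
      AdicCompletion.evalₐ I n (D' x) = Ideal.Quotient.mk _ (D a) := by
  choose rep hrep using AdicCompletion.mk_surjective I R
  have hcauchy (f : AdicCompletion.AdicCauchySequence I R) (n : ℕ) :
      D (f (n + 1)) ≡ D (f (n + 1 + 1)) [SMOD (I ^ n • ⊤ : Submodule R R)] := by
    rw [SModEq.sub_mem, ← map_sub]
    have h := f.2 (Nat.le_succ (n + 1))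
    rw [SModEq.sub_mem] at h
    simp only [smul_eq_mul, Ideal.mul_top] at h ⊢
    exact derivation_mem_pow I D n _ h
  refine ⟨fun x => AdicCompletion.mk I R
    (AdicCompletion.AdicCauchySequence.mk I R (fun n => D (rep x (n + 1))) (hcauchy (rep x))),
    fun n x a ha => ?_⟩
  rw [AdicCompletion.evalₐ_mk, Ideal.Quotient.mk_eq_mk_iff_sub_mem]
  change D (rep x (n + 1)) - D a ∈ I ^ n
  rw [← map_sub]
  refine derivation_mem_pow I D n _ ?_
  rw [← hrep x, AdicCompletion.evalₐ_mk, Ideal.Quotient.mk_eq_mk_iff_sub_mem] at ha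
  exact ha

/-- The extension by continuity of a derivation of a ring to an adic completion. -/
noncomputable def completionDer : IntDer (AdicCompletion I R) :=
  have h := (exists_completion_map I D).choose_spec
  IntDer.mk (exists_completion_map I D).choose
    (fun x y => by
      refine AdicCompletion.ext_evalₐ fun n => ?_
      obtain ⟨a, ha⟩ := Ideal.Quotient.mk_surjective (AdicCompletion.evalₐ I (n + 1) x)
      obtain ⟨b, hb⟩ := Ideal.Quotient.mk_surjective (AdicCompletion.evalₐ I (n + 1) y)
      rw [h n (x + y) (a + b) (by rw [map_add, map_add, ha, hb]), map_add, map_add, map_add,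
        h n x a ha.symm, h n y b hb.symm])
    (fun x y => by
      refine AdicCompletion.ext_evalₐ fun n => ?_
      obtain ⟨a, ha⟩ := Ideal.Quotient.mk_surjective (AdicCompletion.evalₐ I (n + 1) x)
      obtain ⟨b, hb⟩ := Ideal.Quotient.mk_surjective (AdicCompletion.evalₐ I (n + 1) y)
      have hle : I ^ (n + 1) ≤ I ^ n := Ideal.pow_le_pow_right n.le_succ
      have hdown (z : AdicCompletion I R) (c : R)
          (hc : Ideal.Quotient.mk _ c = AdicCompletion.evalₐ I (n + 1) z) :
          AdicCompletion.evalₐ I n z = Ideal.Quotient.mk _ c := by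
        obtain ⟨f, rfl⟩ := AdicCompletion.mk_surjective I R z
        rw [AdicCompletion.evalₐ_mk, Ideal.Quotient.mk_eq_mk_iff_sub_mem] at hc
        rw [AdicCompletion.evalₐ_mk, Ideal.Quotient.mk_eq_mk_iff_sub_mem]
        have h1 := f.2 (Nat.le_succ n)
        rw [SModEq.sub_mem] at h1
        simp only [smul_eq_mul, Ideal.mul_top] at h1
        have h2 := sub_mem h1 (hle hc)
        simpa using h2
      rw [h n (x * y) (a * b) (by rw [map_mul, map_mul, ha, hb]), Derivation.leibniz]
      simp only [map_add, map_mul, smul_eq_mul]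
      rw [h n x a ha.symm, h n y b hb.symm, hdown x a ha, hdown y b hb])

theorem evalₐ_completionDer {n : ℕ} {x : AdicCompletion I R} {a : R}
    (h : AdicCompletion.evalₐ I (n + 1) x = Ideal.Quotient.mk _ a) :
    AdicCompletion.evalₐ I n (completionDer I D x) = Ideal.Quotient.mk _ (D a) :=
  (exists_completion_map I D).choose_spec n x a h

theorem completionDer_algebraMap (a : R) :
    completionDer I D (algebraMap R _ a) = algebraMap R _ (D a) := by
  refine AdicCompletion.ext_evalₐ fun n => ?_
  rw [evalₐ_completionDer I D (AlgHom.commutes _ a)]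
  exact (AlgHom.commutes _ _).symm

theorem completionDer_comm {D E : Derivation ℤ R R} (h : ∀ a, D (E a) = E (D a))
    (x : AdicCompletion I R) :
    completionDer I D (completionDer I E x) = completionDer I E (completionDer I D x) := by
  refine AdicCompletion.ext_evalₐ fun n => ?_
  obtain ⟨a, ha⟩ := Ideal.Quotient.mk_surjective (AdicCompletion.evalₐ I (n + 1 + 1) x)
  rw [evalₐ_completionDer I D (evalₐ_completionDer I E ha.symm),
    evalₐ_completionDer I E (evalₐ_completionDer I D ha.symm), h]

end Completion

/-! ### Power series as functions on a completion -/

section EvalHat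

variable {K A : Type*} [CommRing K] [CommRing A] (c : K →+* A) (𝔪 : Ideal A) {n : ℕ}
  (x : Fin n → A) (hx : ∀ i, x i ∈ 𝔪)

theorem evalₐ_evalHat_coe (p : MvPolynomial (Fin n) K) (k : ℕ) :
    AdicCompletion.evalₐ 𝔪 k (evalHat c 𝔪 x hx p) =
      Ideal.Quotient.mk _ (MvPolynomial.eval₂Hom c x p) := by
  unfold evalHat
  generalize_proofs
  rename_i hf _
  rw [AdicCompletion.evalₐ_liftRingHom 𝔪 _ hf]
  have : truncTotalAlgHom (Fin n) K k (p : MvPowerSeries (Fin n) K) = Ideal.Quotient.mk _ p :=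
    (truncTotalAlgHom (Fin n) K k).commutes p
  simp only [RingHom.comp_apply, AlgHom.toRingHom_eq_coe, RingHom.coe_coe]
  rw [this]
  rfl

theorem evalHat_coe (p : MvPolynomial (Fin n) K) :
    evalHat c 𝔪 x hx p = algebraMap A _ (MvPolynomial.eval₂Hom c x p) := by
  refine AdicCompletion.ext_evalₐ fun k => ?_
  rw [evalₐ_evalHat_coe]
  exact (AlgHom.commutes _ _).symm

theorem evalHat_C (a : K) : evalHat c 𝔪 x hx (C a) = algebraMap A _ (c a) := by
  rw [← MvPolynomial.coe_C, evalHat_coe]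
  simp

theorem evalHat_X (i : Fin n) : evalHat c 𝔪 x hx (X i) = algebraMap A _ (x i) := by
  rw [← MvPolynomial.coe_X, evalHat_coe]
  simp

end EvalHat

end FormalLeaf

end

section

open MvPowerSeries

namespace FormalLeaf

/-! ### Growth of iterated derivatives in a finitely generated ring -/

/-- `MonomialBound s m c b` says that `b` is a sum of at most `c` signed monomials of degree at
most `m` in the elements of `s`. -/
inductive MonomialBound {B : Type*} [CommRing B] (s : Set B) : ℕ → ℕ → B → Prop
  | zero : MonomialBound s 0 0 0
  | one : MonomialBound s 0 1 1
  | mul_mem {m c : ℕ} {y b : B} (hy : y ∈ s) (hb : MonomialBound s m c b) :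
      MonomialBound s (m + 1) c (y * b)
  | add {m c c' : ℕ} {b b' : B} (hb : MonomialBound s m c b) (hb' : MonomialBound s m c' b') :
      MonomialBound s m (c + c') (b + b')
  | neg {m c : ℕ} {b : B} (hb : MonomialBound s m c b) : MonomialBound s m c (-b)
  | mono {m m' c c' : ℕ} {b : B} (hm : m ≤ m') (hc : c ≤ c') (hb : MonomialBound s m c b) :
      MonomialBound s m' c' b

namespace MonomialBound

variable {B : Type*} [CommRing B] {s : Set B}

theorem mul {m c m' c' : ℕ} {b b' : B} (hb : MonomialBound s m c b)
    (hb' : MonomialBound s m' c' b') : MonomialBound s (m + m') (c * c') (b * b') := by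
  induction hb with
  | zero => simpa using mono (Nat.zero_le _) le_rfl (zero (s := s))
  | one => simpa using hb'
  | mul_mem hy _ ih =>
    rw [mul_assoc, add_right_comm]
    exact mul_mem hy ih
  | add _ _ ih ih' =>
    rw [add_mul, add_mul]
    exact add ih ih'
  | neg _ ih => rw [neg_mul]; exact neg ih
  | mono hm hc _ ih => exact mono (by lia) (Nat.mul_le_mul_right _ hc) ih

theorem exists_of_mem_adjoin {b : B} (hb : b ∈ Algebra.adjoin ℤ s) :
    ∃ m c, MonomialBound s m c b := by
  induction hb using Algebra.adjoin_induction with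
  | mem y hy => exact ⟨1, 1, by simpa using mul_mem hy one⟩
  | algebraMap r =>
    refine ⟨0, r.natAbs, ?_⟩
    have (k : ℕ) : MonomialBound s 0 k (k : B) := by
      induction k with
      | zero => simpa using zero
      | succ k ih => rw [Nat.cast_succ]; exact add ih one
    rw [eq_intCast]
    obtain h | h := r.natAbs_eq
    · have e : (r : B) = (r.natAbs : B) := by conv_lhs => rw [h, Int.cast_natCast]
      rw [e]
      exact this _
    · have e : (r : B) = -(r.natAbs : B) := by
        conv_lhs => rw [h, Int.cast_neg, Int.cast_natCast]
      rw [e]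
      exact neg (this _)
  | add x y _ _ hx hy =>
    obtain ⟨m, c, hx⟩ := hx
    obtain ⟨m', c', hy⟩ := hy
    exact ⟨max m m', c + c', add (mono (le_max_left _ _) le_rfl hx)
      (mono (le_max_right _ _) le_rfl hy)⟩
  | mul x y _ _ hx hy =>
    obtain ⟨m, c, hx⟩ := hx
    obtain ⟨m', c', hy⟩ := hy
    exact ⟨m + m', c * c', mul hx hy⟩

/-- A derivation multiplies the number of monomials by at most a constant times the degree. -/
theorem derivation {D : Derivation ℤ B B} {δ G : ℕ} (hD : ∀ y ∈ s, MonomialBound s (δ + 1) G (D y))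
    {m c : ℕ} {b : B} (hb : MonomialBound s m c b) :
    MonomialBound s (m + δ) (c * m * G) (D b) := by
  induction hb with
  | zero => simpa using mono (Nat.zero_le δ) le_rfl (zero (s := s))
  | one => simpa using mono (Nat.zero_le δ) le_rfl (zero (s := s))
  | @mul_mem m c y b hy hb ih =>
    rw [Derivation.leibniz, smul_eq_mul, smul_eq_mul]
    have h1 := mul_mem hy ih
    have h2 := mul hb (hD y hy)
    refine mono ?_ ?_ (add (mono ?_ le_rfl h1) h2)
    · lia
    · exact le_of_eq (by ring)
    · lia
  | add _ _ ih ih' =>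
    rw [map_add]
    exact mono le_rfl (le_of_eq (by ring)) (add ih ih')
  | neg _ ih => rw [map_neg]; exact neg ih
  | mono hm hc _ ih =>
    exact mono (by lia) (Nat.mul_le_mul_right _ (Nat.mul_le_mul hc hm)) ih

theorem iterDer {ι : Type*} {D : ι → Derivation ℤ B B} {hD : ∀ i j a, D i (D j a) = D j (D i a)}
    {δ G : ℕ} (hG : ∀ i, ∀ y ∈ s, MonomialBound s (δ + 1) G (D i y)) {m c : ℕ} {b : B}
    (hb : MonomialBound s m c b) (I : ι →₀ ℕ) :
    MonomialBound s (m + I.degree * δ) (c * (G * (m + δ)) ^ I.degree * I.degree.factorial)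
      (FormalLeaf.iterDer D hD I b) := by
  obtain ⟨k, hk⟩ : ∃ k, I.degree = k := ⟨_, rfl⟩
  rw [hk]
  induction k generalizing I with
  | zero =>
    rw [Finsupp.degree_eq_zero_iff] at hk
    simpa [hk] using hb
  | succ k ih =>
    obtain ⟨i, hi⟩ : ∃ i, I i ≠ 0 := by
      by_contra! h
      have : I = 0 := Finsupp.ext h
      simp [this] at hk
    have hle : Finsupp.single i 1 ≤ I := by simpa using Nat.one_le_iff_ne_zero.2 hi
    obtain ⟨L, rfl⟩ : ∃ L, I = Finsupp.single i 1 + L :=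
      ⟨I - Finsupp.single i 1, (add_tsub_cancel_of_le hle).symm⟩
    rw [map_add, Finsupp.degree_single, add_comm] at hk
    rw [iterDer_add, iterDer_single_one]
    refine mono ?_ ?_ (derivation (hG i) (ih L (by lia)))
    · exact le_of_eq (by ring)
    · rw [pow_succ, Nat.factorial_succ]
      have h : m + k * δ ≤ (m + δ) * (k + 1) := by
        nlinarith [Nat.zero_le (m * k), Nat.zero_le δ]
      calc c * (G * (m + δ)) ^ k * k.factorial * (m + k * δ) * G
          ≤ c * (G * (m + δ)) ^ k * k.factorial * ((m + δ) * (k + 1)) * G := by gcongr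
        _ = _ := by ring

theorem norm_le {g : B →+* ℂ} {Y : ℝ} (hY : 1 ≤ Y) (hg : ∀ y ∈ s, ‖g y‖ ≤ Y) {m c : ℕ} {b : B}
    (hb : MonomialBound s m c b) : ‖g b‖ ≤ c * Y ^ m := by
  have hY0 : 0 ≤ Y := zero_le_one.trans hY
  induction hb with
  | zero => simp
  | one => simp
  | @mul_mem m c y b hy hb ih =>
    rw [map_mul, norm_mul, pow_succ']
    calc ‖g y‖ * ‖g b‖ ≤ Y * (c * Y ^ m) := mul_le_mul (hg y hy) ih (norm_nonneg _) hY0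
      _ = _ := by ring
  | add _ _ ih ih' =>
    rw [map_add, Nat.cast_add, add_mul]
    exact (norm_add_le _ _).trans (add_le_add ih ih')
  | neg _ ih => rwa [map_neg, norm_neg]
  | @mono m m' c c' b hm hc _ ih =>
    refine ih.trans (mul_le_mul (by exact_mod_cast hc) (pow_le_pow_right₀ hY hm) (by positivity)
      (by positivity))

theorem isIntegral {K : Type*} [Field K] {ε : B →+* K} {N : ℕ}
    (hN : ∀ y ∈ s, IsIntegral ℤ ((N : K) * ε y)) {m c : ℕ} {b : B}
    (hb : MonomialBound s m c b) : IsIntegral ℤ ((N : K) ^ m * ε b) := by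
  have hNi : IsIntegral ℤ (N : K) := by simpa using isIntegral_algebraMap (R := ℤ) (A := K) (x := N)
  induction hb with
  | zero => simpa using isIntegral_zero
  | one => simpa using isIntegral_one
  | @mul_mem m c y b hy hb ih =>
    have := (hN y hy).mul ih
    rw [map_mul]
    have e : (N : K) ^ (m + 1) * (ε y * ε b) = N * ε y * (N ^ m * ε b) := by ring
    rw [e]
    exact this
  | add _ _ ih ih' => rw [map_add, mul_add]; exact ih.add ih'
  | neg _ ih => rw [map_neg, mul_neg]; exact ih.neg
  | @mono m m' c c' b hm hc _ ih =>
    obtain ⟨k, rfl⟩ := Nat.exists_eq_add_of_le hm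
    rw [pow_add, mul_right_comm]
    exact ih.mul (hNi.pow k)

end MonomialBound

section FiniteType

variable {B : Type*} [CommRing B] [Algebra.FiniteType ℤ B] {d : ℕ}

/-- In a ring of finite type over `ℤ`, an iterated derivative of order `k` is a sum of
`O(C ^ k * k!)` monomials of degree `O(k)` in suitable generators. -/
theorem exists_monomialBound_iterDer (D : Fin d → Derivation ℤ B B)
    (hD : ∀ i j a, D i (D j a) = D j (D i a)) (b : B) :
    ∃ (s : Finset B), Algebra.adjoin ℤ (s : Set B) = ⊤ ∧ ∃ m δ c A : ℕ, ∀ I : Fin d →₀ ℕ,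
      MonomialBound (s : Set B) (m + I.degree * δ) (c * A ^ I.degree * I.degree.factorial)
        (iterDer D hD I b) := by
  obtain ⟨s, hs⟩ := (‹Algebra.FiniteType ℤ B›).out
  have hex (b : B) : ∃ m c, MonomialBound (s : Set B) m c b :=
    MonomialBound.exists_of_mem_adjoin (by rw [hs]; trivial)
  choose μ γ hμ using hex
  let δ := ∑ i, ∑ y ∈ s, μ (D i y)
  let G := ∑ i, ∑ y ∈ s, γ (D i y)
  have hle (f : B → ℕ) (i : Fin d) (y : B) (hy : y ∈ s) : f (D i y) ≤ ∑ i, ∑ y ∈ s, f (D i y) :=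
    (Finset.single_le_sum (f := fun y => f (D i y)) (fun _ _ => Nat.zero_le _) hy).trans
      (Finset.single_le_sum (f := fun i => ∑ y ∈ s, f (D i y)) (fun _ _ => Nat.zero_le _)
        (Finset.mem_univ i))
  refine ⟨s, hs, μ b, δ, γ b, G * (μ b + δ), fun I => ?_⟩
  refine MonomialBound.iterDer (fun i y hy => ?_) (hμ b) I
  exact MonomialBound.mono ((hle μ i y hy).trans (Nat.le_succ _)) (hle γ i y hy) (hμ _)

omit [Algebra.FiniteType ℤ B] in
theorem degree_eq_sum (I : Fin d →₀ ℕ) : I.degree = ∑ i, I i :=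
  Finsupp.degree_eq_sum I

/-- `|I|! ≤ d ^ |I| * I!`, since some component of `I` is at least `|I| / d`. -/
theorem factorial_degree_le (I : Fin d →₀ ℕ) :
    I.degree.factorial ≤ d ^ I.degree * multiFactorial I := by
  obtain ⟨k, hk⟩ : ∃ k, I.degree = k := ⟨_, rfl⟩
  rw [hk]
  induction k generalizing I with
  | zero => simpa using Nat.one_le_iff_ne_zero.2 (multiFactorial_ne_zero I)
  | succ k ih =>
    obtain ⟨i, hi⟩ : ∃ i, k + 1 ≤ d * I i := by
      by_contra! h
      have hd : d ≠ 0 := by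
        rintro rfl
        simp [degree_eq_sum] at hk
      have : Nonempty (Fin d) := ⟨⟨0, Nat.pos_of_ne_zero hd⟩⟩
      have h1 : ∑ i, d * I i < ∑ _i : Fin d, (k + 1) :=
        Finset.sum_lt_sum_of_nonempty Finset.univ_nonempty fun i _ => h i
      rw [← Finset.mul_sum, ← degree_eq_sum, hk] at h1
      simp at h1
    have hi0 : I i ≠ 0 := by rintro h; simp [h] at hi
    have hle : Finsupp.single i 1 ≤ I := by simpa using Nat.one_le_iff_ne_zero.2 hi0
    obtain ⟨L, rfl⟩ : ∃ L, I = L + Finsupp.single i 1 :=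
      ⟨I - Finsupp.single i 1, (tsub_add_cancel_of_le hle).symm⟩
    rw [map_add, Finsupp.degree_single] at hk
    rw [multiFactorial_add_single, Nat.factorial_succ]
    have hi' : k + 1 ≤ d * (L i + 1) := by simpa using hi
    calc (k + 1) * k.factorial ≤ (d * (L i + 1)) * (d ^ k * multiFactorial L) :=
          Nat.mul_le_mul hi' (ih L (by lia))
      _ = _ := by ring

end FiniteType

/-! ### Divisibility of iterated derivatives -/

section Divisibility

variable {B : Type*} [CommRing B] {s : Set B}

/-- An additive map that is linear over the generators of an ideal `𝔞` and maps the ring into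
`𝔞 ^ j` raises the `𝔞`-adic filtration by `j`. -/
theorem map_mem_pow_of_linear {L : B → B} (hadd : ∀ a b, L (a + b) = L a + L b)
    (hs : ∀ r ∈ s, ∀ b, L (r * b) = r * L b) {j : ℕ} (hL : ∀ b, L b ∈ Ideal.span s ^ j) (k : ℕ) :
    ∀ b ∈ Ideal.span s ^ k, L b ∈ Ideal.span s ^ (k + j) := by
  have h0 : L 0 = 0 := by simpa using hadd 0 0
  induction k with
  | zero => intro b _; simpa using hL b
  | succ k ih =>
    intro b hb
    rw [pow_succ'] at hb
    refine Submodule.mul_induction_on hb (fun a ha b hb => ?_) fun x y hx hy => ?_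
    · induction ha using Submodule.span_induction generalizing b with
      | mem r hr =>
        rw [hs r hr, add_right_comm, pow_succ']
        exact Ideal.mul_mem_mul (Ideal.subset_span hr) (ih b hb)
      | zero => simp [h0]
      | add x y _ _ hx hy =>
        rw [add_mul, hadd]
        exact add_mem (hx b hb) (hy b hb)
      | smul c x _ hx =>
        rw [smul_eq_mul, mul_assoc, mul_left_comm]
        exact hx _ (Ideal.mul_mem_left _ _ hb)
    · rw [hadd]
      exact add_mem hx hy

/-- If the `p`-th powers of the derivations `D i` map the ring to an ideal generated by constants,
then `D ^ I` maps it to the power of that ideal with exponent `∑ ⌊I i / p⌋`. -/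
theorem iterDer_mem_pow {d : ℕ} {D : Fin d → Derivation ℤ B B}
    {hD : ∀ i j a, D i (D j a) = D j (D i a)} {p : ℕ}
    (hs : ∀ r ∈ s, ∀ i, D i r = 0) (hp : ∀ i b, (D i)^[p] b ∈ Ideal.span s) (I : Fin d →₀ ℕ)
    (b : B) : iterDer D hD I b ∈ Ideal.span s ^ (∑ i, I i / p) := by
  have hlin (i : Fin d) (m : ℕ) : (∀ a b, (D i)^[m] (a + b) = (D i)^[m] a + (D i)^[m] b) ∧
      ∀ r ∈ s, ∀ b, (D i)^[m] (r * b) = r * (D i)^[m] b := by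
    induction m with
    | zero => simp
    | succ m ih =>
      simp only [Function.iterate_succ_apply']
      refine ⟨fun a b => by rw [ih.1, map_add], fun r hr b => ?_⟩
      rw [ih.2 r hr, Derivation.leibniz, hs r hr]
      simp
  have h1 (i : Fin d) (m k : ℕ) : ∀ b ∈ Ideal.span s ^ k, (D i)^[m] b ∈ Ideal.span s ^ k :=
    map_mem_pow_of_linear (j := 0) (hlin i m).1 (hlin i m).2 (by simp) k
  have h2 (i : Fin d) (m k : ℕ) : ∀ b ∈ Ideal.span s ^ k,
      ((D i)^[p])^[m] b ∈ Ideal.span s ^ (k + m) := by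
    induction m with
    | zero => simp
    | succ m ih =>
      intro b hb
      rw [Function.iterate_succ_apply', ← add_assoc]
      exact map_mem_pow_of_linear (j := 1) (hlin i p).1 (hlin i p).2
        (by simpa using hp i) _ _ (ih b hb)
  suffices ∀ (T : Finset (Fin d)) (I : Fin d →₀ ℕ), I.support ⊆ T →
      iterDer D hD I b ∈ Ideal.span s ^ (∑ i ∈ T, I i / p) from
    this Finset.univ I (Finset.subset_univ _)
  intro T
  induction T using Finset.induction_on with
  | empty =>
    intro I _
    simp
  | insert i T hi ih =>
    intro I hI
    have hdec : I = Finsupp.single i (I i) + I.erase i := (Finsupp.single_add_erase i I).symm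
    have hsum : ∑ j ∈ insert i T, I j / p = (∑ j ∈ T, (I.erase i) j / p) + I i / p := by
      rw [Finset.sum_insert hi, add_comm]
      congr 1
      refine Finset.sum_congr rfl fun j hj => ?_
      rw [Finsupp.erase_ne (ne_of_mem_of_not_mem hj hi)]
    rw [hsum]
    conv => enter [2]; rw [hdec]
    rw [iterDer_add, iterDer_single]
    have hmem := ih (I.erase i) (by
      intro j hj
      rw [Finsupp.support_erase, Finset.mem_erase] at hj
      exact (Finset.mem_insert.1 (hI hj.2)).resolve_left hj.1)
    conv => enter [2]; rw [← Nat.mod_add_div (I i) p]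
    rw [Function.iterate_add_apply, Function.iterate_mul]
    exact h1 _ _ _ _ (h2 _ _ _ _ hmem)

end Divisibility

end FormalLeaf

end

section

open MvPowerSeries IsDedekindDomain NumberField
open scoped NumberField

namespace FormalLeaf

/-! ### Absolute values of a number field at the finite places -/

section Places

variable {K : Type*} [Field K] [NumberField K]

/-- The residue characteristic of a finite place. -/
noncomputable def residueChar (v : HeightOneSpectrum (𝓞 K)) : ℕ := ringChar (𝓞 K ⧸ v.asIdeal)

variable (v : HeightOneSpectrum (𝓞 K))

omit [NumberField K] in
theorem natCast_mem_iff (n : ℕ) : (n : 𝓞 K) ∈ v.asIdeal ↔ residueChar v ∣ n := by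
  rw [← Ideal.Quotient.eq_zero_iff_mem, map_natCast]
  exact ringChar.spec _ n

theorem prime_residueChar : (residueChar v).Prime := by
  have : Finite (𝓞 K ⧸ v.asIdeal) := Ideal.finiteQuotientOfFreeOfNeBot _ v.ne_bot
  have h := CharP.char_is_prime_or_zero (𝓞 K ⧸ v.asIdeal) (ringChar (𝓞 K ⧸ v.asIdeal))
  refine h.resolve_right fun h0 => ?_
  have hN := (natCast_mem_iff v (Ideal.absNorm v.asIdeal)).1 (Ideal.absNorm_mem _)
  rw [residueChar, h0, zero_dvd_iff] at hN
  have := HeightOneSpectrum.one_lt_absNorm v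
  lia

theorem exists_adicAbv_eq {x : K} (hx : x ≠ 0) : ∃ m : ℤ,
    v.valuation K x = WithZero.exp m ∧
      HeightOneSpectrum.adicAbv K v x = (Ideal.absNorm v.asIdeal : ℝ) ^ m := by
  have h0 : v.valuation K x ≠ 0 := (Valuation.ne_zero_iff _).2 hx
  refine ⟨Multiplicative.toAdd (WithZero.unzero h0), (WithZero.coe_unzero h0).symm, ?_⟩
  rw [HeightOneSpectrum.adicAbv_def, WithZeroMulInt.toNNReal_neg_apply _ h0]
  push_cast
  rfl

theorem adicAbv_algebraMap_le_one (x : 𝓞 K) :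
    HeightOneSpectrum.adicAbv K v (algebraMap (𝓞 K) K x) ≤ 1 :=
  v.adicAbv_coe_le_one (HeightOneSpectrum.one_lt_absNorm_nnreal v) x

theorem adicAbv_algebraMap_lt_one_iff (x : 𝓞 K) :
    HeightOneSpectrum.adicAbv K v (algebraMap (𝓞 K) K x) < 1 ↔ x ∈ v.asIdeal :=
  v.adicAbv_coe_lt_one_iff (HeightOneSpectrum.one_lt_absNorm_nnreal v) x

theorem adicAbv_le_one_of_isIntegral {x : K} (hx : IsIntegral ℤ x) :
    HeightOneSpectrum.adicAbv K v x ≤ 1 :=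
  adicAbv_algebraMap_le_one v (⟨x, hx⟩ : 𝓞 K)

theorem adicAbv_natCast_lt_one_iff (n : ℕ) :
    HeightOneSpectrum.adicAbv K v (n : K) < 1 ↔ residueChar v ∣ n := by
  have := adicAbv_algebraMap_lt_one_iff v (n : 𝓞 K)
  rwa [map_natCast (algebraMap (𝓞 K) K), natCast_mem_iff] at this

theorem adicAbv_natCast_eq_one {n : ℕ} (hn : ¬ residueChar v ∣ n) :
    HeightOneSpectrum.adicAbv K v (n : K) = 1 :=
  le_antisymm (HeightOneSpectrum.adicAbv_natCast_le_one K v n)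
    (not_lt.1 fun h => hn ((adicAbv_natCast_lt_one_iff v n).1 h))

theorem one_lt_absNorm_real : (1 : ℝ) < Ideal.absNorm v.asIdeal :=
  mod_cast HeightOneSpectrum.one_lt_absNorm v

/-- The absolute value takes no values strictly between `N(v)⁻¹` and `1`. -/
theorem adicAbv_le_inv_absNorm {x : K} (hx : HeightOneSpectrum.adicAbv K v x < 1) :
    HeightOneSpectrum.adicAbv K v x ≤ (Ideal.absNorm v.asIdeal : ℝ)⁻¹ := by
  have hN := one_lt_absNorm_real v
  rcases eq_or_ne x 0 with rfl | h0
  · rw [map_zero]; positivity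
  · obtain ⟨m, -, hm⟩ := exists_adicAbv_eq v h0
    rw [hm] at hx ⊢
    have : m < 0 := by
      by_contra! h
      exact absurd hx (not_lt.2 (one_le_zpow₀ hN.le h))
    rw [← zpow_neg_one]
    exact zpow_le_zpow_right₀ hN.le (by lia)

theorem adicAbv_natCast_eq_pow {n : ℕ} (hn : n ≠ 0) :
    HeightOneSpectrum.adicAbv K v (n : K) =
      HeightOneSpectrum.adicAbv K v (residueChar v : K) ^ padicValNat (residueChar v) n := by
  have := Fact.mk (prime_residueChar v)
  obtain ⟨u, hu⟩ := pow_padicValNat_dvd (p := residueChar v) (n := n)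
  have hu' : ¬ residueChar v ∣ u := by
    rintro ⟨w, rfl⟩
    refine pow_succ_padicValNat_not_dvd (p := residueChar v) hn ⟨w, ?_⟩
    rw [pow_succ, mul_assoc]
    exact hu
  conv_lhs => rw [hu]
  rw [Nat.cast_mul, map_mul, adicAbv_natCast_eq_one v hu', mul_one, Nat.cast_pow, map_pow]

theorem adicAbv_residueChar_pos : 0 < HeightOneSpectrum.adicAbv K v (residueChar v : K) :=
  (HeightOneSpectrum.adicAbv K v).pos (Nat.cast_ne_zero.2 (prime_residueChar v).ne_zero)

/-- Factorials are not smaller than powers of the residue characteristic. -/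
theorem pow_le_adicAbv_factorial (k : ℕ) :
    HeightOneSpectrum.adicAbv K v (residueChar v : K) ^ k ≤
      HeightOneSpectrum.adicAbv K v (k.factorial : K) := by
  have := Fact.mk (prime_residueChar v)
  rw [adicAbv_natCast_eq_pow v (Nat.factorial_ne_zero k)]
  refine pow_le_pow_of_le_one (adicAbv_residueChar_pos v).le
    (HeightOneSpectrum.adicAbv_natCast_le_one K v _) ?_
  have h := sub_one_mul_padicValNat_factorial (p := residueChar v) k
  have hp := (prime_residueChar v).two_le
  have h1 : 1 * padicValNat (residueChar v) k.factorial ≤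
      (residueChar v - 1) * padicValNat (residueChar v) k.factorial :=
    Nat.mul_le_mul_right _ (by lia)
  lia

variable (K) in
theorem finite_setOf_residueChar_dvd {n : ℕ} (hn : n ≠ 0) :
    {v : HeightOneSpectrum (𝓞 K) | residueChar v ∣ n}.Finite := by
  have h0 : Ideal.span {(n : 𝓞 K)} ≠ 0 := by
    simpa [Ideal.span_singleton_eq_bot] using hn
  refine (Ideal.finite_factors h0).subset fun v hv => ?_
  rw [Set.mem_ofPred_eq, Ideal.dvd_span_singleton]
  exact (natCast_mem_iff v n).2 hv

variable (K) in
/-- Almost every place is unramified over `ℚ`, so that its residue characteristic is a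
uniformizer: a prime whose square divides its residue characteristic divides the different. -/
theorem finite_setOf_adicAbv_residueChar_ne :
    {v : HeightOneSpectrum (𝓞 K) | HeightOneSpectrum.adicAbv K v (residueChar v : K) ≠
      (Ideal.absNorm v.asIdeal : ℝ)⁻¹}.Finite := by
  have h0 : differentIdeal ℤ (𝓞 K) ≠ 0 := differentIdeal_ne_bot
  refine (Ideal.finite_factors h0).subset fun v hv => ?_
  rw [Set.mem_ofPred_eq] at hv ⊢
  have hp := prime_residueChar v
  by_contra hdvd
  apply hv
  apply le_antisymm
  · exact adicAbv_le_inv_absNorm v ((adicAbv_natCast_lt_one_iff v _).2 dvd_rfl)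
  have hnot : (residueChar v : 𝓞 K) ∉ v.asIdeal ^ 2 := by
    intro hmem
    apply hdvd
    have hpmax : (Ideal.span {(residueChar v : ℤ)}).IsMaximal :=
      PrincipalIdealRing.isMaximal_of_irreducible (Nat.prime_iff_prime_int.1 hp).irreducible
    have := pow_sub_one_dvd_differentIdeal ℤ (B := 𝓞 K) (p := Ideal.span {(residueChar v : ℤ)})
      v.asIdeal 2 (by simpa using hp.ne_zero) (by
        rw [Ideal.map_span, Set.image_singleton, Ideal.dvd_span_singleton]
        simpa using hmem)
    simpa using this
  obtain ⟨m, hm, hm'⟩ := exists_adicAbv_eq v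
    (x := (residueChar v : K)) (Nat.cast_ne_zero.2 hp.ne_zero)
  rw [hm', ← zpow_neg_one]
  refine zpow_le_zpow_right₀ (one_lt_absNorm_real v).le ?_
  by_contra! hlt
  apply hnot
  rw [← HeightOneSpectrum.intValuation_le_pow_iff_mem, ← v.valuation_of_algebraMap (K := K)]
  refine (congrArg (v.valuation K) (map_natCast (algebraMap (𝓞 K) K) (residueChar v))).le.trans ?_
  rw [hm, WithZero.exp_le_exp]
  push_cast
  lia

/-- The product of the norms of the places above a rational prime `q` is at most `q ^ [K : ℚ]`. -/
theorem sum_log_absNorm_le (T : Finset (HeightOneSpectrum (𝓞 K))) {q : ℕ} (hq : q ≠ 0)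
    (hT : ∀ v ∈ T, residueChar v = q) :
    ∑ v ∈ T, Real.log (Ideal.absNorm v.asIdeal) ≤ Module.finrank ℤ (𝓞 K) * Real.log q := by
  have hdvd : ∏ v ∈ T, v.asIdeal ∣ Ideal.span {(q : 𝓞 K)} := by
    refine Finset.prod_dvd_of_coprime ?_ fun v hv => ?_
    · intro v _ w _ hvw
      refine Ideal.isCoprime_of_isMaximal ?_
      exact fun h => hvw (HeightOneSpectrum.ext h)
    · rw [Ideal.dvd_span_singleton, natCast_mem_iff, hT v hv]
  have h1 := Ideal.absNorm_dvd_absNorm_of_le (Ideal.le_of_dvd hdvd)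
  rw [map_prod, Ideal.absNorm_span_singleton] at h1
  have h2 : (Algebra.norm ℤ (q : 𝓞 K)).natAbs = q ^ Module.finrank ℤ (𝓞 K) := by
    have := Algebra.norm_algebraMap (S := 𝓞 K) (q : ℤ)
    rw [map_natCast] at this
    rw [this, Int.natAbs_pow, Int.natAbs_natCast]
  rw [h2] at h1
  have h3 := Nat.le_of_dvd (pow_pos (Nat.pos_of_ne_zero hq) _) h1
  have hpos (v : HeightOneSpectrum (𝓞 K)) : (0 : ℝ) < Ideal.absNorm v.asIdeal :=
    zero_lt_one.trans (one_lt_absNorm_real v)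
  rw [← Real.log_prod fun v _ => (hpos v).ne', ← Real.log_pow]
  refine Real.log_le_log (Finset.prod_pos fun v _ => hpos v) ?_
  exact_mod_cast h3

theorem summable_log_div : Summable fun q : ℕ => Real.log q / (q * (q - 1)) := by
  have hs : Summable fun q : ℕ => 4 * (1 / (q : ℝ) ^ (3 / 2 : ℝ)) :=
    (Real.summable_one_div_nat_rpow.2 (by norm_num)).mul_left 4
  refine Summable.of_nonneg_of_le (fun q => ?_) (fun q => ?_) hs
  · rcases q with _ | q
    · simp
    · push_cast
      have : (0 : ℝ) ≤ Real.log (q + 1) := Real.log_nonneg (by simp)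
      have h2 : (0 : ℝ) ≤ (q + 1) * (q + 1 - 1) := by
        rw [add_sub_cancel_right]; positivity
      positivity
  · rcases lt_or_ge q 2 with h | h
    · interval_cases q
      · simp
      · simp
    · have hq : (2 : ℝ) ≤ q := by exact_mod_cast h
      have hq0 : (0 : ℝ) < q := by linarith
      have h1 := Real.log_le_rpow_div hq0.le (ε := 1 / 2) (by norm_num)
      rw [div_le_iff₀ (mul_pos hq0 (by linarith))]
      have h2 : (q : ℝ) ^ (1 / 2 : ℝ) = (q : ℝ) ^ 2 * (1 / (q : ℝ) ^ (3 / 2 : ℝ)) := by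
        rw [one_div ((q : ℝ) ^ (3 / 2 : ℝ)), ← Real.rpow_neg hq0.le, ← Real.rpow_natCast, ← Real.rpow_add hq0]
        norm_num
      have h3 : (0 : ℝ) ≤ 1 / (q : ℝ) ^ (3 / 2 : ℝ) := by positivity
      have h4 : (q : ℝ) ^ 2 ≤ 2 * (q * (q - 1)) := by nlinarith
      nlinarith [mul_le_mul_of_nonneg_right h4 h3]

variable (K) in
theorem summable_log_absNorm_div : Summable fun v : HeightOneSpectrum (𝓞 K) =>
    Real.log (Ideal.absNorm v.asIdeal) / (residueChar v * (residueChar v - 1)) := by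
  classical
  have hden (v : HeightOneSpectrum (𝓞 K)) :
      (0 : ℝ) ≤ residueChar v * (residueChar v - 1) := by
    have : (1 : ℝ) ≤ residueChar v := by exact_mod_cast (prime_residueChar v).one_lt.le
    exact mul_nonneg (by linarith) (by linarith)
  have hlog (q : ℕ) : 0 ≤ Real.log q / (q * (q - 1)) := by
    rcases q with _ | q
    · simp
    · push_cast
      have : (0 : ℝ) ≤ Real.log (q + 1) := Real.log_nonneg (by simp)
      have h2 : (0 : ℝ) ≤ (q + 1) * (q + 1 - 1) := by
        rw [add_sub_cancel_right]; positivity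
      positivity
  refine summable_of_sum_le
    (c := ∑' q : ℕ, Module.finrank ℤ (𝓞 K) * (Real.log q / (q * (q - 1)))) (fun v => ?_)
    fun u => ?_
  · exact div_nonneg (Real.log_nonneg (one_lt_absNorm_real v).le) (hden v)
  · rw [← Finset.sum_fiberwise_of_maps_to (t := u.image residueChar)
      fun v hv => Finset.mem_image_of_mem _ hv]
    refine le_trans (Finset.sum_le_sum fun q hq => ?_)
      ((summable_log_div.mul_left _).sum_le_tsum (u.image residueChar)
        fun q _ => mul_nonneg (Nat.cast_nonneg _) (hlog q))
    obtain ⟨v, -, rfl⟩ := Finset.mem_image.1 hq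
    rw [← mul_div_assoc]
    calc ∑ w ∈ u with residueChar w = residueChar v,
          Real.log (Ideal.absNorm w.asIdeal) / (residueChar w * (residueChar w - 1))
        = (∑ w ∈ u with residueChar w = residueChar v, Real.log (Ideal.absNorm w.asIdeal)) /
            (residueChar v * (residueChar v - 1)) := by
          rw [Finset.sum_div]
          refine Finset.sum_congr rfl fun w hw => ?_
          rw [(Finset.mem_filter.1 hw).2]
      _ ≤ _ := by
          refine div_le_div_of_nonneg_right ?_ (hden v)
          exact sum_log_absNorm_le _ (prime_residueChar v).ne_zero
            fun w hw => (Finset.mem_filter.1 hw).2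

/-- The constant `N(v) ^ (1 / (p (p - 1)))`, where `p` is the residue characteristic of `v`. -/
noncomputable def growthConst (v : HeightOneSpectrum (𝓞 K)) : ℝ :=
  (Ideal.absNorm v.asIdeal : ℝ) ^ (1 / (residueChar v * (residueChar v - 1) : ℝ))

theorem residueChar_mul_pos : (0 : ℝ) < residueChar v * (residueChar v - 1) := by
  have : (1 : ℝ) < residueChar v := by exact_mod_cast (prime_residueChar v).one_lt
  exact mul_pos (by linarith) (by linarith)

theorem one_le_growthConst : 1 ≤ growthConst v :=
  Real.one_le_rpow (one_lt_absNorm_real v).le (by have := residueChar_mul_pos v; positivity)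

variable (K) in
theorem multipliable_growthConst (S : Finset (HeightOneSpectrum (𝓞 K))) :
    Multipliable fun v : {v : HeightOneSpectrum (𝓞 K) // v ∉ S} => growthConst v.1 := by
  refine Real.multipliable_of_summable_log
    (fun v => zero_lt_one.trans_le (one_le_growthConst v.1)) ?_
  refine ((summable_log_absNorm_div K).comp_injective Subtype.val_injective).congr fun v => ?_
  rw [growthConst, Real.log_rpow (zero_lt_one.trans (one_lt_absNorm_real v.1)), Function.comp_apply]
  ring

/-- By Legendre's formula, `v_p(k!) - ⌊k / p⌋ = v_p(⌊k / p⌋!) ≤ k / (p (p - 1))`. -/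
theorem inv_pow_le_growthConst
    (hv : HeightOneSpectrum.adicAbv K v (residueChar v : K) = (Ideal.absNorm v.asIdeal : ℝ)⁻¹)
    (k : ℕ) :
    ((Ideal.absNorm v.asIdeal : ℝ)⁻¹) ^ (k / residueChar v) ≤
      growthConst v ^ k * HeightOneSpectrum.adicAbv K v (k.factorial : K) := by
  have hp := prime_residueChar v
  have := Fact.mk hp
  set p := residueChar v with hpdef
  set N : ℝ := ((Ideal.absNorm v.asIdeal : ℕ) : ℝ) with hN
  have hN1 : 1 < N := one_lt_absNorm_real v
  have hN0 : 0 < N := by linarith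
  rw [adicAbv_natCast_eq_pow v (Nat.factorial_ne_zero k), ← hpdef, hv]
  have h1 : padicValNat p k.factorial = padicValNat p (k / p).factorial + k / p := by
    rw [← padicValNat_mul_div_factorial, padicValNat_factorial_mul]
  set w := padicValNat p (k / p).factorial
  have h2 : (p - 1) * w ≤ k / p := by
    rw [sub_one_mul_padicValNat_factorial]
    exact Nat.sub_le _ _
  have h3 : N ^ w ≤ growthConst v ^ k := by
    rw [growthConst, ← hN, ← hpdef, ← Real.rpow_natCast, ← Real.rpow_natCast,
      ← Real.rpow_mul hN0.le]
    refine Real.rpow_le_rpow_of_exponent_le hN1.le ?_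
    rw [one_div_mul_eq_div, le_div_iff₀ (residueChar_mul_pos v), ← hpdef]
    have h4 : p * ((p - 1) * w) ≤ k := (Nat.mul_le_mul_left p h2).trans (Nat.mul_div_le k p)
    have h5 : ((p * ((p - 1) * w) : ℕ) : ℝ) ≤ k := by exact_mod_cast h4
    push_cast [Nat.cast_sub hp.one_lt.le] at h5
    linarith
  rw [h1, pow_add, ← mul_assoc]
  refine le_mul_of_one_le_left (by positivity) ?_
  rw [inv_pow, ← div_eq_mul_inv, one_le_div (by positivity)]
  exact h3

end Places

end FormalLeaf

end

section

open MvPowerSeries IsDedekindDomain NumberField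
open scoped NumberField

namespace FormalLeaf

/-! ### Growth of Taylor coefficients over a number field -/

section Growth

variable {K : Type*} [Field K] [NumberField K] {d : ℕ} {B : Type*} [CommRing B]
  (ε : B →+* K) (D : Fin d → Derivation ℤ B B) (hD : ∀ i j a, D i (D j a) = D j (D i a))

omit [NumberField K] in
/-- At an archimedean place, `|D^I b|` grows at most like `A ^ |I| * |I|!`, and `|I|! ≤ d ^ |I| I!`. -/
theorem posRadius_taylorFun_arch [Algebra.FiniteType ℤ B] (σ : K →+* ℂ) (b : B) :
    PosRadius (fun c => ‖σ c‖) (taylorFun ε D hD b) := by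
  obtain ⟨s, -, m, δ, c, A, hI⟩ := exists_monomialBound_iterDer D hD b
  set Y : ℝ := 1 + ∑ y ∈ s, ‖σ (ε y)‖ with hYdef
  have hY1 : 1 ≤ Y := le_add_of_nonneg_right (Finset.sum_nonneg fun _ _ => norm_nonneg _)
  have hY0 : 0 < Y := by linarith
  have hYs : ∀ y ∈ (s : Set B), ‖(σ.comp ε) y‖ ≤ Y := fun y hy =>
    (Finset.single_le_sum (f := fun y => ‖σ (ε y)‖) (fun _ _ => norm_nonneg _) hy).trans
      (le_add_of_nonneg_left zero_le_one)
  set E : ℝ := A * d * Y ^ δ + 1 with hE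
  have hE0 : 0 < E := by positivity
  refine ⟨E⁻¹, inv_pos.2 hE0, c * Y ^ m, fun I => ?_⟩
  have h1 := (hI I).norm_le hY1 hYs
  have hf : (0 : ℝ) < multiFactorial I := by
    exact_mod_cast Nat.pos_of_ne_zero (multiFactorial_ne_zero I)
  change ‖σ (coeff I (taylorFun ε D hD b))‖ * E⁻¹ ^ I.degree ≤ c * Y ^ m
  rw [coeff_taylorFun, map_div₀, map_natCast, norm_div, Complex.norm_natCast, inv_pow,
    ← div_eq_mul_inv, div_div, div_le_iff₀ (by positivity)]
  refine h1.trans ?_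
  have h2 : (I.degree.factorial : ℝ) ≤ d ^ I.degree * multiFactorial I := by
    exact_mod_cast factorial_degree_le I
  calc ((c * A ^ I.degree * I.degree.factorial : ℕ) : ℝ) * Y ^ (m + I.degree * δ)
      = c * A ^ I.degree * I.degree.factorial * (Y ^ m * (Y ^ δ) ^ I.degree) := by
        push_cast
        rw [pow_add, mul_comm I.degree, pow_mul]
    _ ≤ c * A ^ I.degree * (d ^ I.degree * multiFactorial I) * (Y ^ m * (Y ^ δ) ^ I.degree) := by
        gcongr
    _ = c * Y ^ m * (multiFactorial I * (A * d * Y ^ δ) ^ I.degree) := by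
        rw [mul_pow, mul_pow]; ring
    _ ≤ c * Y ^ m * (multiFactorial I * E ^ I.degree) := by
        gcongr
        exact le_add_of_nonneg_right zero_le_one

theorem adicAbv_multiFactorial (v : HeightOneSpectrum (𝓞 K)) (I : Fin d →₀ ℕ) :
    HeightOneSpectrum.adicAbv K v (multiFactorial I : K) =
      ∏ i, HeightOneSpectrum.adicAbv K v ((I i).factorial : K) := by
  rw [multiFactorial, Nat.cast_prod, map_prod]

theorem adicAbv_multiFactorial_pos (v : HeightOneSpectrum (𝓞 K)) (I : Fin d →₀ ℕ) :
    0 < HeightOneSpectrum.adicAbv K v (multiFactorial I : K) :=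
  (HeightOneSpectrum.adicAbv K v).pos (Nat.cast_ne_zero.2 (multiFactorial_ne_zero I))

/-- The images of a finite set have a common denominator. -/
theorem exists_natCast_mul_isIntegral (s : Finset B) :
    ∃ N : ℕ, N ≠ 0 ∧ ∀ y ∈ s, IsIntegral ℤ ((N : K) * ε y) := by
  classical
  have : Algebra.IsAlgebraic ℤ ℚ := IsLocalization.isAlgebraic ℚ (nonZeroDivisors ℤ)
  have : Algebra.IsAlgebraic ℤ K := Algebra.IsAlgebraic.trans ℤ ℚ K
  obtain ⟨r, hr, h⟩ := Algebra.IsAlgebraic.exists_integral_multiples ℤ (s.image ε)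
  refine ⟨r.natAbs, Int.natAbs_ne_zero.2 hr, fun y hy => ?_⟩
  have h1 := h (ε y) (Finset.mem_image_of_mem _ hy)
  rw [zsmul_eq_mul] at h1
  obtain e | e := r.natAbs_eq
  · rwa [e, Int.cast_natCast] at h1
  · rw [e, Int.cast_neg, Int.cast_natCast, neg_mul] at h1
    simpa using h1.neg

/-- At a finite place, `N ^ (m + |I| δ) * D^I b` is integral and `|I!| ≥ |p| ^ |I|`. -/
theorem posRadius_taylorFun_finite [Algebra.FiniteType ℤ B] (v : HeightOneSpectrum (𝓞 K))
    (b : B) : PosRadius (HeightOneSpectrum.adicAbv K v) (taylorFun ε D hD b) := by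
  obtain ⟨s, -, m, δ, c, A, hI⟩ := exists_monomialBound_iterDer D hD b
  obtain ⟨N, hN0, hN⟩ := exists_natCast_mul_isIntegral ε s
  set a := HeightOneSpectrum.adicAbv K v with ha
  have hNpos : 0 < a N := a.pos (Nat.cast_ne_zero.2 hN0)
  have hp := adicAbv_residueChar_pos v
  rw [← ha] at hp
  refine ⟨a N ^ δ * a (residueChar v), by positivity, (a N ^ m)⁻¹, fun I => ?_⟩
  have h1 := adicAbv_le_one_of_isIntegral v ((hI I).isIntegral hN)
  rw [← ha, map_mul, map_pow] at h1
  have h2 : a (residueChar v) ^ I.degree ≤ a (multiFactorial I) := by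
    rw [ha, adicAbv_multiFactorial, degree_eq_sum, ← Finset.prod_pow_eq_pow_sum]
    exact Finset.prod_le_prod (fun _ _ => pow_nonneg hp.le _)
      fun i _ => pow_le_adicAbv_factorial v (I i)
  have hf : 0 < a (multiFactorial I) := adicAbv_multiFactorial_pos v I
  rw [coeff_taylorFun, map_div₀, div_mul_eq_mul_div, div_le_iff₀ hf, mul_pow, ← pow_mul,
    mul_comm δ, ← mul_assoc]
  have h3 : a (ε (iterDer D hD I b)) * a N ^ (I.degree * δ) ≤ (a N ^ m)⁻¹ := by
    rw [← one_div, le_div_iff₀ (by positivity)]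
    rw [pow_add] at h1
    linarith
  exact mul_le_mul h3 h2 (by positivity) (by positivity)

/-- Almost every finite place is nonnegative on a finitely generated ring. -/
theorem exists_finset_adicAbv_le_one [Algebra.FiniteType ℤ B] :
    ∃ S : Finset (HeightOneSpectrum (𝓞 K)), ∀ v ∉ S, ∀ b : B,
      HeightOneSpectrum.adicAbv K v (ε b) ≤ 1 := by
  obtain ⟨s, hs⟩ := (‹Algebra.FiniteType ℤ B›).out
  obtain ⟨N, hN0, hN⟩ := exists_natCast_mul_isIntegral ε s
  refine ⟨(finite_setOf_residueChar_dvd K hN0).toFinset, fun v hv b => ?_⟩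
  have hvN : ¬ residueChar v ∣ N := by simpa using hv
  have hb : b ∈ Algebra.adjoin ℤ (s : Set B) := by rw [hs]; trivial
  induction hb using Algebra.adjoin_induction with
  | mem y hy =>
    have := adicAbv_le_one_of_isIntegral v (hN y hy)
    rwa [map_mul, adicAbv_natCast_eq_one v hvN, one_mul] at this
  | algebraMap r =>
    rw [eq_intCast, map_intCast]
    exact HeightOneSpectrum.adicAbv_intCast_le_one K v r
  | add x y _ _ hx hy =>
    rw [map_add]
    exact (HeightOneSpectrum.adicAbv_add_le_max K v _ _).trans (max_le hx hy)
  | mul x y _ _ hx hy =>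
    rw [map_mul, map_mul]
    exact mul_le_one₀ hx (apply_nonneg _ _) hy

theorem adicAbv_le_of_mem_span_pow (v : HeightOneSpectrum (𝓞 K))
    (hB : ∀ b : B, HeightOneSpectrum.adicAbv K v (ε b) ≤ 1) {s : Set B}
    (hs : ∀ r ∈ s, HeightOneSpectrum.adicAbv K v (ε r) < 1) (k : ℕ) :
    ∀ b ∈ Ideal.span s ^ k,
      HeightOneSpectrum.adicAbv K v (ε b) ≤ (Ideal.absNorm v.asIdeal : ℝ)⁻¹ ^ k := by
  have hN : (0 : ℝ) ≤ (Ideal.absNorm v.asIdeal : ℝ)⁻¹ := by positivity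
  have h1 : ∀ b ∈ Ideal.span s,
      HeightOneSpectrum.adicAbv K v (ε b) ≤ (Ideal.absNorm v.asIdeal : ℝ)⁻¹ := by
    intro b hb
    induction hb using Submodule.span_induction with
    | mem r hr => exact adicAbv_le_inv_absNorm v (hs r hr)
    | zero => rwa [map_zero, map_zero]
    | add x y _ _ hx hy =>
      rw [map_add]
      exact (HeightOneSpectrum.adicAbv_add_le_max K v _ _).trans (max_le hx hy)
    | smul c x _ hx =>
      rw [smul_eq_mul, map_mul, map_mul]
      exact (mul_le_of_le_one_left (apply_nonneg _ _) (hB c)).trans hx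
  induction k with
  | zero => intro b _; simpa using hB b
  | succ k ih =>
    intro b hb
    rw [pow_succ] at hb
    induction hb using Submodule.mul_induction_on' with
    | mem_mul_mem x hx y hy =>
      rw [map_mul, map_mul, pow_succ]
      exact mul_le_mul (ih x hx) (h1 y hy) (apply_nonneg _ _) (by positivity)
    | add x _ y _ hx hy =>
      rw [map_add]
      exact (HeightOneSpectrum.adicAbv_add_le_max K v _ _).trans (max_le hx hy)

/-- If the `p`-th powers of the commuting derivations vanish modulo almost every place, then the
Taylor coefficients grow at almost every place at most like the powers of `growthConst v`. -/
theorem exists_finset_adicAbv_coeff_taylorFun_le [Algebra.FiniteType ℤ B]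
    (hgood : {v : HeightOneSpectrum (𝓞 K) | ¬ ∃ s : Set B,
      (∀ r ∈ s, HeightOneSpectrum.adicAbv K v (ε r) < 1 ∧ ∀ i, D i r = 0) ∧
        ∀ i b, (D i)^[residueChar v] b ∈ Ideal.span s}.Finite) :
    ∃ S : Finset (HeightOneSpectrum (𝓞 K)), ∀ v ∉ S, ∀ (b : B) (I : Fin d →₀ ℕ),
      HeightOneSpectrum.adicAbv K v (coeff I (taylorFun ε D hD b)) ≤
        growthConst v ^ I.degree := by
  classical
  obtain ⟨S, hS⟩ := exists_finset_adicAbv_le_one ε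
  refine ⟨S ∪ hgood.toFinset ∪ (finite_setOf_adicAbv_residueChar_ne K).toFinset,
    fun v hv b I => ?_⟩
  simp only [Finset.mem_union, Set.Finite.mem_toFinset, Set.mem_ofPred_eq, not_or, not_not] at hv
  obtain ⟨⟨hvS, s, hs, hp⟩, hur⟩ := hv
  have h1 := adicAbv_le_of_mem_span_pow ε v (hS v hvS) (fun r hr => (hs r hr).1) _ _
    (iterDer_mem_pow (hD := hD) (fun r hr => (hs r hr).2) hp I b)
  rw [coeff_taylorFun, map_div₀, div_le_iff₀ (adicAbv_multiFactorial_pos v I)]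
  refine h1.trans ?_
  rw [adicAbv_multiFactorial, degree_eq_sum, ← Finset.prod_pow_eq_pow_sum,
    ← Finset.prod_pow_eq_pow_sum, ← Finset.prod_mul_distrib]
  exact Finset.prod_le_prod (fun _ _ => by positivity)
    fun i _ => inv_pow_le_growthConst v hur (I i)

end Growth

/-! ### Growth of the straightening automorphism -/

section StraightenGrowth

variable {K : Type*} [Field K] {d n : ℕ} {hd : d ≤ n} {φ : Fin n → MvPowerSeries (Fin d) K}
  {J : Fin d → Fin n} {ρ : Fin n ≃ Fin n}

/-- Every coefficient of a component of the straightening automorphism is a coefficient of `φ` in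
the same degree, or `0`, or the coefficient `1` of a variable. -/
theorem coeff_straighten_cases (hρ : ∀ k, ρ (J k) = Fin.castLE hd k) (i : Fin n)
    (I : Fin n →₀ ℕ) :
    (∃ I' : Fin d →₀ ℕ, I'.degree = I.degree ∧
      coeff I (straighten hd φ J ρ i) = coeff I' (φ i)) ∨
    coeff I (straighten hd φ J ρ i) = 0 ∨
    (I.degree = 1 ∧ coeff I (straighten hd φ J ρ i) = 1) := by
  classical
  by_cases hI : ∃ I', I = Finsupp.embDomain (Fin.castLEEmb hd) I'
  · obtain ⟨I', rfl⟩ := hI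
    refine Or.inl ⟨I', ?_, ?_⟩
    · rw [Finsupp.embDomain_eq_mapDomain, Finsupp.degree_mapDomain]
    · unfold straighten
      rw [map_add, coeff_embDomain_rename, add_eq_left]
      split_ifs with hi
      · simp
      · rw [coeff_X, if_neg]
        intro h
        have h1 : ρ i ∉ Set.range (Fin.castLEEmb hd) := by
          rintro ⟨k, hk⟩
          exact hi ⟨k, ρ.injective ((hρ k).trans hk)⟩
        have h2 := DFunLike.congr_fun h (ρ i)
        rw [Finsupp.embDomain_of_notMem_range _ _ _ h1, Finsupp.single_eq_same] at h2
        exact zero_ne_one h2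
  · have h0 : coeff I (rename (R := K) (Fin.castLEEmb hd) (φ i)) = 0 := by
      refine coeff_rename_eq_zero _ _ ?_
      rintro ⟨I', hI'⟩
      exact hI ⟨I', by rw [Finsupp.embDomain_eq_mapDomain]; exact hI'.symm⟩
    right
    unfold straighten
    rw [map_add, h0, zero_add]
    split_ifs with hi
    · exact Or.inl (map_zero _)
    · rw [coeff_X]
      split_ifs with h
      · exact Or.inr ⟨by rw [h, Finsupp.degree_single], rfl⟩
      · exact Or.inl rfl

theorem posRadius_straighten (hρ : ∀ k, ρ (J k) = Fin.castLE hd k) {a : K → ℝ}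
    (ha : ∀ x, 0 ≤ a x) (ha0 : a 0 = 0) (ha1 : a 1 = 1) (i : Fin n)
    (h : PosRadius a (φ i)) : PosRadius a (straighten hd φ J ρ i) := by
  obtain ⟨r, hr, C, hC⟩ := h
  have hr' : 0 < min r 1 := lt_min hr one_pos
  refine ⟨min r 1, hr', max C 1, fun I => ?_⟩
  rcases coeff_straighten_cases (φ := φ) hρ i I with ⟨I', hI', h⟩ | h | ⟨hI, h⟩
  · rw [h, ← hI']
    refine le_trans ?_ ((hC I').trans (le_max_left _ _))
    exact mul_le_mul_of_nonneg_left (pow_le_pow_left₀ hr'.le (min_le_left _ _) _) (ha _)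
  · rw [h, ha0, zero_mul]
    exact zero_le_one.trans (le_max_right _ _)
  · rw [h, hI, ha1, one_mul, pow_one]
    exact (min_le_right _ _).trans (le_max_right _ _)

theorem hasGrowthType_straighten [NumberField K] (hφJ : ∀ k, φ (J k) = X k)
    (h0 : ∀ i, constantCoeff (φ i) = 0) (hρ : ∀ k, ρ (J k) = Fin.castLE hd k)
    (harch : ∀ (σ : K →+* ℂ) (i : Fin n), PosRadius (fun c => ‖σ c‖) (φ i))
    (hfin : ∀ (v : HeightOneSpectrum (𝓞 K)) (i : Fin n),
      PosRadius (HeightOneSpectrum.adicAbv K v) (φ i))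
    (S : Finset (HeightOneSpectrum (𝓞 K)))
    (hS : ∀ v ∉ S, ∀ i I, HeightOneSpectrum.adicAbv K v (coeff I (φ i)) ≤
      growthConst v ^ I.degree) :
    HasGrowthType 0 (straighten hd φ J ρ) := by
  refine ⟨⟨constantCoeff_straighten h0, isUnit_det_straighten hφJ hρ, fun σ i => ?_,
    fun v i => ?_⟩, S, fun v => growthConst v.1, fun v => one_le_growthConst v.1,
    multipliable_growthConst K S, fun v i I => ?_⟩
  · exact posRadius_straighten hρ (fun _ => norm_nonneg _) (by simp) (by simp) i (harch σ i)
  · exact posRadius_straighten hρ (a := HeightOneSpectrum.adicAbv K v)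
      (fun _ => apply_nonneg _ _) (map_zero _) (map_one _) i (hfin v i)
  · rw [NNReal.coe_zero, Real.rpow_zero, div_one]
    have h1 := one_le_growthConst v.1
    rcases coeff_straighten_cases (φ := φ) hρ i I with ⟨I', hI', h⟩ | h | ⟨hI, h⟩
    · rw [h, ← hI']
      exact hS v.1 v.2 i I'
    · rw [h, map_zero]
      positivity
    · rw [h, map_one]
      exact one_le_pow₀ h1

end StraightenGrowth

end FormalLeaf

end

section

open MvPowerSeries IsDedekindDomain NumberField
open scoped NumberField

namespace FormalLeaf

/-! ### Formal leaves in adapted coordinates -/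

/-- An injection `J` between initial segments extends to a permutation, after composition with the
standard inclusion. -/
theorem exists_perm_apply_eq_castLE {d n : ℕ} (hd : d ≤ n) {J : Fin d → Fin n}
    (hJ : Function.Injective J) : ∃ ρ : Fin n ≃ Fin n, ∀ k, ρ (J k) = Fin.castLE hd k := by
  classical
  let e : {x // x ∈ Set.range J} ≃ {x // x ∈ Set.range (Fin.castLE hd)} :=
    (Equiv.ofInjective J hJ).symm.trans (Equiv.ofInjective _ (Fin.castLE_injective hd))
  refine ⟨e.extendSubtype, fun k => ?_⟩
  rw [Equiv.extendSubtype_apply_of_mem e (J k) ⟨k, rfl⟩]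
  have : (Equiv.ofInjective J hJ).symm ⟨J k, ⟨k, rfl⟩⟩ = k := Equiv.ofInjective_symm_apply hJ k
  simp [e, this]

theorem formallyUnramified_int_numberField (K : Type*) [Field K] [NumberField K] :
    Algebra.FormallyUnramified ℤ K := by
  have : Algebra.FormallyUnramified ℤ ℚ :=
    Algebra.FormallyUnramified.of_isLocalization (nonZeroDivisors ℤ)
  have : Algebra.FormallyUnramified ℚ K := Algebra.FormallyUnramified.of_isSeparable ℚ K
  exact Algebra.FormallyUnramified.comp ℤ ℚ K

/-- Derivations kill number fields. -/
theorem derivation_apply_numberField {K A N : Type*} [Field K] [NumberField K] [CommRing A]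
    [AddCommGroup N] [Module A N] (c : K →+* A) (D : Derivation ℤ A N) (a : K) : D (c a) = 0 := by
  let _ : Algebra K A := c.toAlgebra
  let _ : Module K N := Module.compHom N c
  have : IsScalarTower K A N := IsScalarTower.of_algebraMap_smul fun _ _ => rfl
  have := formallyUnramified_int_numberField K
  have h : D.compAlgebraMap K = 0 :=
    derivation_eq_of_formallyUnramified (S := ℤ) fun a => by simp
  exact DFunLike.congr_fun h a

/-- The situation to which the geometry is reduced: near `P` the foliation has a frame of commuting
derivations `D k` dual to some of the chart coordinates, defined over a finitely generated ring
`B`. Taylor expansion along these derivations parametrizes the leaf, with controlled growth.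
Here `A` is the completed local ring, `E` the frame on `A`, and `V` the ideal of the leaf. -/
theorem alphaAffine_comap_le_zero {K : Type*} [Field K] [NumberField K] {A : Type*}
    [CommRing A] (c : K →+* A) (ev : A →+* K) (hev : ∀ a, ev (c a) = a) {d n : ℕ}
    {V : Ideal A} (e : MvPowerSeries (Fin d) K ≃+* A ⧸ V) (hevV : ∀ g ∈ V, ev g = 0)
    {B : Type*} [CommRing B] [Algebra.FiniteType ℤ B] (κ : B →+* A)
    (D : Fin d → Derivation ℤ B B) (hD : ∀ i j a, D i (D j a) = D j (D i a))
    (x : Fin n → B) (hx : ∀ i, ev (κ (x i)) = 0) (J : Fin d → Fin n)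
    (hJ : ∀ i k, D i (x (J k)) = if i = k then 1 else 0)
    (Ev : MvPowerSeries (Fin n) K →+* A) (hEvC : ∀ a, Ev (C a) = c a)
    (hEvX : ∀ i, Ev (X i) = κ (x i))
    (E : Fin d → Derivation ℤ A A) (hE : ∀ i j a, E i (E j a) = E j (E i a))
    (hED : ∀ i b, κ (D i b) = E i (κ b)) (hEV : ∀ i, ∀ g ∈ V, E i g ∈ V)
    (hgood : {v : HeightOneSpectrum (𝓞 K) | ¬ ∃ s : Set B,
      (∀ r ∈ s, HeightOneSpectrum.adicAbv K v (ev (κ r)) < 1 ∧ ∀ i, D i r = 0) ∧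
        ∀ i b, (D i)^[residueChar v] b ∈ Ideal.span s}.Finite) :
    alphaAffine d (V.comap Ev) ≤ 0 := by
  classical
  set φ : Fin n → MvPowerSeries (Fin d) K := fun i => taylorFun (ev.comp κ) D hD (x i) with hφ
  have hφT (i : Fin n) : taylor ev E hE (Ev (X i)) = φ i := by
    rw [hEvX, taylor_apply]
    ext I
    rw [coeff_taylorFun, coeff_taylorFun, ← map_iterDer (hD := hD) κ hED]
    rfl
  have hφJ (k : Fin d) : φ (J k) = X k := taylorFun_of_coord (fun i => hJ i k) (hx _)
  have hφ0 (i : Fin n) : constantCoeff (φ i) = 0 := by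
    rw [hφ, constantCoeff_taylorFun]
    exact hx i
  have hJinj : Function.Injective J := by
    intro a b hab
    by_contra hne
    have h1 := hJ a a
    rw [hab, hJ, if_neg hne, if_pos rfl] at h1
    have := congrArg (ev.comp κ) h1
    simp at this
  have hdn : d ≤ n := by simpa using Fintype.card_le_of_injective J hJinj
  obtain ⟨ρ, hρ⟩ := exists_perm_apply_eq_castLE hdn hJinj
  obtain ⟨S, hS⟩ := exists_finset_adicAbv_coeff_taylorFun_le (ev.comp κ) D hD hgood
  refine sInf_le ⟨0, by simp, straighten hdn φ J ρ, ?_, ?_⟩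
  · exact hasGrowthType_straighten hφJ hφ0 hρ
      (fun σ i => posRadius_taylorFun_arch _ _ _ σ _)
      (fun v i => posRadius_taylorFun_finite _ _ _ v _) S
      fun v hv i I => hS v hv (x i) I
  · refine span_subst_straighten c V e Ev hEvC (taylor ev E hE) (fun a => ?_)
      (fun g hg => taylor_eq_zero hEV hevV hg) hφT hφJ hφ0 hρ
    rw [taylor_apply, taylorFun_of_const fun i => derivation_apply_numberField c (E i) a, hev]

/-- The preceding theorem for the completion `A` of a local ring `O` with residue field `K`. -/
theorem alphaAffine_comap_evalHat_le_zero {K : Type*} [Field K] [NumberField K] {O : Type*}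
    [CommRing O] [IsLocalRing O] [IsNoetherianRing O] (c : K →+* O) (ε : O →+* K) [IsLocalHom ε]
    (hε : ∀ a, ε (c a) = a) {d n : ℕ}
    {V : Ideal (AdicCompletion (IsLocalRing.maximalIdeal O) O)}
    (e : MvPowerSeries (Fin d) K ≃+* AdicCompletion (IsLocalRing.maximalIdeal O) O ⧸ V)
    (x : Fin n → O) (hx : ∀ i, x i ∈ IsLocalRing.maximalIdeal O)
    {B : Type*} [CommRing B] [Algebra.FiniteType ℤ B] (ι : B →+* O)
    (D : Fin d → Derivation ℤ B B) (hD : ∀ i j a, D i (D j a) = D j (D i a))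
    (x' : Fin n → B) (hx' : ∀ i, ι (x' i) = x i) (J : Fin d → Fin n)
    (hJ : ∀ i k, D i (x' (J k)) = if i = k then 1 else 0)
    (E : Fin d → Derivation ℤ O O) (hE : ∀ i j a, E i (E j a) = E j (E i a))
    (hED : ∀ i b, E i (ι b) = ι (D i b))
    (hEV : ∀ i, ∀ g ∈ V, completionDer (IsLocalRing.maximalIdeal O) (E i) g ∈ V)
    (hgood : {v : HeightOneSpectrum (𝓞 K) | ¬ ∃ s : Set B,
      (∀ r ∈ s, HeightOneSpectrum.adicAbv K v (ε (ι r)) < 1 ∧ ∀ i, D i r = 0) ∧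
        ∀ i b, (D i)^[residueChar v] b ∈ Ideal.span s}.Finite) :
    alphaAffine d (V.comap (evalHat c (IsLocalRing.maximalIdeal O) x hx)) ≤ 0 := by
  have hε0 : ∀ a ∈ IsLocalRing.maximalIdeal O, ε a = 0 := fun a ha => by
    by_contra h
    exact (IsLocalRing.mem_maximalIdeal a).1 ha (isUnit_of_map_unit ε a (Ne.isUnit h))
  -- the evaluation at the closed point extends to the completion
  obtain ⟨ev, hev⟩ : ∃ ev : AdicCompletion (IsLocalRing.maximalIdeal O) O →+* K,
      ∀ a, ev (algebraMap O _ a) = ε a := by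
    refine ⟨(Ideal.Quotient.lift _ ε hε0).comp
      (AdicCompletion.evalOneₐ (IsLocalRing.maximalIdeal O)).toRingHom, fun a => ?_⟩
    rw [RingHom.comp_apply]
    change Ideal.Quotient.lift _ ε hε0 (AdicCompletion.evalOneₐ _ (algebraMap O _ a)) = _
    rw [AlgHom.commutes]
    rfl
  have hnt := e.injective.nontrivial
  have hVtop : V ≠ ⊤ := Ideal.Quotient.nontrivial_iff.1 hnt
  have hevV : V ≤ RingHom.ker ev := by
    rw [IsLocalRing.eq_maximalIdeal (RingHom.ker_isMaximal_of_surjective ev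
      fun a => ⟨algebraMap O _ (c a), by rw [hev, hε]⟩)]
    exact IsLocalRing.le_maximalIdeal hVtop
  refine alphaAffine_comap_le_zero ((algebraMap O _).comp c) ev
    (fun a => (hev _).trans (hε a)) e (fun g hg => hevV hg) ((algebraMap O _).comp ι) D hD x'
    (fun i => ?_) J hJ _ (fun a => evalHat_C _ _ _ _ a) (fun i => ?_)
    (fun i => completionDer (IsLocalRing.maximalIdeal O) (E i))
    (fun i j => completionDer_comm _ (hE i j)) (fun i b => ?_) hEV ?_
  · rw [RingHom.comp_apply, hev, hx']
    exact hε0 _ (hx i)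
  · rw [evalHat_X, RingHom.comp_apply, hx']
  · rw [RingHom.comp_apply, RingHom.comp_apply, completionDer_algebraMap, hED]
  · simpa only [RingHom.comp_apply, hev] using hgood

end FormalLeaf

end

section

open IsDedekindDomain NumberField
open scoped NumberField

namespace FormalLeaf

/-! ### Frames dual to coordinates -/

theorem derivation_sum_apply {A ι : Type*} [CommRing A] (s : Finset ι)
    (f : ι → Derivation ℤ A A) (a : A) : (∑ i ∈ s, f i) a = ∑ i ∈ s, f i a := by
  classical
  induction s using Finset.induction_on with
  | empty => simp
  | insert i s hi ih => rw [Finset.sum_insert hi, Finset.sum_insert hi, Derivation.add_apply, ih]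

section DualFrame

variable {B : Type*} [CommRing B] {M : Submodule B (Derivation ℤ B B)} {d : ℕ}
  {D : Fin d → Derivation ℤ B B} {x : Fin d → B}

theorem frame_comm (hD : ∀ i, D i ∈ M) (hx : ∀ i k, D i (x k) = if i = k then 1 else 0)
    (hspan : ∀ E ∈ M, E = ∑ k, E (x k) • D k) (hinv : ∀ E ∈ M, ∀ E' ∈ M, ⁅E, E'⁆ ∈ M)
    (i j : Fin d) (a : B) : D i (D j a) = D j (D i a) := by
  have h := hspan _ (hinv _ (hD i) _ (hD j))
  have h0 : ⁅D i, D j⁆ = 0 := by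
    rw [h]
    refine Finset.sum_eq_zero fun k _ => ?_
    rw [Derivation.commutator_apply, hx, hx]
    split_ifs <;> simp
  have := DFunLike.congr_fun h0 a
  rwa [Derivation.commutator_apply, Derivation.zero_apply, sub_eq_zero] at this

theorem exists_quotient_derivation (I : Ideal B) (E : Derivation ℤ B B)
    (h : ∀ a ∈ I, E a ∈ I) :
    ∃ E' : IntDer (B ⧸ I), ∀ a, E' (Ideal.Quotient.mk I a) = Ideal.Quotient.mk I (E a) := by
  choose r hr using Ideal.Quotient.mk_surjective (I := I)
  have hf (a : B) : Ideal.Quotient.mk I (E (r (Ideal.Quotient.mk I a))) =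
      Ideal.Quotient.mk I (E a) := by
    rw [Ideal.Quotient.mk_eq_mk_iff_sub_mem, ← map_sub]
    refine h _ ?_
    rw [← Ideal.Quotient.mk_eq_mk_iff_sub_mem, hr]
  refine ⟨IntDer.mk (fun x => Ideal.Quotient.mk I (E (r x))) (fun x y => ?_) fun x y => ?_, hf⟩
  · obtain ⟨a, rfl⟩ := Ideal.Quotient.mk_surjective x
    obtain ⟨b, rfl⟩ := Ideal.Quotient.mk_surjective y
    rw [← map_add, hf, hf, hf, map_add, map_add]
  · obtain ⟨a, rfl⟩ := Ideal.Quotient.mk_surjective x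
    obtain ⟨b, rfl⟩ := Ideal.Quotient.mk_surjective y
    rw [← map_mul, hf, hf, hf, Derivation.leibniz, map_add, smul_eq_mul, smul_eq_mul, map_mul,
      map_mul]

theorem map_mem_map_of_mem_relDer {R : Type*} [CommRing R] (β : R →+* B) (I : Ideal R)
    {E : Derivation ℤ B B} (hE : E ∈ relDer β) {a : B} (ha : a ∈ I.map β) : E a ∈ I.map β := by
  induction ha using Submodule.span_induction with
  | mem a ha =>
    obtain ⟨r, -, rfl⟩ := ha
    rw [show E (β r) = 0 from hE r]
    exact zero_mem _
  | zero => rw [map_zero]; exact zero_mem _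
  | add a b _ _ ha hb => rw [map_add]; exact add_mem ha hb
  | smul c a ha h =>
    rw [smul_eq_mul, Derivation.leibniz]
    exact add_mem (Ideal.mul_mem_left _ _ h) (Ideal.mul_mem_right _ _ ha)

/-- If the reduced foliation is stable under `p`-th powers, then the `p`-th power of `D l` is zero
modulo the prime: it is a combination of the `D k` whose coefficients are its values on the
coordinates, and these vanish since `p ≥ 2`. -/
theorem iterate_mem_map_of_stable {R : Type*} [CommRing R] (β : R →+* B) (I : Ideal R) {p : ℕ}
    (hp : 2 ≤ p) (hM : M ≤ relDer β) (hD : ∀ i, D i ∈ M)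
    (hx : ∀ i k, D i (x k) = if i = k then 1 else 0) (hspan : ∀ E ∈ M, E = ∑ k, E (x k) • D k)
    (hstable : ∀ E ∈ pullbackDer ((Ideal.Quotient.mk (I.map β)).comp β)
        (Ideal.Quotient.mk (I.map β)) M,
      ∃ E' ∈ pullbackDer ((Ideal.Quotient.mk (I.map β)).comp β)
        (Ideal.Quotient.mk (I.map β)) M, ∀ b, E' b = E^[p] b) (l : Fin d) (b : B) :
    (D l)^[p] b ∈ I.map β := by
  set red := Ideal.Quotient.mk (I.map β)
  obtain ⟨Dbar, hDbar⟩ := exists_quotient_derivation (I.map β) (D l)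
    fun a ha => map_mem_map_of_mem_relDer β I (hM (hD l)) ha
  have hmem : Dbar ∈ pullbackDer (red.comp β) red M := by
    refine Submodule.subset_span ⟨fun r => ?_, D l, hD l, hDbar⟩
    rw [RingHom.comp_apply, hDbar, show D l (β r) = 0 from hM (hD l) r, map_zero]
  have hiter (k : ℕ) (b : B) : Dbar^[k] (red b) = red ((D l)^[k] b) := by
    induction k with
    | zero => rfl
    | succ k ih => rw [Function.iterate_succ_apply', Function.iterate_succ_apply', ih, hDbar]
  obtain ⟨E, hE, hEp⟩ := hstable Dbar hmem
  have hEspan : ∀ E ∈ pullbackDer (red.comp β) red M, ∀ b,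
      E (red b) = ∑ k, E (red (x k)) * red (D k b) := by
    intro E hE b
    induction hE using Submodule.span_induction with
    | mem E hE =>
      obtain ⟨-, E₀, hE₀, h⟩ := hE
      simp only [h]
      conv_lhs => rw [hspan E₀ hE₀]
      rw [derivation_sum_apply, map_sum]
      exact Finset.sum_congr rfl fun k _ => by
        rw [Derivation.smul_apply, smul_eq_mul, map_mul]
    | zero => simp
    | add E E' _ _ h h' => simp only [Derivation.add_apply, h, h', add_mul, Finset.sum_add_distrib]
    | smul c E _ h =>
      simp only [Derivation.smul_apply, smul_eq_mul, mul_assoc]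
      rw [h, Finset.mul_sum]
  have hzero (k : Fin d) : (D l)^[p] (x k) = 0 := by
    obtain ⟨q, rfl⟩ := Nat.exists_eq_add_of_le' hp
    have h2 : D l (D l (x k)) = 0 := by
      rw [hx]
      split_ifs <;> simp
    rw [Function.iterate_add_apply, show (D l)^[2] (x k) = D l (D l (x k)) from rfl, h2]
    exact Function.iterate_fixed (map_zero _) q
  rw [← Ideal.Quotient.eq_zero_iff_mem]
  change red ((D l)^[p] b) = 0
  rw [← hiter, ← hEp, hEspan E hE]
  refine Finset.sum_eq_zero fun k _ => ?_
  rw [hEp, hiter, hzero, map_zero, zero_mul]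

end DualFrame

/-! ### Primes of `𝓞 K [1/N]` -/

section RingAway

variable {K : Type*} [Field K] [NumberField K] {N : ℕ}

theorem exists_pow_mul_mem {r : K} (hN : N ≠ 0) (hr : r ∈ ringAway K N) :
    ∃ (k : ℕ) (a : 𝓞 K), (N : K) ^ k * r = algebraMap (𝓞 K) K a := by
  have hN' : (N : K) ≠ 0 := Nat.cast_ne_zero.2 hN
  induction hr using Algebra.adjoin_induction with
  | mem r hr =>
    rw [Set.mem_singleton_iff] at hr
    exact ⟨1, 1, by rw [hr, pow_one, mul_inv_cancel₀ hN', map_one]⟩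
  | algebraMap a => exact ⟨0, a, by rw [pow_zero, one_mul]⟩
  | add r r' _ _ h h' =>
    obtain ⟨k, a, h⟩ := h
    obtain ⟨k', a', h'⟩ := h'
    refine ⟨k + k', (N : 𝓞 K) ^ k' * a + (N : 𝓞 K) ^ k * a', ?_⟩
    rw [map_add, map_mul, map_mul, ← h, ← h', map_pow, map_pow, map_natCast]
    ring
  | mul r r' _ _ h h' =>
    obtain ⟨k, a, h⟩ := h
    obtain ⟨k', a', h'⟩ := h'
    refine ⟨k + k', a * a', ?_⟩
    rw [map_mul, ← h, ← h']
    ring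

/-- A place not dividing `N` gives a maximal ideal of `𝓞 K [1/N]`. -/
theorem exists_maximalSpectrum_ringAway (hN : N ≠ 0) (v : HeightOneSpectrum (𝓞 K))
    (hv : ¬ residueChar v ∣ N) : ∃ 𝔭 : MaximalSpectrum (ringAway K N),
      (∀ r ∈ 𝔭.asIdeal, HeightOneSpectrum.adicAbv K v (r : K) < 1) ∧
      𝔭.asIdeal.comap (algebraMap (𝓞 K) (ringAway K N)) = v.asIdeal ∧
      ringChar (ringAway K N ⧸ 𝔭.asIdeal) = residueChar v := by
  have hN1 := adicAbv_natCast_eq_one v hv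
  have hle (r : ringAway K N) : HeightOneSpectrum.adicAbv K v (r : K) ≤ 1 := by
    obtain ⟨k, a, h⟩ := exists_pow_mul_mem hN r.2
    have := adicAbv_algebraMap_le_one v a
    rwa [← h, map_mul, map_pow, hN1, one_pow, one_mul] at this
  let I : Ideal (ringAway K N) :=
    { carrier := {r | HeightOneSpectrum.adicAbv K v (r : K) < 1}
      add_mem' := fun {a b} ha hb =>
        (HeightOneSpectrum.adicAbv_add_le_max K v _ _).trans_lt (max_lt ha hb)
      zero_mem' := by simp
      smul_mem' := fun c r hr => by
        change HeightOneSpectrum.adicAbv K v ((c : K) * r) < 1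
        rw [map_mul]
        exact (mul_le_of_le_one_left (apply_nonneg _ _) (hle c)).trans_lt hr }
  have hI (r : ringAway K N) : r ∈ I ↔ HeightOneSpectrum.adicAbv K v (r : K) < 1 := Iff.rfl
  have hmax : I.IsMaximal := by
    rw [Ideal.isMaximal_iff]
    refine ⟨by simp [hI], fun J r hJ hr hrJ => ?_⟩
    obtain ⟨k, a, h⟩ := exists_pow_mul_mem hN r.2
    have hr1 : HeightOneSpectrum.adicAbv K v (r : K) = 1 := le_antisymm (hle r) (not_lt.1 hr)
    have ha : a ∉ v.asIdeal := by
      rw [← adicAbv_algebraMap_lt_one_iff, ← h, map_mul, map_pow, hN1, hr1]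
      simp
    obtain ⟨b, c, hc, hbc⟩ := v.isMaximal.exists_inv ha
    have hcI : algebraMap (𝓞 K) (ringAway K N) c ∈ I :=
      (adicAbv_algebraMap_lt_one_iff v c).2 hc
    have : (1 : ringAway K N) = algebraMap (𝓞 K) (ringAway K N) b * (N : ringAway K N) ^ k * r +
        algebraMap (𝓞 K) (ringAway K N) c := by
      apply Subtype.ext
      have h2 := congrArg (algebraMap (𝓞 K) K) hbc
      rw [map_add, map_mul, ← h, map_one] at h2
      push_cast
      rw [← h2, mul_assoc]
    rw [this]
    exact add_mem (Ideal.mul_mem_left _ _ hrJ) (hJ hcI)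
  refine ⟨⟨I, hmax⟩, fun r hr => hr, ?_, ?_⟩
  · ext a
    rw [Ideal.mem_comap, ← adicAbv_algebraMap_lt_one_iff]
    exact Iff.rfl
  · have : CharP (ringAway K N ⧸ I) (residueChar v) := ⟨fun n => by
      rw [← map_natCast (Ideal.Quotient.mk I), Ideal.Quotient.eq_zero_iff_mem, hI,
        ← adicAbv_natCast_lt_one_iff]
      simp⟩
    exact ringChar.eq _ (residueChar v)

/-- A property of almost all maximal ideals of `𝓞 K [1/N]` holds at almost all places. -/
theorem finite_setOf_place_of_maximalSpectrum (hN : N ≠ 0)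
    {p : MaximalSpectrum (ringAway K N) → Prop} (hp : {𝔭 | ¬ p 𝔭}.Finite)
    {p' : HeightOneSpectrum (𝓞 K) → Prop}
    (h : ∀ 𝔭 v, p 𝔭 → (∀ r ∈ 𝔭.asIdeal, HeightOneSpectrum.adicAbv K v (r : K) < 1) →
      ringChar (ringAway K N ⧸ 𝔭.asIdeal) = residueChar v → p' v) :
    {v | ¬ p' v}.Finite := by
  have hfin := (hp.image fun 𝔭 => 𝔭.asIdeal.comap (algebraMap (𝓞 K) (ringAway K N))).preimage
    (f := HeightOneSpectrum.asIdeal) fun v _ w _ hvw => HeightOneSpectrum.ext hvw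
  refine ((finite_setOf_residueChar_dvd K hN).union hfin).subset fun v hv => ?_
  rw [Set.mem_union, or_iff_not_imp_left]
  intro hvN
  obtain ⟨𝔭, h1, h2, h3⟩ := exists_maximalSpectrum_ringAway hN v hvN
  exact ⟨𝔭, fun hp𝔭 => hv (h 𝔭 v hp𝔭 h1 h3), h2⟩

theorem finiteType_int_ringAway : Algebra.FiniteType ℤ (ringAway K N) := by
  have : Algebra.FiniteType (𝓞 K) (ringAway K N) :=
    (Subalgebra.fg_iff_finiteType _).1 (Subalgebra.fg_def.2 ⟨_, Set.finite_singleton _, rfl⟩)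
  exact Algebra.FiniteType.trans (S := 𝓞 K) inferInstance this

/-- Finitely many elements of `K` have a common denominator in `𝓞 K`. -/
theorem exists_common_denominator {d : ℕ} (a : Fin d → K) : ∃ r : ringAway K N, (r : K) ≠ 0 ∧
    ∃ c : Fin d → ringAway K N, ∀ i, (c i : K) = r * a i := by
  obtain ⟨r, hr⟩ := IsLocalization.exist_integer_multiples_of_finite (nonZeroDivisors (𝓞 K)) a
  choose c hc using hr
  refine ⟨algebraMap (𝓞 K) _ r, ?_, fun i => algebraMap (𝓞 K) _ (c i), fun i => ?_⟩
  · change algebraMap (𝓞 K) K r ≠ 0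
    exact IsFractionRing.to_map_ne_zero_of_mem_nonZeroDivisors r.2
  · change algebraMap (𝓞 K) K (c i) = algebraMap (𝓞 K) K r * a i
    exact (hc i).trans (Algebra.smul_def (r : 𝓞 K) (a i))

end RingAway

/-! ### Linear independence of frames at a point -/

theorem exists_submatrix_det_ne_zero {K : Type*} [Field K] {d n : ℕ}
    (A : Matrix (Fin d) (Fin n) K) (h : ∀ w : Fin d → K, (∀ j, ∑ i, w i * A i j = 0) → w = 0) :
    ∃ J : Fin d → Fin n, (A.submatrix id J).det ≠ 0 := by
  have hrow : LinearIndependent K A.row := by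
    rw [Fintype.linearIndependent_iff]
    intro w hw
    refine congrFun (h w fun j => ?_)
    have := congrFun hw j
    simpa using this
  have hspan : Submodule.span K (Set.range A.col) = ⊤ := by
    apply Submodule.eq_top_of_finrank_eq
    rw [← Matrix.rank_eq_finrank_span_cols, hrow.rank_matrix]
    simp
  have hrank : Module.finrank K (Submodule.span K (Set.range A.col)) = d := by
    rw [hspan]; simp
  have hex := Submodule.exists_fun_fin_finrank_span_eq K (Set.range A.col)
  rw [hrank] at hex
  obtain ⟨f, hf, -, hli⟩ := hex
  choose J hJ using hf
  refine ⟨J, ?_⟩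
  have hcol : (A.submatrix id J).col = f := funext hJ
  rw [← hcol, Matrix.linearIndependent_cols_iff_isUnit, Matrix.isUnit_iff_isUnit_det] at hli
  exact hli.ne_zero

open scoped TensorProduct in
/-- If a combination of a basis of the derivations of a smooth algebra takes values in an ideal,
then its coefficients lie in the ideal, since `Hom (Ω, q) = q Hom (Ω, B)` for the finite projective
module `Ω` of differentials. -/
theorem mem_of_sum_smul_basis_apply_mem {R B ι : Type*} [CommRing R] [CommRing B] [Algebra R B]
    [Algebra.Smooth R B] [Fintype ι] (b : Module.Basis ι B (relDer (algebraMap R B)))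
    (q : Ideal B) (c : ι → B) (h : ∀ z, ∑ i, c i * (b i : Derivation ℤ B B) z ∈ q) (i : ι) :
    c i ∈ q := by
  have hfin : Module.Finite B Ω[B⁄R] := inferInstance
  have hproj : Module.Projective B Ω[B⁄R] := inferInstance
  obtain ⟨m, f, g, -, -, hfg⟩ := Module.Finite.exists_comp_eq_id_of_projective B Ω[B⁄R]
  -- derivations killing `R` are linear forms on the differentials
  have toR (E : relDer (algebraMap R B)) : ∃ L : Ω[B⁄R] →ₗ[B] B,
      ∀ z, L (KaehlerDifferential.D R B z) = (E : Derivation ℤ B B) z := by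
    let E' : Derivation R B B := Derivation.mk'
      { toFun := fun z => (E : Derivation ℤ B B) z
        map_add' := map_add _
        map_smul' := fun r z => by
          rw [Algebra.smul_def, Derivation.leibniz, E.2 r, smul_zero, add_zero, smul_eq_mul,
            RingHom.id_apply, Algebra.smul_def] }
      fun x y => Derivation.leibniz _ x y
    exact ⟨E'.liftKaehlerDifferential, fun z => Derivation.liftKaehlerDifferential_comp_D E' z⟩
  have ofL (L : Ω[B⁄R] →ₗ[B] B) : ∃ E : relDer (algebraMap R B),
      ∀ z, (E : Derivation ℤ B B) z = L (KaehlerDifferential.D R B z) :=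
    ⟨⟨(L.compDer (KaehlerDifferential.D R B)).restrictScalars ℤ, fun r => by simp⟩, fun z => rfl⟩
  set s : relDer (algebraMap R B) := ∑ i, c i • b i with hs
  have hs' (z : B) : (s : Derivation ℤ B B) z = ∑ i, c i * (b i : Derivation ℤ B B) z := by
    rw [hs, Submodule.coe_sum, derivation_sum_apply]
    rfl
  obtain ⟨L, hL⟩ := toR s
  have hLq (w : Ω[B⁄R]) : L w ∈ q := by
    have hw : w ∈ Submodule.span B (Set.range (KaehlerDifferential.D R B)) := by
      rw [KaehlerDifferential.span_range_derivation]; trivial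
    induction hw using Submodule.span_induction with
    | mem w hw =>
      obtain ⟨z, rfl⟩ := hw
      rw [hL, hs']
      exact h z
    | zero => rw [map_zero]; exact zero_mem _
    | add x y _ _ hx hy => rw [map_add]; exact add_mem hx hy
    | smul a x _ hx => rw [map_smul]; exact Ideal.mul_mem_left _ _ hx
  choose E hE using fun k => ofL (LinearMap.proj k ∘ₗ g)
  have hsum : s = ∑ k, L (f fun j => if k = j then 1 else 0) • E k := by
    apply Subtype.ext
    ext z
    rw [← hL, Submodule.coe_sum, derivation_sum_apply]
    have h1 : f (g (KaehlerDifferential.D R B z)) = KaehlerDifferential.D R B z :=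
      LinearMap.congr_fun hfg _
    rw [← h1, LinearMap.pi_apply_eq_sum_univ f, map_sum]
    refine Finset.sum_congr rfl fun k _ => ?_
    rw [map_smul, Submodule.coe_smul, Derivation.smul_apply, hE, smul_eq_mul, smul_eq_mul, mul_comm]
    rfl
  have hc : c i = b.repr s i := by
    classical
    rw [hs, map_sum, Finsupp.finsetSum_apply]
    simp [Finsupp.single_apply]
  rw [hc, hsum, map_sum, Finsupp.finsetSum_apply]
  refine Ideal.sum_mem _ fun k _ => ?_
  rw [map_smul, Finsupp.smul_apply, smul_eq_mul]
  exact Ideal.mul_mem_right _ _ (hLq _)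

end FormalLeaf

end

section

open AlgebraicGeometry CategoryTheory IsDedekindDomain
open scoped NumberField

namespace FormalLeaf

/-! ### Local rings of the model along the generic fibre -/

theorem isIso_stalkMap_of_flat_of_surjectiveOnStalks {X Y : Scheme.{u}} (f : X ⟶ Y) [Flat f]
    [SurjectiveOnStalks f] (x : X) : IsIso (f.stalkMap x) := by
  have hflat := Flat.stalkMap f x
  have hinj : Function.Injective (f.stalkMap x).hom := by
    algebraize [(f.stalkMap x).hom]
    have : IsLocalHom (algebraMap (Y.presheaf.stalk (f x)) (X.presheaf.stalk x)) :=
      inferInstanceAs (IsLocalHom (f.stalkMap x).hom)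
    have := Module.FaithfullyFlat.of_flat_of_isLocalHom (A := Y.presheaf.stalk (f x))
      (B := X.presheaf.stalk x)
    exact FaithfulSMul.algebraMap_injective _ _
  exact (ConcreteCategory.isIso_iff_bijective _).2 ⟨hinj, f.stalkMap_surjective x⟩

theorem isFractionRing_ringAway (K : Type u) [Field K] [NumberField K] (N : ℕ) :
    IsFractionRing (ringAway K N) K := by
  refine IsFractionRing.of_field (ringAway K N) K fun z => ?_
  obtain ⟨a, b, hb, rfl⟩ := IsFractionRing.div_surjective (A := 𝓞 K) z
  exact ⟨algebraMap _ _ a, algebraMap _ _ b, rfl⟩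

theorem formallyEtale_of_bijective {R S : Type*} [CommRing R] [CommRing S] {f : R →+* S}
    (hf : Function.Bijective f) : f.FormallyEtale := by
  algebraize [f]
  rw [← f.algebraMap_toAlgebra, RingHom.formallyEtale_algebraMap]
  exact Algebra.FormallyEtale.of_equiv (AlgEquiv.ofBijective (Algebra.ofId R S) hf)

theorem formallyEtale_of_isPushout {R S A B : CommRingCat.{u}} {f : R ⟶ S} {g : R ⟶ A}
    {a : S ⟶ B} {b : A ⟶ B} (h : IsPushout f g a b) (hg : g.hom.FormallyEtale) :
    a.hom.FormallyEtale := by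
  algebraize [f.hom, g.hom, a.hom, b.hom, a.hom.comp f.hom]
  have : IsScalarTower R A B := .of_algebraMap_eq' (congrArg CommRingCat.Hom.hom h.w)
  have hpo : Algebra.IsPushout R S A B := CommRingCat.isPushout_iff_isPushout.1 h
  rw [← a.hom.algebraMap_toAlgebra, RingHom.formallyEtale_algebraMap]
  exact Algebra.FormallyEtale.of_equiv (hpo.equiv R S A B)

theorem exists_derivation_extend_of_ringHom {S T : Type*} [CommRing S] [CommRing T] {φ : S →+* T}
    (hφ : φ.FormallyEtale) (D : Derivation ℤ S S) :
    ∃ D' : Derivation ℤ T T, ∀ a, D' (φ a) = φ (D a) := by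
  algebraize [φ]
  exact exists_derivation_extend ((Algebra.linearMap S T).compDer D)

/-- The compatibility of two derivations with a homomorphism `ψ` can be checked after a formally
unramified base change `φ`. -/
theorem derivation_comp_eq_of_formallyUnramified {S T A : Type*} [CommRing S] [CommRing T]
    [CommRing A] {φ : S →+* T} (hφ : φ.FormallyUnramified) (ψ : T →+* A) (D : Derivation ℤ T T)
    (E : Derivation ℤ A A) (h : ∀ a, E (ψ (φ a)) = ψ (D (φ a))) (t : T) : E (ψ t) = ψ (D t) := by
  algebraize [φ, ψ]
  exact DFunLike.congr_fun (derivation_eq_of_formallyUnramified (S := S)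
    (D := E.compAlgebraMap T) (E := (Algebra.linearMap T A).compDer D) h) t

theorem formallyUnramified_of_formallyEtale {S T : Type*} [CommRing S] [CommRing T]
    {φ : S →+* T} (hφ : φ.FormallyEtale) : φ.FormallyUnramified := by
  algebraize [φ]
  exact inferInstanceAs (Algebra.FormallyUnramified S T)

section Model

variable {K : Type u} [Field K] [NumberField K] {U : Scheme.{u}}
  {π : U ⟶ Spec (CommRingCat.of K)} {d : ℕ} {F : Foliation π d} {N : ℕ} (M : Model F N)

theorem Model.flat_incl : Flat M.incl := by
  have := isFractionRing_ringAway K N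
  have : Flat (genericPt K N) := by
    rw [genericPt, Flat.SpecMap_iff, CommRingCat.hom_ofHom, RingHom.flat_algebraMap_iff]
    exact IsLocalization.flat K (nonZeroDivisors (ringAway K N))
  exact MorphismProperty.of_isPullback M.isPullback.flip this

theorem Model.surjectiveOnStalks_incl : SurjectiveOnStalks M.incl := by
  have := isFractionRing_ringAway K N
  have : SurjectiveOnStalks (genericPt K N) := by
    rw [genericPt, SurjectiveOnStalks.Spec_iff, CommRingCat.hom_ofHom]
    exact RingHom.surjectiveOnStalks_of_isLocalization (nonZeroDivisors (ringAway K N)) K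
  exact MorphismProperty.of_isPullback M.isPullback.flip this

theorem Model.isIso_stalkMap_incl (x : U) : IsIso (M.incl.stalkMap x) := by
  have := M.flat_incl
  have := M.surjectiveOnStalks_incl
  exact isIso_stalkMap_of_flat_of_surjectiveOnStalks _ _

theorem Model.exists_affineOpens_formallyEtale (W : M.scheme.affineOpens) :
    ∃ (W' : U.affineOpens) (h : W'.1 ≤ M.incl ⁻¹ᵁ W.1), W'.1 = M.incl ⁻¹ᵁ W.1 ∧
      (M.incl.appLE W.1 W'.1 h).hom.FormallyEtale := by
  have := isFractionRing_ringAway K N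
  have haff : IsAffineOpen (M.incl ⁻¹ᵁ W.1 ⊓ π ⁻¹ᵁ ⊤) := by
    have : IsAffineHom M.incl := MorphismProperty.of_isPullback M.isPullback.flip
      (inferInstanceAs (IsAffineHom (genericPt K N)))
    rw [Scheme.Hom.preimage_top, inf_top_eq]
    exact W.2.preimage M.incl
  have hpo := (isIso_pushoutSection_iff M.isPullback (US := ⊤) (UT := ⊤) (UX := W.1) le_top le_top
    rfl).1 (isIso_pushoutSection_of_isAffineOpen M.isPullback le_top le_top rfl
      (isAffineOpen_top _) (isAffineOpen_top _) W.2)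
  have hgen : ((genericPt K N).appLE ⊤ ⊤ le_top).hom.FormallyEtale := by
    have h1 : (algebraMap (ringAway K N) K).FormallyEtale := by
      rw [RingHom.formallyEtale_algebraMap]
      exact Algebra.FormallyEtale.of_isLocalization (nonZeroDivisors (ringAway K N))
    have h2 : (genericPt K N).appLE ⊤ ⊤ le_top =
        (Scheme.ΓSpecIso _).hom ≫ CommRingCat.ofHom (algebraMap (ringAway K N) K) ≫
          (Scheme.ΓSpecIso _).inv := by
      have h3 : (genericPt K N).appLE ⊤ ⊤ le_top = (genericPt K N).appTop :=
        (Scheme.Hom.app_eq_appLE _).symm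
      rw [h3, ← Scheme.ΓSpecIso_naturality_assoc, Iso.hom_inv_id, Category.comp_id]
      rfl
    rw [h2]
    exact (formallyEtale_of_bijective (Scheme.ΓSpecIso _).commRingCatIsoToRingEquiv.bijective).comp
      (h1.comp (formallyEtale_of_bijective
        (Scheme.ΓSpecIso _).commRingCatIsoToRingEquiv.symm.bijective))
  exact ⟨⟨_, haff⟩, inf_le_left, by simp, formallyEtale_of_isPushout hpo hgen⟩

end Model

end FormalLeaf

end

section

open AlgebraicGeometry CategoryTheory

namespace FormalLeaf

/-! ### Germs and restrictions -/

section Germ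

variable {Y : Scheme.{u}} {y : Y} {O : Type u} [CommRing O] (θ : Y.presheaf.stalk y ≃+* O)

/-- The germ at `y` of a function, in a ring `O` identified with the local ring by `θ`. -/
noncomputable def germHom (W : Y.Opens) (hW : y ∈ W) : Γ(Y, W) →+* O :=
  θ.toRingHom.comp (Y.presheaf.germ W y hW).hom

theorem germHom_map {W W' : Y.Opens} (h : W' ≤ W) (hW' : y ∈ W') (s : Γ(Y, W)) :
    germHom θ W' hW' ((Y.presheaf.map (homOfLE h).op).hom s) = germHom θ W (h hW') s :=
  congrArg θ (TopCat.Presheaf.germ_res_apply Y.presheaf (homOfLE h) y hW' s)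

theorem isUnit_germHom_iff {W : Y.Opens} (hW : y ∈ W) (s : Γ(Y, W)) :
    IsUnit (germHom θ W hW s) ↔ y ∈ Y.basicOpen s := by
  rw [Scheme.mem_basicOpen Y s y hW]
  exact isUnit_map_iff θ _

theorem exists_isLocalization_germHom {W : Y.Opens} (hW : IsAffineOpen W) (hy : y ∈ W) :
    ∃ S : Submonoid Γ(Y, W), @IsLocalization _ _ S O _ (germHom θ W hy).toAlgebra := by
  let _ := Y.presheaf.algebra_section_stalk ⟨y, hy⟩
  have := hW.isLocalization_stalk ⟨y, hy⟩
  let _ := (germHom θ W hy).toAlgebra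
  exact ⟨_, IsLocalization.isLocalization_of_algEquiv (hW.primeIdealOf ⟨y, hy⟩).asIdeal.primeCompl
    (AlgEquiv.ofRingEquiv (f := θ) fun _ => rfl)⟩

theorem formallyEtale_germHom {W : Y.Opens} (hW : IsAffineOpen W) (hy : y ∈ W) :
    (germHom θ W hy).FormallyEtale := by
  obtain ⟨S, hS⟩ := exists_isLocalization_germHom θ hW hy
  let _ := (germHom θ W hy).toAlgebra
  exact Algebra.FormallyEtale.of_isLocalization S

/-- Finitely many germs are the germs of functions on a common basic open subset. -/
theorem exists_germHom_eq {W : Y.Opens} (hW : IsAffineOpen W) (hy : y ∈ W) {n : ℕ}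
    (x : Fin n → O) : ∃ (s : Γ(Y, W)) (hs : y ∈ Y.basicOpen s)
      (x' : Fin n → Γ(Y, Y.basicOpen s)), ∀ i, germHom θ _ hs (x' i) = x i := by
  obtain ⟨S, hS⟩ := exists_isLocalization_germHom θ hW hy
  let _ := (germHom θ W hy).toAlgebra
  obtain ⟨s, hs⟩ := IsLocalization.exist_integer_multiples_of_finite S x
  choose β hβ using hs
  have hsu : IsUnit (germHom θ W hy s) := IsLocalization.map_units O s
  have hsy : y ∈ Y.basicOpen (s : Γ(Y, W)) := (isUnit_germHom_iff θ hy _).1 hsu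
  have hle := Y.basicOpen_le (s : Γ(Y, W))
  have hsu' : IsUnit ((Y.presheaf.map (homOfLE hle).op).hom (s : Γ(Y, W))) :=
    RingedSpace.isUnit_res_basicOpen _ _
  obtain ⟨t, ht⟩ := hsu'.exists_right_inv
  refine ⟨s, hsy, fun i => (Y.presheaf.map (homOfLE hle).op).hom (β i) * t, fun i => ?_⟩
  have h1 : germHom θ W hy (β i) = germHom θ W hy s * x i :=
    (hβ i).trans (Algebra.smul_def (s : Γ(Y, W)) (x i))
  have h2 := congrArg (germHom θ _ hsy) ht
  rw [map_mul, map_one, germHom_map] at h2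
  rw [map_mul, germHom_map, h1, mul_right_comm, h2, one_mul]

theorem formallyEtale_map_basicOpen {W : Y.Opens} (hW : IsAffineOpen W) (s : Γ(Y, W)) :
    (Y.presheaf.map (homOfLE (Y.basicOpen_le s)).op).hom.FormallyEtale := by
  have := hW.isLocalization_of_eq_basicOpen s (homOfLE (Y.basicOpen_le s)) rfl
  let _ := (Y.presheaf.map (homOfLE (Y.basicOpen_le s)).op).hom.toAlgebra
  exact Algebra.FormallyEtale.of_isLocalization (Submonoid.powers s)

end Germ

section Restrict

variable {R : CommRingCat.{u}} {Y : Scheme.{u}} {str : Y ⟶ Spec R} {d : ℕ}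

theorem map_baseHom {W W' : Y.Opens} (h : W' ≤ W) (r : R) :
    (Y.presheaf.map (homOfLE h).op).hom (baseHom str W r) = baseHom str W' r := by
  have h2 : str.appLE ⊤ W le_top ≫ Y.presheaf.map (homOfLE h).op = str.appLE ⊤ W' le_top :=
    Scheme.Hom.appLE_map _ _ _
  exact congrArg (fun f => ((Scheme.ΓSpecIso R).inv ≫ f).hom r) h2

/-- A frame of a foliation restricts to a frame. -/
theorem Foliation.exists_frame_restrict (fol : Foliation str d) {W W' : Y.affineOpens}
    (h : W'.1 ≤ W.1) (het : (Y.presheaf.map (homOfLE h).op).hom.FormallyEtale)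
    (b : Fin d → Derivation ℤ Γ(Y, W.1) Γ(Y, W.1))
    (hb : fol.sections W = Submodule.span _ (Set.range b)) :
    ∃ b' : Fin d → Derivation ℤ Γ(Y, W'.1) Γ(Y, W'.1),
      (∀ i a, b' i ((Y.presheaf.map (homOfLE h).op).hom a) =
        (Y.presheaf.map (homOfLE h).op).hom (b i a)) ∧
      fol.sections W' = Submodule.span _ (Set.range b') := by
  choose b' hb' using fun i => exists_derivation_extend_of_ringHom het (b i)
  have hmem (i : Fin d) : b i ∈ fol.sections W := by
    rw [hb]; exact Submodule.subset_span ⟨i, rfl⟩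
  refine ⟨b', hb', ?_⟩
  rw [fol.sections_restrict W W' h, pullbackDer]
  apply le_antisymm <;> rw [Submodule.span_le]
  · rintro E ⟨-, E₀, hE₀, hE⟩
    rw [hb, Submodule.mem_span_range_iff_exists_fun] at hE₀
    obtain ⟨a, rfl⟩ := hE₀
    have : E = ∑ i, (Y.presheaf.map (homOfLE h).op).hom (a i) • b' i := by
      algebraize [(Y.presheaf.map (homOfLE h).op).hom]
      have := formallyUnramified_of_formallyEtale het
      refine derivation_eq_of_formallyUnramified (S := Γ(Y, W.1)) fun z => ?_
      change E ((Y.presheaf.map (homOfLE h).op).hom z) =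
        (∑ i, (Y.presheaf.map (homOfLE h).op).hom (a i) • b' i)
          ((Y.presheaf.map (homOfLE h).op).hom z)
      rw [hE, derivation_sum_apply, derivation_sum_apply, map_sum]
      refine Finset.sum_congr rfl fun i _ => ?_
      rw [Derivation.smul_apply, Derivation.smul_apply, hb', smul_eq_mul, smul_eq_mul, map_mul]
    rw [this]
    exact Submodule.sum_mem _ fun i _ => Submodule.smul_mem _ _ (Submodule.subset_span ⟨i, rfl⟩)
  · rintro _ ⟨i, rfl⟩
    refine Submodule.subset_span ⟨fun r => ?_, b i, hmem i, hb' i⟩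
    rw [← map_baseHom h, hb', show b i (baseHom str W.1 r) = 0 from fol.sections_le W (hmem i) r,
      map_zero]

end Restrict

end FormalLeaf

end

section

open AlgebraicGeometry CategoryTheory

namespace FormalLeaf

/-! ### Frames of a foliation adapted to étale coordinates -/

theorem mem_of_sum_smul_basis_apply_mem_of_ringHom {R B ι : Type*} [CommRing R] [CommRing B]
    {β : R →+* B} (hβ : β.Smooth) [Fintype ι] (b : Module.Basis ι B (relDer β))
    (q : Ideal B) (c : ι → B) (h : ∀ z, ∑ i, c i * (b i : Derivation ℤ B B) z ∈ q) (i : ι) :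
    c i ∈ q := by
  algebraize [β]
  exact mem_of_sum_smul_basis_apply_mem (R := R) b q c h i

theorem smooth_baseHom {R : CommRingCat.{u}} {Y : Scheme.{u}} (str : Y ⟶ Spec R) [Smooth str]
    {W : Y.Opens} (hW : IsAffineOpen W) : (baseHom str W).Smooth := by
  have h := Smooth.smooth_appLE str (isAffineOpen_top (Spec R)) hW le_top
  exact RingHom.Smooth.respectsIso.2 _ (Scheme.ΓSpecIso R).symm.commRingCatIsoToRingEquiv h

/-- If the functions `x` at `y` are unramified coordinates, then a foliation has near `y` a frame
dual to some of them. -/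
theorem Foliation.exists_dual_frame {R : CommRingCat.{u}} {Y : Scheme.{u}} {str : Y ⟶ Spec R}
    [Smooth str] {d n : ℕ} (fol : Foliation str d) {y : Y} {K : Type u} [Field K] {O : Type u}
    [CommRing O] (θ : Y.presheaf.stalk y ≃+* O) (ε : O →+* K) [IsLocalHom ε] (j : R →+* K)
    (hj : ∀ (W : Y.Opens) (hW : y ∈ W) (r : R), ε (germHom θ W hW (baseHom str W r)) = j r)
    (hden : ∀ a : Fin d → K, ∃ r, j r ≠ 0 ∧ ∃ c : Fin d → R, ∀ i, j (c i) = j r * a i)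
    (x : Fin n → O)
    (hunr : ∀ δ : O →+ K, (∀ a b, δ (a * b) = ε a * δ b + ε b * δ a) → (∀ i, δ (x i) = 0) →
      δ = 0) :
    ∃ (W : Y.affineOpens) (hW : y ∈ W.1) (D : Fin d → Derivation ℤ Γ(Y, W.1) Γ(Y, W.1))
      (x' : Fin n → Γ(Y, W.1)) (J : Fin d → Fin n),
      (∀ i, germHom θ W.1 hW (x' i) = x i) ∧ (∀ i, D i ∈ fol.sections W) ∧
      (∀ i k, D i (x' (J k)) = if i = k then 1 else 0) ∧
      ∀ E ∈ fol.sections W, E = ∑ k, E (x' (J k)) • D k := by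
  classical
  obtain ⟨W₀, hy₀, m, b, hb⟩ := fol.exists_frame y
  obtain ⟨s, hs, x₁, hx₁⟩ := exists_germHom_eq θ W₀.2 hy₀ x
  let W₁ : Y.affineOpens := ⟨Y.basicOpen s, W₀.2.basicOpen s⟩
  obtain ⟨b₁, hb₁, hspan₁⟩ := fol.exists_frame_restrict (W := W₀) (W' := W₁) (Y.basicOpen_le s)
    (formallyEtale_map_basicOpen W₀.2 s) _ hb
  choose E hE using fun i => exists_derivation_extend_of_ringHom
    (formallyEtale_germHom θ W₁.2 hs) (b₁ i)
  -- the values of the frame on the coordinates at `y` form a matrix with independent rows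
  obtain ⟨J, hJ⟩ := exists_submatrix_det_ne_zero
    (Matrix.of fun i k => ε (germHom θ W₁.1 hs (b₁ i (x₁ k)))) (by
      intro w hw
      have hδ := hunr (AddMonoidHom.mk' (fun a => ∑ i, w i * ε (E i a)) fun a a' => by
          simp only [map_add, mul_add, Finset.sum_add_distrib])
        (fun a a' => by
          simp only [AddMonoidHom.mk'_apply, Derivation.leibniz, map_add, smul_eq_mul, map_mul,
            Finset.mul_sum, ← Finset.sum_add_distrib]
          exact Finset.sum_congr rfl fun i _ => by ring)
        (fun i => by
          rw [AddMonoidHom.mk'_apply, ← hx₁]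
          exact (Finset.sum_congr rfl fun l _ =>
            congrArg (fun t => w l * ε t) (hE l (x₁ i))).trans (hw i))
      obtain ⟨r, hr, c, hc⟩ := hden w
      have hz (z : Γ(Y, W₀.1)) :
          ∑ i, w i * ε (germHom θ W₀.1 hy₀ ((b (Sum.inl i) : Derivation ℤ _ _) z)) = 0 := by
        have h1 := DFunLike.congr_fun hδ (germHom θ W₀.1 hy₀ z)
        rw [AddMonoidHom.mk'_apply, AddMonoidHom.zero_apply] at h1
        rw [← h1]
        refine Finset.sum_congr rfl fun i _ => ?_
        rw [← germHom_map θ (Y.basicOpen_le s) hs, ← germHom_map θ (Y.basicOpen_le s) hs, hE]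
        exact congrArg (fun t => w i * ε (germHom θ _ hs t)) (hb₁ i z).symm
      funext i
      have h2 := mem_of_sum_smul_basis_apply_mem_of_ringHom (smooth_baseHom str W₀.2) b
        (RingHom.ker (ε.comp (germHom θ W₀.1 hy₀)))
        (Sum.elim (fun i => baseHom str W₀.1 (c i)) 0) (fun z => by
          rw [Fintype.sum_sum_type, RingHom.mem_ker, RingHom.comp_apply]
          simp only [Sum.elim_inl, Sum.elim_inr, Pi.zero_apply, zero_mul, Finset.sum_const_zero,
            add_zero, map_sum, map_mul, hj, hc, mul_assoc]
          rw [← Finset.mul_sum, hz, mul_zero]) (Sum.inl i)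
      rw [RingHom.mem_ker, RingHom.comp_apply, Sum.elim_inl, hj, hc] at h2
      exact (mul_eq_zero.1 h2).resolve_left hr)
  set M₁ : Matrix (Fin d) (Fin d) Γ(Y, W₁.1) := Matrix.of fun i k => b₁ i (x₁ (J k)) with hM₁
  have hdet : ε (germHom θ W₁.1 hs M₁.det) ≠ 0 := by
    rw [RingHom.map_det, RingHom.map_det]
    exact hJ
  have hy₂ : y ∈ Y.basicOpen M₁.det := by
    rw [← isUnit_germHom_iff θ hs]
    exact isUnit_of_map_unit ε _ hdet.isUnit
  let W₂ : Y.affineOpens := ⟨Y.basicOpen M₁.det, W₁.2.basicOpen M₁.det⟩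
  obtain ⟨b₂, hb₂, hspan₂⟩ := fol.exists_frame_restrict (W := W₁) (W' := W₂)
    (Y.basicOpen_le M₁.det) (formallyEtale_map_basicOpen W₁.2 M₁.det) _ hspan₁
  set res := (Y.presheaf.map (homOfLE (Y.basicOpen_le M₁.det)).op).hom with hres
  set M₂ : Matrix (Fin d) (Fin d) Γ(Y, W₂.1) :=
    Matrix.of fun i k => b₂ i (res (x₁ (J k))) with hM₂
  have hM₂' : M₂ = res.mapMatrix M₁ := by
    ext i k
    exact hb₂ i _
  have hunit : IsUnit M₂.det := by
    rw [hM₂', ← RingHom.map_det]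
    exact RingedSpace.isUnit_res_basicOpen _ _
  have hDx (i k : Fin d) :
      (∑ l, M₂⁻¹ i l • b₂ l) (res (x₁ (J k))) = if i = k then 1 else 0 := by
    rw [derivation_sum_apply]
    simp only [Derivation.smul_apply, smul_eq_mul]
    have := congrFun (congrFun (Matrix.nonsing_inv_mul M₂ hunit) i) k
    rwa [Matrix.mul_apply, Matrix.one_apply] at this
  refine ⟨W₂, hy₂, fun i => ∑ l, M₂⁻¹ i l • b₂ l, fun i => res (x₁ i), J, fun i => ?_, fun i => ?_,
    hDx, fun E hE => ?_⟩
  · exact (germHom_map θ (Y.basicOpen_le M₁.det) hy₂ _).trans (hx₁ i)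
  · rw [hspan₂]
    exact Submodule.sum_mem _ fun l _ => Submodule.smul_mem _ _ (Submodule.subset_span ⟨l, rfl⟩)
  · rw [hspan₂, Submodule.mem_span_range_iff_exists_fun] at hE
    obtain ⟨a, rfl⟩ := hE
    have h1 (k : Fin d) : (∑ i, a i • b₂ i) (res (x₁ (J k))) = (Matrix.vecMul a M₂) k := by
      rw [derivation_sum_apply]
      rfl
    simp only [h1, Finset.smul_sum, smul_smul]
    rw [Finset.sum_comm]
    refine Finset.sum_congr rfl fun l _ => ?_
    rw [← Finset.sum_smul]
    congr 1
    have h2 : Matrix.vecMul (Matrix.vecMul a M₂) M₂⁻¹ = a := by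
      rw [Matrix.vecMul_vecMul, Matrix.mul_nonsing_inv M₂ hunit, Matrix.vecMul_one]
    exact (congrFun h2 l).symm

end FormalLeaf

end

section

open AlgebraicGeometry CategoryTheory

namespace FormalLeaf

/-! ### Evaluation at the rational point -/

section BaseHom

theorem appLE_baseHom {R : CommRingCat.{u}} {X Y : Scheme.{u}} (f : X ⟶ Y) (str : Y ⟶ Spec R)
    {W : Y.Opens} {W' : X.Opens} (h : W' ≤ f ⁻¹ᵁ W) (r : R) :
    (f.appLE W W' h).hom (baseHom str W r) = baseHom (f ≫ str) W' r := by
  have h2 : str.appLE ⊤ W le_top ≫ f.appLE W W' h = (f ≫ str).appLE ⊤ W' le_top :=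
    Scheme.Hom.appLE_comp_appLE _ _ _ _ _ _ _
  exact congrArg (fun f => ((Scheme.ΓSpecIso R).inv ≫ f).hom r) h2

theorem baseHom_comp_specMap {R S : CommRingCat.{u}} {X : Scheme.{u}} (π : X ⟶ Spec S)
    (φ : R ⟶ S) (W : X.Opens) (r : R) :
    baseHom (π ≫ Spec.map φ) W r = baseHom π W (φ.hom r) := by
  have h1 : (Spec.map φ).appLE ⊤ ⊤ le_top ≫ π.appLE ⊤ W le_top =
      (π ≫ Spec.map φ).appLE ⊤ W le_top := Scheme.Hom.appLE_comp_appLE _ _ _ _ _ _ _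
  have h2 : (Spec.map φ).appLE ⊤ ⊤ le_top = (Spec.map φ).appTop :=
    (Scheme.Hom.app_eq_appLE _).symm
  have h3 : (Scheme.ΓSpecIso R).inv ≫ (π ≫ Spec.map φ).appLE ⊤ W le_top =
      φ ≫ (Scheme.ΓSpecIso S).inv ≫ π.appLE ⊤ W le_top := by
    rw [← h1, h2, ← Category.assoc, ← Scheme.ΓSpecIso_inv_naturality, Category.assoc]
  exact congrArg (fun f => f.hom r) h3

theorem germAt_appLE {X : Scheme.{u}} (U : X.Opens) (x : X) (hx : x ∈ U) (W : U.toScheme.Opens)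
    (hW : (⟨x, hx⟩ : U) ∈ W) (W' : X.Opens) (h : W ≤ U.ι ⁻¹ᵁ W') (s : Γ(X, W')) :
    germAt U x hx W hW ((U.ι.appLE W' W h).hom s) = X.presheaf.germ W' x (h hW) s := by
  have h1 : U.ι.appLE W' W h ≫ U.toScheme.presheaf.germ W ⟨x, hx⟩ hW =
      X.presheaf.germ W' x (h hW) ≫ (U.stalkIso ⟨x, hx⟩).inv := by
    rw [Scheme.Opens.stalkIso_inv]
    refine Eq.trans ?_ (Scheme.Hom.germ_stalkMap U.ι W' ⟨x, hx⟩ (h hW)).symm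
    rw [Scheme.Hom.appLE, Category.assoc]
    exact congrArg (U.ι.app W' ≫ ·) (TopCat.Presheaf.germ_res _ _ _ _)
  have h2 : U.ι.appLE W' W h ≫ U.toScheme.presheaf.germ W ⟨x, hx⟩ hW ≫
      (U.stalkIso ⟨x, hx⟩).hom = X.presheaf.germ W' x (h hW) := by
    rw [← Category.assoc, h1, Category.assoc, Iso.inv_hom_id, Category.comp_id]
  exact congrArg (fun f => f.hom s) h2

theorem germAt_baseHom {R : CommRingCat.{u}} {X : Scheme.{u}} (π : X ⟶ Spec R) (U : X.Opens)
    (x : X) (hx : x ∈ U) (W : U.toScheme.Opens) (hW : (⟨x, hx⟩ : U) ∈ W) (a : R) :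
    germAt U x hx W hW (baseHom (U.ι ≫ π) W a) =
      (X.presheaf.germ ⊤ x trivial).hom (baseHom π ⊤ a) := by
  rw [← appLE_baseHom U.ι π (W := ⊤) le_top]
  exact germAt_appLE U x hx W hW ⊤ le_top _

end BaseHom

section EvalAt

variable {K : Type u} [Field K] {X : Scheme.{u}} (P : Spec (CommRingCat.of K) ⟶ X)

/-- The value at a rational point of a germ of function. -/
noncomputable def evalAt : X.presheaf.stalk (ratPoint P) →+* K :=
  (Scheme.stalkClosedPointTo P).hom

instance isLocalHom_evalAt : IsLocalHom (evalAt P) :=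
  Scheme.isLocalHom_stalkClosedPointTo' P

theorem evalAt_constStalk {π : X ⟶ Spec (CommRingCat.of K)} (hP : P ≫ π = 𝟙 _) (a : K) :
    evalAt P (constStalk π (ratPoint P) a) = a := by
  have h1 : π.appLE ⊤ ⊤ le_top = π.app ⊤ := (Scheme.Hom.app_eq_appLE _).symm
  have h2 : (Spec (CommRingCat.of K)).presheaf.germ ⊤ (π (ratPoint P)) trivial ≫
      π.stalkMap (ratPoint P) = π.app ⊤ ≫ X.presheaf.germ ⊤ (ratPoint P) trivial :=
    Scheme.Hom.germ_stalkMap π ⊤ (ratPoint P) trivial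
  have h3 : Scheme.stalkClosedPointTo (P ≫ π) = π.stalkMap (ratPoint P) ≫
    Scheme.stalkClosedPointTo P := Scheme.stalkClosedPointTo_comp P π
  have h4 : (Spec (CommRingCat.of K)).presheaf.germ ⊤ ((P ≫ π) (IsLocalRing.closedPoint K))
      trivial ≫ Scheme.stalkClosedPointTo (P ≫ π) = (Scheme.ΓSpecIso (CommRingCat.of K)).hom := by
    have h5 : P ≫ π = Spec.map (𝟙 (CommRingCat.of K)) := by rw [hP, Spec.map_id]
    rw [h5]
    exact (Scheme.germ_stalkClosedPointTo_Spec _).trans (Category.comp_id _)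
  set a' := (Scheme.ΓSpecIso (CommRingCat.of K)).inv.hom a with ha'
  have e1 := congrArg (fun f => (Scheme.stalkClosedPointTo P).hom
    ((X.presheaf.germ ⊤ (ratPoint P) trivial).hom (f.hom a'))) h1
  have e2 := congrArg (fun f => (Scheme.stalkClosedPointTo P).hom (f.hom a')) h2
  have e3 := congrArg (fun f => f.hom (((Spec (CommRingCat.of K)).presheaf.germ ⊤
    (π (ratPoint P)) trivial).hom a')) h3
  have e4 := congrArg (fun f => f.hom a') h4
  have e5 := congrArg (fun f => f.hom a) (Scheme.ΓSpecIso (CommRingCat.of K)).inv_hom_id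
  exact e1.trans (e2.symm.trans (e3.symm.trans (e4.trans e5)))

end EvalAt

/-! ### Étale charts are unramified coordinates -/

section Chart

variable {K : Type u} [Field K] {X : Scheme.{u}} {π : X ⟶ Spec (CommRingCat.of K)}
  {P : Spec (CommRingCat.of K) ⟶ X} {n : ℕ}

theorem formallyUnramified_of_bijective {R S : Type*} [CommRing R] [CommRing S] {f : R →+* S}
    (hf : Function.Bijective f) : f.FormallyUnramified :=
  formallyUnramified_of_formallyEtale (formallyEtale_of_bijective hf)

theorem formallyUnramified_germ {Y : Scheme.{u}} {W : Y.Opens} (hW : IsAffineOpen W) {y : Y}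
    (hy : y ∈ W) : (Y.presheaf.germ W y hy).hom.FormallyUnramified :=
  formallyUnramified_of_formallyEtale (formallyEtale_germHom (RingEquiv.refl _) hW hy)

/-- The ring of functions on affine space is the polynomial ring. -/
theorem exists_bijective_affineSpace (R : CommRingCat.{u}) (σ : Type u) :
    ∃ e : MvPolynomial σ R →+* Γ(AffineSpace σ (Spec R), ⊤), Function.Bijective e ∧
      (∀ a, e (MvPolynomial.C a) = baseHom (AffineSpace σ (Spec R) ↘ Spec R) ⊤ a) ∧
      ∀ i, e (MvPolynomial.X i) = AffineSpace.coord _ i := by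
  have h (p : MvPolynomial σ R) := congrArg (fun f => f.hom p)
    (congrArg ((Scheme.ΓSpecIso _).inv ≫ ·) (AffineSpace.SpecIso_hom_appTop (n := σ) R))
  refine ⟨((Scheme.ΓSpecIso (CommRingCat.of (MvPolynomial σ R))).inv ≫
    (AffineSpace.SpecIso σ R).hom.appTop).hom, ?_, fun a => ?_, fun i => ?_⟩
  · exact ((Scheme.ΓSpecIso (CommRingCat.of (MvPolynomial σ R))).symm ≪≫
      Scheme.Γ.mapIso (AffineSpace.SpecIso σ R).op).commRingCatIsoToRingEquiv.bijective
  · refine (h _).trans ?_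
    have h1 : (AffineSpace σ (Spec R) ↘ Spec R).appLE ⊤ ⊤ le_top =
      (AffineSpace σ (Spec R) ↘ Spec R).appTop := (Scheme.Hom.app_eq_appLE _).symm
    rw [baseHom, h1]
    simp
  · refine (h _).trans ?_
    simp

theorem EtaleChart.exists_formallyUnramified (c : EtaleChart π P n) :
    ∃ Φ : MvPolynomial (ULift.{u} (Fin n)) K →+* X.presheaf.stalk (ratPoint P),
      Φ.FormallyUnramified ∧ ∀ i, Φ (MvPolynomial.X i) =
        germAt c.nbhd (ratPoint P) c.mem ⊤ trivial (c.coord i.down) := by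
  have := c.etale
  set f := AffineSpace.homOfVector (n := ULift.{u} (Fin n)) (c.nbhd.ι ≫ π)
    fun i => c.coord i.down with hf
  have : FormallyUnramified f := inferInstance
  let y : c.nbhd := ⟨ratPoint P, c.mem⟩
  obtain ⟨e₁, he₁, -, hX⟩ := exists_bijective_affineSpace (CommRingCat.of K) (ULift.{u} (Fin n))
  have h1 : e₁.FormallyUnramified := formallyUnramified_of_bijective he₁
  have h2 := formallyUnramified_germ (isAffineOpen_top
    (AffineSpace (ULift.{u} (Fin n)) (Spec (CommRingCat.of K)))) (y := f y) trivial
  have h3 := FormallyUnramified.stalkMap f y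
  have h4 : (c.nbhd.stalkIso y).hom.hom.FormallyUnramified :=
    formallyUnramified_of_bijective (c.nbhd.stalkIso y).commRingCatIsoToRingEquiv.bijective
  refine ⟨_, ((h1.comp h2).comp h3).comp h4, fun i => ?_⟩
  have h5 := hX i
  have h7 : f.app ⊤ (AffineSpace.coord _ i) = c.coord i.down :=
    AffineSpace.homOfVector_appTop_coord _ _ _
  have h8 := congrArg (fun g => (c.nbhd.stalkIso y).hom.hom (g.hom (AffineSpace.coord _ i)))
    (Scheme.Hom.germ_stalkMap f ⊤ y trivial)
  have h9 := congrArg (fun t => germAt c.nbhd (ratPoint P) c.mem ⊤ trivial t) h7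
  have h10 := congrArg (fun t => (c.nbhd.stalkIso y).hom.hom ((f.stalkMap y).hom
    (((AffineSpace (ULift.{u} (Fin n)) (Spec (CommRingCat.of K))).presheaf.germ ⊤ (f y)
      trivial).hom t))) h5
  exact h10.trans (h8.trans h9)

/-- A derivation at `P` is determined by its values on the coordinates of a chart. -/
theorem EtaleChart.eq_zero_of_derivation [NumberField K] (c : EtaleChart π P n)
    (δ : X.presheaf.stalk (ratPoint P) →+ K)
    (hδ : ∀ a b, δ (a * b) = evalAt P a * δ b + evalAt P b * δ a)
    (h0 : ∀ i, δ (germAt c.nbhd (ratPoint P) c.mem ⊤ trivial (c.coord i)) = 0) : δ = 0 := by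
  obtain ⟨Φ, hΦ, hΦX⟩ := c.exists_formallyUnramified
  let _ : Module (X.presheaf.stalk (ratPoint P)) K := Module.compHom K (evalAt P)
  let Δ : Derivation ℤ (X.presheaf.stalk (ratPoint P)) K :=
    Derivation.mk' δ.toIntLinearMap hδ
  have hΔ : ∀ p, Δ (Φ p) = 0 := by
    intro p
    induction p using MvPolynomial.induction_on with
    | C a => exact derivation_apply_numberField (Φ.comp MvPolynomial.C) Δ a
    | add p q hp hq => rw [map_add, map_add, hp, hq, add_zero]
    | mul_X p i hp =>
      have h1 : Δ (Φ (MvPolynomial.X i)) = 0 := by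
        rw [hΦX]
        exact h0 i.down
      rw [map_mul, Derivation.leibniz, hp, h1, smul_zero, smul_zero, add_zero]
  algebraize [Φ]
  have h2 : Δ = 0 := derivation_eq_of_formallyUnramified
    (S := MvPolynomial (ULift.{u} (Fin n)) K) fun p => hΔ p
  ext a
  exact DFunLike.congr_fun h2 a

end Chart

end FormalLeaf

end

section

open AlgebraicGeometry CategoryTheory IsDedekindDomain NumberField
open scoped NumberField

namespace FormalLeaf

/-! ### The local ring of the generic fibre and the model -/

section Compare

variable {K : Type u} [Field K] {X : Scheme.{u}} {π : X ⟶ Spec (CommRingCat.of K)}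
  {U : X.Opens} {d N : ℕ} {F : Foliation (U.ι ≫ π) d} (M : Model F N)

theorem Model.appLE_baseHom {W : M.scheme.Opens} {W' : U.toScheme.Opens}
    (h : W' ≤ M.incl ⁻¹ᵁ W) (r : ringAway K N) :
    (M.incl.appLE W W' h).hom (baseHom M.str W r) = baseHom (U.ι ≫ π) W' (r : K) := by
  refine (FormalLeaf.appLE_baseHom M.incl M.str h r).trans ?_
  have h1 : baseHom (M.incl ≫ M.str) W' =
    baseHom ((U.ι ≫ π) ≫ Spec.map (CommRingCat.ofHom (algebraMap (ringAway K N) K))) W' :=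
    congrArg (fun f => baseHom f W') M.isPullback.w
  exact (DFunLike.congr_fun h1 r).trans (baseHom_comp_specMap _ _ _ _)

variable [NumberField K] {x : X} (hx : x ∈ U)

/-- The local ring of a model at a point of the generic fibre is that of the generic fibre. -/
noncomputable def Model.stalkEquiv :
    M.scheme.presheaf.stalk (M.incl (⟨x, hx⟩ : U)) ≃+* X.presheaf.stalk x :=
  have := M.isIso_stalkMap_incl (⟨x, hx⟩ : U)
  (asIso (M.incl.stalkMap (⟨x, hx⟩ : U)) ≪≫ U.stalkIso ⟨x, hx⟩).commRingCatIsoToRingEquiv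

theorem Model.germHom_stalkEquiv {W : M.scheme.Opens} {W' : U.toScheme.Opens}
    (h : W' ≤ M.incl ⁻¹ᵁ W) (hW' : (⟨x, hx⟩ : U) ∈ W') (s : Γ(M.scheme, W)) :
    germHom (M.stalkEquiv hx) W (h hW') s =
      germAt U x hx W' hW' ((M.incl.appLE W W' h).hom s) := by
  have h1 : M.incl.appLE W W' h ≫ U.toScheme.presheaf.germ W' ⟨x, hx⟩ hW' =
      M.scheme.presheaf.germ W (M.incl (⟨x, hx⟩ : U)) (h hW') ≫ M.incl.stalkMap ⟨x, hx⟩ := by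
    refine Eq.trans ?_ (Scheme.Hom.germ_stalkMap M.incl W ⟨x, hx⟩ (h hW')).symm
    rw [Scheme.Hom.appLE, Category.assoc]
    exact congrArg (M.incl.app W ≫ ·) (TopCat.Presheaf.germ_res _ _ _ _)
  exact congrArg (fun f => (U.stalkIso ⟨x, hx⟩).hom.hom (f.hom s)) h1.symm

theorem Model.germHom_baseHom {W : M.scheme.Opens} (hW : M.incl (⟨x, hx⟩ : U) ∈ W)
    (r : ringAway K N) :
    germHom (M.stalkEquiv hx) W hW (baseHom M.str W r) = constStalk π x (r : K) := by
  refine (M.germHom_stalkEquiv hx (W' := M.incl ⁻¹ᵁ W) le_rfl hW _).trans ?_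
  rw [M.appLE_baseHom]
  exact germAt_baseHom π U x hx _ _ _

theorem Model.finiteType_int_sections {W : M.scheme.Opens} (hW : IsAffineOpen W) :
    Algebra.FiniteType ℤ Γ(M.scheme, W) := by
  have := M.smooth
  have h1 : (baseHom M.str W).FiniteType := by
    have h2 := smooth_baseHom M.str hW
    algebraize [baseHom M.str W]
    exact inferInstanceAs (Algebra.FiniteType (ringAway K N) Γ(M.scheme, W))
  algebraize [baseHom M.str W]
  exact Algebra.FiniteType.trans (S := ringAway K N) finiteType_int_ringAway h1

/-- The derivations of the local ring of `X` which extend sections of the foliation of a model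
preserve the ideal of the formal leaf. -/
theorem Model.completionDer_mem {P : Spec (CommRingCat.of K) ⟶ X} (hPU : ratPoint P ∈ U)
    {V : SmoothFormalSubscheme π P d} (hV : V.IsFormalLeaf hPU F) {W : M.scheme.affineOpens}
    (hW : M.incl (⟨ratPoint P, hPU⟩ : U) ∈ W.1) {D : Derivation ℤ Γ(M.scheme, W.1) Γ(M.scheme, W.1)}
    (hD : D ∈ M.fol.sections W)
    {E : Derivation ℤ (X.presheaf.stalk (ratPoint P)) (X.presheaf.stalk (ratPoint P))}
    (hED : ∀ b, E (germHom (M.stalkEquiv hPU) W.1 hW b) = germHom (M.stalkEquiv hPU) W.1 hW (D b)) :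
    ∀ g ∈ V.ideal, completionDer (IsLocalRing.maximalIdeal (X.presheaf.stalk (ratPoint P))) E g ∈
      V.ideal := by
  obtain ⟨W', h, hW', het⟩ := M.exists_affineOpens_formallyEtale W
  have hmem : (⟨ratPoint P, hPU⟩ : U) ∈ W'.1 := by rw [hW']; exact hW
  obtain ⟨D', hD'⟩ := exists_derivation_extend_of_ringHom het D
  have hD'F : D' ∈ F.sections W' := by
    rw [M.fol_generic W W' h]
    exact Submodule.subset_span ⟨fun a => derivation_apply_numberField (baseHom (U.ι ≫ π) W'.1) D' a,
      D, hD, hD'⟩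
  have hED' := derivation_comp_eq_of_formallyUnramified (formallyUnramified_of_formallyEtale het)
    (germAt U (ratPoint P) hPU W'.1 hmem) D' E fun a => by
      rw [← M.germHom_stalkEquiv hPU h hmem, hED, hD', M.germHom_stalkEquiv hPU h hmem]
  refine hV W' hmem _ (Submodule.subset_span ⟨fun a => ?_, D', hD'F, fun a => ?_⟩)
  · exact derivation_apply_numberField (constHat π (ratPoint P)) _ a
  · rw [RingHom.comp_apply, RingHom.comp_apply, completionDer_algebraMap, hED']

end Compare

/-! ### The bound in a chart -/

/-- The frame found near `P` on a model of the foliation satisfies the hypotheses of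
`alphaAffine_comap_evalHat_le_zero`. -/
theorem EtaleChart.alphaAffine_pushforward_le_zero {K : Type u} [Field K] [NumberField K]
    {X : Scheme.{u}} {π : X ⟶ Spec (CommRingCat.of K)} {P : Spec (CommRingCat.of K) ⟶ X}
    (hP : P ≫ π = 𝟙 _) {U : X.Opens} (hPU : ratPoint P ∈ U) {d : ℕ} {F : Foliation (U.ι ≫ π) d}
    (hF : F.AlmostAllPCurvaturesVanish) {V : SmoothFormalSubscheme π P d}
    (hV : V.IsFormalLeaf hPU F) {n : ℕ} (c : EtaleChart π P n) :
    alphaAffine d (c.pushforward V) ≤ 0 := by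
  obtain ⟨N, hN, M, hfin⟩ := hF
  have := M.smooth
  obtain ⟨e, -⟩ := V.smooth
  have hconst {W : M.scheme.Opens} (hW : M.incl (⟨ratPoint P, hPU⟩ : U) ∈ W) (r : ringAway K N) :
      evalAt P (germHom (M.stalkEquiv hPU) W hW (baseHom M.str W r)) = r := by
    rw [M.germHom_baseHom, evalAt_constStalk P hP]
  obtain ⟨W, hW, D, x', J, hx', hD, hJ, hspan⟩ := M.fol.exists_dual_frame (M.stalkEquiv hPU)
    (evalAt P) (algebraMap (ringAway K N) K) (fun W hW r => hconst hW r) exists_common_denominator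
    (fun i => germAt c.nbhd (ratPoint P) c.mem ⊤ trivial (c.coord i))
    (fun δ hδ h0 => c.eq_zero_of_derivation δ hδ h0)
  have hcomm := frame_comm (x := fun k => x' (J k)) hD hJ hspan (M.fol.involutive W)
  have het := formallyEtale_germHom (M.stalkEquiv hPU) W.2 hW
  choose E hED using fun i => exists_derivation_extend_of_ringHom het (D i)
  have hft := M.finiteType_int_sections W.2
  have hnoeth : IsNoetherianRing (X.presheaf.stalk (ratPoint P)) := by
    have := Algebra.FiniteType.isNoetherianRing ℤ Γ(M.scheme, W.1)
    obtain ⟨S, hS⟩ := exists_isLocalization_germHom (M.stalkEquiv hPU) W.2 hW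
    let _ := (germHom (M.stalkEquiv hPU) W.1 hW).toAlgebra
    exact IsLocalization.isNoetherianRing S _ this
  have hE (i j : Fin d) (a : X.presheaf.stalk (ratPoint P)) : E i (E j a) = E j (E i a) := by
    have h1 : ⁅E i, E j⁆ = 0 := by
      algebraize [germHom (M.stalkEquiv hPU) W.1 hW]
      have := formallyUnramified_of_formallyEtale het
      refine derivation_eq_of_formallyUnramified (S := Γ(M.scheme, W.1)) fun b => ?_
      change ⁅E i, E j⁆ (germHom (M.stalkEquiv hPU) W.1 hW b) = 0
      rw [Derivation.commutator_apply, hED, hED, hED, hED, hcomm, sub_self]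
    have h2 := DFunLike.congr_fun h1 a
    rwa [Derivation.commutator_apply, Derivation.zero_apply, sub_eq_zero] at h2
  refine alphaAffine_comap_evalHat_le_zero (constStalk π (ratPoint P)) (evalAt P)
    (evalAt_constStalk P hP) e _ c.vanish (germHom (M.stalkEquiv hPU) W.1 hW) D hcomm x' hx' J hJ E
    hE hED (fun i => M.completionDer_mem hPU hV hW (hD i) (hED i)) ?_
  refine finite_setOf_place_of_maximalSpectrum hN.ne' hfin fun 𝔭 v h𝔭 hlt hchar =>
    ⟨baseHom M.str W.1 '' 𝔭.asIdeal, ?_, fun i b => ?_⟩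
  · rintro _ ⟨r, hr, rfl⟩
    refine ⟨?_, fun i => M.fol.sections_le W (hD i) r⟩
    rw [hconst]
    exact hlt r hr
  · rw [← hchar]
    refine iterate_mem_map_of_stable (baseHom M.str W.1) 𝔭.asIdeal (x := fun k => x' (J k)) ?_
      (M.fol.sections_le W) hD hJ hspan (h𝔭 W) i b
    rw [hchar]
    exact (prime_residueChar v).two_le

end FormalLeaf

end

section

open AlgebraicGeometry CategoryTheory

namespace FormalLeaf

/-! ### Existence of étale charts -/

theorem bijective_appLE_of_isOpenImmersion {X Y : Scheme.{u}} (f : X ⟶ Y) [IsOpenImmersion f]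
    {V : Y.Opens} (hV : V ≤ f.opensRange) {W : X.Opens} (hW : W = f ⁻¹ᵁ V) :
    Function.Bijective (f.appLE V W hW.le).hom := by
  subst hW
  have h1 : f.appLE V (f ⁻¹ᵁ V) le_rfl = f.app V := (Scheme.Hom.app_eq_appLE _).symm
  have := f.isIso_app V hV
  rw [h1]
  exact (asIso (f.app V)).commRingCatIsoToRingEquiv.bijective

theorem isStandardSmooth_of_comp_bijective {R S T : Type u} [CommRing R] [CommRing S] [CommRing T]
    {f : R →+* S} {g : S →+* T} (hg : Function.Bijective g)
    (h : (g.comp f).IsStandardSmooth) : f.IsStandardSmooth := by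
  have h1 := RingHom.isStandardSmooth_respectsIso.1 _ (RingEquiv.ofBijective g hg).symm h
  convert! h1
  ext a
  exact ((RingEquiv.ofBijective g hg).symm_apply_apply (f a)).symm

/-- A smooth point has an affine open neighbourhood whose ring is standard smooth. -/
theorem exists_isStandardSmooth_baseHom {K : Type u} [Field K] {X : Scheme.{u}}
    (π : X ⟶ Spec (CommRingCat.of K)) (U : X.Opens) [Smooth (U.ι ≫ π)] {x : X} (hx : x ∈ U) :
    ∃ V : X.Opens, x ∈ V ∧ IsAffineOpen V ∧
      (baseHom (V.ι ≫ π) ⊤ : K →+* _).IsStandardSmooth := by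
  obtain ⟨T, -, W, hW, hxW, e, h⟩ := Smooth.exists_isStandardSmooth (U.ι ≫ π) ⟨x, hx⟩
  -- the spectrum of a field has a single point
  have hT : T = ⊤ := by
    rw [eq_top_iff]
    intro t _
    have : t = (U.ι ≫ π) ⟨x, hx⟩ :=
      Subsingleton.elim (α := PrimeSpectrum K) _ _
    rw [this]
    exact e hxW
  subst hT
  have h1 : (baseHom (U.ι ≫ π) W : K →+* _).IsStandardSmooth :=
    RingHom.isStandardSmooth_respectsIso.2 _
      (Scheme.ΓSpecIso (CommRingCat.of K)).symm.commRingCatIsoToRingEquiv h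
  have hpre : W = U.ι ⁻¹ᵁ (U.ι ''ᵁ W) := (U.ι.preimage_image_eq W).symm
  have hb := bijective_appLE_of_isOpenImmersion U.ι (V := U.ι ''ᵁ W)
    (Scheme.Hom.image_le_opensRange _ _) hpre
  have h2 : (baseHom π (U.ι ''ᵁ W) : K →+* _).IsStandardSmooth := by
    refine isStandardSmooth_of_comp_bijective hb ?_
    convert! h1
    ext a
    exact appLE_baseHom U.ι π hpre.le a
  refine ⟨U.ι ''ᵁ W, ⟨⟨x, hx⟩, hxW, rfl⟩, hW.image_of_isOpenImmersion U.ι, ?_⟩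
  set V := U.ι ''ᵁ W
  have hpre' : (⊤ : V.toScheme.Opens) = V.ι ⁻¹ᵁ V := (Scheme.Opens.ι_preimage_self V).symm
  have hb' := bijective_appLE_of_isOpenImmersion V.ι (V := V) (by rw [Scheme.Opens.opensRange_ι])
    hpre'
  have h3 := RingHom.isStandardSmooth_respectsIso.1 _ (RingEquiv.ofBijective _ hb') h2
  convert! h3
  ext a
  exact (appLE_baseHom V.ι π hpre'.le a).symm

/-- An étale homomorphism from a polynomial ring gives an étale map to affine space. -/
theorem etale_homOfVector {R : CommRingCat.{u}} {Y : Scheme.{u}} [IsAffine Y] (q : Y ⟶ Spec R)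
    {σ : Type u} (ψ : MvPolynomial σ R →+* Γ(Y, ⊤)) (hψ : ψ.Etale)
    (hC : ∀ a, ψ (MvPolynomial.C a) = baseHom q ⊤ a) :
    Etale (AffineSpace.homOfVector (n := σ) q fun i => ψ (MvPolynomial.X i)) := by
  set f := AffineSpace.homOfVector (n := σ) q fun i => ψ (MvPolynomial.X i) with hf
  obtain ⟨e, he, heC, heX⟩ := exists_bijective_affineSpace R σ
  rw [HasRingHomProperty.iff_of_isAffine (P := @Etale)]
  have hover : f ≫ (AffineSpace σ (Spec R) ↘ Spec R) = q := AffineSpace.homOfVector_over _ _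
  have h1 : f.appTop.hom.comp e = ψ := by
    refine MvPolynomial.ringHom_ext (fun a => ?_) fun i => ?_
    · rw [RingHom.comp_apply, heC, hC]
      have h2 : f.appLE ⊤ ⊤ le_top = f.appTop := (Scheme.Hom.app_eq_appLE _).symm
      have h3 := appLE_baseHom f (AffineSpace σ (Spec R) ↘ Spec R) (W := ⊤) (W' := ⊤) le_top a
      rw [h2] at h3
      exact h3.trans (congrArg (fun q => baseHom q ⊤ a) hover)
    · rw [RingHom.comp_apply, heX]
      exact AffineSpace.homOfVector_appTop_coord _ _ _
  have h2 := RingHom.Etale.respectsIso.2 _ (RingEquiv.ofBijective e he).symm hψ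
  convert! h2
  ext z
  obtain ⟨p, rfl⟩ := he.2 z
  rw [← h1]
  exact congrArg (fun p => f.appTop.hom (e p))
    ((RingEquiv.ofBijective e he).symm_apply_apply p).symm

theorem bijective_aeval_X_sub_C {K σ τ : Type*} [CommRing K] (e : σ ≃ τ) (a : τ → K) :
    Function.Bijective (MvPolynomial.aeval (R := K)
      fun i : σ => (MvPolynomial.X (e i) - MvPolynomial.C (a (e i)) : MvPolynomial τ K)) := by
  refine Function.bijective_iff_has_inverse.2 ⟨MvPolynomial.aeval
    fun i : τ => (MvPolynomial.X (e.symm i) + MvPolynomial.C (a i) : MvPolynomial σ K),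
    DFunLike.congr_fun (f := (MvPolynomial.aeval _).comp (MvPolynomial.aeval _))
      (g := AlgHom.id K _) ?_,
    DFunLike.congr_fun (f := (MvPolynomial.aeval _).comp (MvPolynomial.aeval _))
      (g := AlgHom.id K _) ?_⟩
  all_goals
    ext i : 1
    simp [MvPolynomial.algebraMap_eq]

/-- Standard smooth coordinates, translated so that they vanish at `P`, form an étale chart. -/
theorem exists_etaleChart {K : Type u} [Field K] {X : Scheme.{u}}
    (π : X ⟶ Spec (CommRingCat.of K)) (P : Spec (CommRingCat.of K) ⟶ X) (hP : P ≫ π = 𝟙 _)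
    (U : X.Opens) (hPU : ratPoint P ∈ U) [Smooth (U.ι ≫ π)] :
    ∃ n, Nonempty (EtaleChart π P n) := by
  obtain ⟨V, hPV, hV, hk⟩ := exists_isStandardSmooth_baseHom π U hPU
  obtain ⟨n, φ, hφC, hφ⟩ := hk.exists_etale_mvPolynomial
  have : IsAffine V.toScheme := hV
  let g (i : Fin n) := germAt V (ratPoint P) hPV ⊤ trivial (φ (MvPolynomial.X i))
  have hbij := bijective_aeval_X_sub_C (K := K) Equiv.ulift.{u} fun i => evalAt P (g i)
  -- a translation of affine space moves the image of `P` to the origin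
  let ψ := φ.comp (MvPolynomial.aeval (R := K) fun i : ULift.{u} (Fin n) =>
    (MvPolynomial.X i.down - MvPolynomial.C (evalAt P (g i.down)) :
      MvPolynomial (Fin n) K)).toRingHom
  have hψ : ψ.Etale := RingHom.Etale.stableUnderComposition _ _ (RingHom.Etale.of_bijective hbij) hφ
  have hC (a : K) : φ (MvPolynomial.C a) = baseHom (V.ι ≫ π) ⊤ a := DFunLike.congr_fun hφC a
  refine ⟨n, ⟨V, hPV, fun i => ψ (MvPolynomial.X ⟨i⟩),
    etale_homOfVector (R := CommRingCat.of K) (V.ι ≫ π) ψ hψ fun a => ?_, fun i => ?_⟩⟩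
  · refine Eq.trans ?_ (hC a)
    simp [ψ, MvPolynomial.algebraMap_eq]
  · have h1 : ψ (MvPolynomial.X ⟨i⟩) =
        φ (MvPolynomial.X i) - baseHom (V.ι ≫ π) ⊤ (evalAt P (g i)) := by
      rw [← hC, ← map_sub]
      simp [ψ]
    rw [IsLocalRing.mem_maximalIdeal, mem_nonunits_iff]
    intro hu
    refine (hu.map (evalAt P)).ne_zero ?_
    rw [h1, map_sub, map_sub, sub_eq_zero]
    exact ((congrArg (evalAt P) (germAt_baseHom π V (ratPoint P) hPV ⊤ trivial _)).trans
      (evalAt_constStalk P hP _)).symm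

end FormalLeaf

end

theorem mainTheorem5 {K : Type u} [Field K] [NumberField K] {X : Scheme.{u}}
    (π : X ⟶ Spec (CommRingCat.of K)) (hX : IsProjectiveOver π)
    (P : Spec (CommRingCat.of K) ⟶ X) (hP : P ≫ π = 𝟙 _)
    (U : X.Opens) (hPU : ratPoint P ∈ U) (hU : Smooth (U.ι ≫ π))
    {d : ℕ} (F : Foliation (U.ι ≫ π) d) (hF : F.AlmostAllPCurvaturesVanish)
    (V : SmoothFormalSubscheme π P d) (hV : V.IsFormalLeaf hPU F) :
    V.IsAnalyticOfType 0 := by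
  refine ⟨exists_etaleChart π P hP U hPU, fun n c => ?_⟩
  rw [ENNReal.coe_zero]
  exact c.alphaAffine_pushforward_le_zero hP hPU hF hV
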